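/- Let $\Gamma=(V,E,s,t)$ be a row-finite digraph (loops and parallel arrows allowed; every vertex emits finitely many arrows), let $\mathbb F$ be a field, and let $L=L_{\mathbb F}(\Gamma)$ be the Leavitt path algebra: the $\mathbb F$-algebra (unital only if $V$ is finite) generated by $V\sqcup E\sqcup E^*$ subject to $vw=\delta_{v,w}v$; $s(e)e=e=e\,t(e)$ and $t(e)e^*=e^*=e^*s(e)$; $e^*f=\delta_{e,f}t(e)$; and $v=\sum_{s(e)=v}ee^*$ for every $v$ with $0<|s^{-1}(v)|<\infty$. Modules are right $L$-modules $M$ with $ML=M$. The support of $M$ is the induced subgraph on $\{v\in V: Mv\neq 0\}$. A cycle is a closed path $e_1\cdots e_n$, $n>0$, with pairwise distinct sources, considered up to rotation. The predecessors of a vertex $w$ are the vertices from which there is a path (possibly of length $0$) to $w$; the predecessors of a cycle are those of its vertices. A sink is maximal if there is no path from any cycle to it; a cycle is maximal if there is no path from any other cycle to it. Let $W$ be the set of maximal sinks and maximal cycles having finitely many predecessors. Put $\mathcal P=\{f\in\mathbb F[x]: f \text{ irreducible},\ f(0)=1\}$. For a vertex $v$ on a cycle $C$ let $C_v$ denote the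 closed path obtained by running once around $C$ from $v$; right multiplication by $C_v$ is a linear operator on $Mv$. For every finite dimensional $L$-module $M$ there are submodules $M_u$ $(u\in W)$ and submodules $M_{C,f}\subseteq M_C$ ($C\in W$ a cycle, $f\in\mathcal P$) with the following properties. 1. $M=\bigoplus_{u\in W}M_u$; if $M_u\ne 0$ then the support of $M_u$ is the induced subgraph on the predecessors of $u$; and the decomposition is functorial: $g(M_u)\subseteq M'_u$ for every homomorphism $g:M\to M'$ of finite dimensional $L$-modules. 2. Let $w\in W$ be a sink. Then $M_w\cong M'_w$ if and only if $\dim_{\mathbb F}(M_ww)=\dim_{\mathbb F}(M'_ww)$, and every natural number is $\dim_{\mathbb F}(Mw)$ for some finite dimensional $M$ with $M=M_w$. Moreover, $M_w$ is indecomposable if and only if $\dim_{\mathbb F}(M_ww)=1$, if and only if $M_w$ is simple. 3. Let $C\in W$ be a cycle. Then $M_C=\bigoplus_{f\in\mathcal P}M_{C,f}$, functorially ($g(M_{C,f})\subseteq M'_{C,f}$ for every homomorphism $g:M\to M'$), and $M_{C,f}$ is $f$-primary: for every vertex $v$ on $C$, some power of $f$ annihilates the operator on $M_{C,f}v$ given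 by right multiplication by $C_v$. 4. Let $C\in W$ be a cycle and $f\in\mathcal P$. Each $M_{C,f}$ is a finite direct sum of indecomposable submodules. For every indecomposable direct summand $Q$ of $M_{C,f}$ there is exactly one positive integer $n=n(Q)$ such that, for every vertex $v$ on $C$, the space $Qv$ with right multiplication by $C_v$ is isomorphic to $\mathbb F[x]/(f^n)$ with multiplication by $x$. If $Q$ and $Q'$ are indecomposable direct summands of $M_{C,f}$ and $M'_{C,f}$ respectively, then $Q\cong Q'$ if and only if $n(Q)=n(Q')$. The module $Q$ is simple if and only if $n(Q)=1$. Every positive integer occurs: for every $n\ge 1$ there is an indecomposable finite dimensional module $M$ with $M=M_{C,f}$ and $n(M)=n$. -/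

import Mathlib

open Polynomial

universe uV uE uF w

/-- A directed graph `(V, E, s, t)`: loops and parallel arrows are allowed. -/
structure DiGraph (V : Type*) (E : Type*) where
  s : E → V
  t : E → V

namespace DiGraph

section Graph

variable {V : Type uV} {E : Type uE} (Γ : DiGraph V E)

/-- Every vertex emits only finitely many arrows. -/
def RowFinite : Prop := ∀ v : V, {e : E | Γ.s e = v}.Finite

/-- `Γ.Reaches v w`: there is a path (possibly of length zero) from `v` to `w`. -/
def Reaches : V → V → Prop :=
  Relation.ReflTransGen fun v w => ∃ e : E, Γ.s e = v ∧ Γ.t e = w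

def IsSink (v : V) : Prop := ∀ e : E, Γ.s e ≠ v

/-- `C` (a nonempty list of arrows up to rotation) is a cycle: consecutive arrows are composable,
cyclically, and the sources of the arrows are pairwise distinct. -/
def IsCycle (C : Cycle E) : Prop :=
  C ≠ Cycle.nil ∧ C.Chain (fun e f => Γ.t e = Γ.s f) ∧ (C.map Γ.s).Nodup

/-- The vertices on a cycle. -/
def cycleVertices (C : Cycle E) : Set V := {v | ∃ e ∈ C, Γ.s e = v}

/-- The predecessors of a vertex. -/
def pred (w : V) : Set V := {v | Γ.Reaches v w}

/-- The predecessors of a cycle. -/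
def cyclePred (C : Cycle E) : Set V := {v | ∃ w ∈ Γ.cycleVertices C, Γ.Reaches v w}

/-- A sink to which no cycle connects. -/
def IsMaximalSink (w : V) : Prop :=
  Γ.IsSink w ∧ ∀ C : Cycle E, Γ.IsCycle C → Disjoint (Γ.cycleVertices C) (Γ.pred w)

/-- A cycle to which no other cycle connects. -/
def IsMaximalCycle (C : Cycle E) : Prop :=
  Γ.IsCycle C ∧ ∀ D : Cycle E, Γ.IsCycle D →
    (∃ v ∈ Γ.cycleVertices D, v ∈ Γ.cyclePred C) → D = C

/-- The maximal sinks with finitely many predecessors. -/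
def FinMaxSink : Type uV := {w : V // Γ.IsMaximalSink w ∧ (Γ.pred w).Finite}

/-- The maximal cycles with finitely many predecessors. -/
def FinMaxCycle : Type uE := {C : Cycle E // Γ.IsMaximalCycle C ∧ (Γ.cyclePred C).Finite}

/-- The predecessors of a maximal sink or of a maximal cycle. -/
def endPred : Γ.FinMaxSink ⊕ Γ.FinMaxCycle → Set V
  | Sum.inl w => Γ.pred w.1
  | Sum.inr C => Γ.cyclePred C.1

end Graph

section Algebra

/-- The generators `V ⊔ E ⊔ E*`. -/
inductive Gen (V : Type uV) (E : Type uE) : Type (max uV uE)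
  | vertex (v : V) : Gen V E
  | arrow (e : E) : Gen V E
  | dual (e : E) : Gen V E

variable (F : Type uF) [Field F] {V : Type uV} {E : Type uE} (Γ : DiGraph V E)

/-- The free generators, as elements of the free algebra. -/
def gen (x : Gen V E) : FreeAlgebra F (Gen V E) := FreeAlgebra.ι F x

/-- The defining relations (V), (E), (CK1), (CK2) of the Leavitt path algebra. -/
inductive LeavittRel : FreeAlgebra F (Gen V E) → FreeAlgebra F (Gen V E) → Prop
  | vertex_mul_self (v : V) : LeavittRel (gen F (.vertex v) * gen F (.vertex v)) (gen F (.vertex v))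
  | vertex_mul_of_ne (v w : V) (h : v ≠ w) : LeavittRel (gen F (.vertex v) * gen F (.vertex w)) 0
  | source_mul (e : E) : LeavittRel (gen F (.vertex (Γ.s e)) * gen F (.arrow e)) (gen F (.arrow e))
  | mul_target (e : E) : LeavittRel (gen F (.arrow e) * gen F (.vertex (Γ.t e))) (gen F (.arrow e))
  | target_mul_dual (e : E) :
      LeavittRel (gen F (.vertex (Γ.t e)) * gen F (.dual e)) (gen F (.dual e))
  | dual_mul_source (e : E) :
      LeavittRel (gen F (.dual e) * gen F (.vertex (Γ.s e))) (gen F (.dual e))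
  | dual_mul_self (e : E) :
      LeavittRel (gen F (.dual e) * gen F (.arrow e)) (gen F (.vertex (Γ.t e)))
  | dual_mul_of_ne (e f : E) (h : e ≠ f) : LeavittRel (gen F (.dual e) * gen F (.arrow f)) 0
  | vertex_eq_sum (v : V) (hfin : {e : E | Γ.s e = v}.Finite) (hne : {e : E | Γ.s e = v}.Nonempty) :
      LeavittRel (gen F (.vertex v)) (∑ e ∈ hfin.toFinset, gen F (.arrow e) * gen F (.dual e))

/-- The image of a generator in the unital algebra presented by the relations. -/
def genQuot (x : Gen V E) : RingQuot (LeavittRel F Γ) :=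
  RingQuot.mkAlgHom F (LeavittRel F Γ) (gen F x)

/-- The Leavitt path algebra `L_F(Γ)`, a non-unital algebra in general: the set of polynomials
without constant term in the generators, modulo the relations. (The relations have no constant
term, so the ideal they generate in the free non-unital algebra is the one they generate in the
free unital algebra.) -/
def LeavittPathAlgebra : Type (max uF uV uE) :=
  NonUnitalAlgebra.adjoin F (Set.range (genQuot F Γ))

instance : NonUnitalRing (LeavittPathAlgebra F Γ) :=
  inferInstanceAs (NonUnitalRing (NonUnitalAlgebra.adjoin F (Set.range (genQuot F Γ))))

instance : Module F (LeavittPathAlgebra F Γ) :=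
  inferInstanceAs (Module F (NonUnitalAlgebra.adjoin F (Set.range (genQuot F Γ))))

instance : IsScalarTower F (LeavittPathAlgebra F Γ) (LeavittPathAlgebra F Γ) :=
  inferInstanceAs (IsScalarTower F (NonUnitalAlgebra.adjoin F (Set.range (genQuot F Γ)))
    (NonUnitalAlgebra.adjoin F (Set.range (genQuot F Γ))))

instance : SMulCommClass F (LeavittPathAlgebra F Γ) (LeavittPathAlgebra F Γ) :=
  inferInstanceAs (SMulCommClass F (NonUnitalAlgebra.adjoin F (Set.range (genQuot F Γ)))
    (NonUnitalAlgebra.adjoin F (Set.range (genQuot F Γ))))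

/-- The generators as elements of `L_F(Γ)`. -/
def lgen (x : Gen V E) : LeavittPathAlgebra F Γ :=
  ⟨genQuot F Γ x, NonUnitalAlgebra.subset_adjoin F (Set.mem_range_self x)⟩

/-- Right modules over the non-unital algebra `L = L_F(Γ)` are the same thing as (unitary) right
modules over its unitization `F ⊕ L`, that is, left modules over the opposite ring. -/
def Scalars : Type (max uF uV uE) := (Unitization F (LeavittPathAlgebra F Γ))ᵐᵒᵖ

instance : Ring (Scalars F Γ) :=
  inferInstanceAs (Ring (Unitization F (LeavittPathAlgebra F Γ))ᵐᵒᵖ)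

instance : Algebra F (Scalars F Γ) :=
  inferInstanceAs (Algebra F (Unitization F (LeavittPathAlgebra F Γ))ᵐᵒᵖ)

/-- An element `a` of `L` as a scalar: `act F Γ a • m` is the right multiple `m a`. -/
def act (a : LeavittPathAlgebra F Γ) : Scalars F Γ :=
  MulOpposite.op (a : Unitization F (LeavittPathAlgebra F Γ))

/-- For `l = [e₁, …, eₙ]`, the scalar `pathAct F Γ l • m` is the right multiple `m e₁ ⋯ eₙ`. -/
def pathAct (l : List E) : Scalars F Γ :=
  MulOpposite.op
    (l.map fun e => ((lgen F Γ (.arrow e) : LeavittPathAlgebra F Γ) :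
      Unitization F (LeavittPathAlgebra F Γ))).prod

end Algebra

section Modules

variable (F : Type uF) [Field F] {V : Type uV} {E : Type uE} (Γ : DiGraph V E)
  (M : Type w) [AddCommGroup M] [Module F M] [Module (Scalars F Γ) M]
  [IsScalarTower F (Scalars F Γ) M]

/-- `M` is unital: `M L = M`. -/
def IsUnital : Prop :=
  ∀ m : M, m ∈ AddSubgroup.closure {x : M | ∃ (n : M) (a : LeavittPathAlgebra F Γ),
    x = act F Γ a • n}

/-- The subspace `M v` for a vertex `v`. -/
def vertexSpace (v : V) : Submodule F M :=
  LinearMap.range (Algebra.lsmul F F M (act F Γ (lgen F Γ (.vertex v))))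

/-- The vertex set of the support subgraph (which is the induced subgraph on it). -/
def vertexSupport : Set V := {v | vertexSpace F Γ M v ≠ ⊥}

/-- `M` is `f`-primary at the cycle `C`: whichever starting point `v = s e` on `C` is chosen, the
operator given on `M v` by right multiplication by `C` is annihilated by a power of `f`. -/
def IsPrimary (C : Cycle E) (f : F[X]) : Prop :=
  ∀ (e : E) (l : List E), ((e :: l : List E) : Cycle E) = C →
    ∃ k : ℕ, ∀ m ∈ vertexSpace F Γ M (Γ.s e),
      aeval (Algebra.lsmul F F M (pathAct F Γ (e :: l))) (f ^ k) m = 0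

/-- Whichever starting point `v = s e` on the cycle `C` is chosen, the space `M v`, with right
multiplication by `C`, is isomorphic to `F[x]/(g)` with multiplication by `x`. -/
def IsCyclicOfType (C : Cycle E) (g : F[X]) : Prop :=
  ∀ (e : E) (l : List E), ((e :: l : List E) : Cycle E) = C →
    ∃ φ : (F[X] ⧸ Ideal.span {g}) ≃ₗ[F] vertexSpace F Γ M (Γ.s e),
      ∀ a, (φ (Ideal.Quotient.mk _ X * a) : M) = pathAct F Γ (e :: l) • (φ a : M)

/-- Finite dimensional unital right `L_F(Γ)`-modules. -/
structure FDModule where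
  carrier : Type w
  [addCommGroup : AddCommGroup carrier]
  [moduleF : Module F carrier]
  [module : Module (Scalars F Γ) carrier]
  [tower : IsScalarTower F (Scalars F Γ) carrier]
  [finite : FiniteDimensional F carrier]
  unital : IsUnital F Γ carrier

attribute [instance] FDModule.addCommGroup FDModule.moduleF FDModule.module FDModule.tower
  FDModule.finite

instance : CoeSort (FDModule.{uV, uE, uF, w} F Γ) (Type w) := ⟨FDModule.carrier⟩

/-- The irreducible polynomials `f` with `f(0) = 1`. -/
def IrredPoly : Type uF := {f : F[X] // Irreducible f ∧ f.eval 0 = 1}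

end Modules

/-- A nonzero module that is not the direct sum of two nonzero submodules. -/
def IsIndecomposable (R : Type*) (M : Type*) [Ring R] [AddCommGroup M] [Module R M] : Prop :=
  Nontrivial M ∧ ∀ A B : Submodule R M, IsCompl A B → A = ⊥ ∨ B = ⊥

/-- `N` is the internal direct sum of the submodules `A i`. -/
def IsDirectSumOf {R : Type*} {M : Type*} [Ring R] [AddCommGroup M] [Module R M] {ι : Type*}
    (N : Submodule R M) (A : ι → Submodule R M) : Prop :=
  iSupIndep A ∧ ⨆ i, A i = N

/-- `Q` is a direct summand of `N`. -/
def IsSummandOf {R : Type*} {M : Type*} [Ring R] [AddCommGroup M] [Module R M]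
    (Q N : Submodule R M) : Prop :=
  ∃ Q' : Submodule R M, Disjoint Q Q' ∧ Q ⊔ Q' = N

end DiGraph

open DiGraph

/-! A finite dimensional module `M` is controlled by its spaces at a few base points. By (CK1), `m
e* e = m` for every `m` at `t e`. Hence arrows act surjectively onto the spaces at their targets,
and the support is closed under predecessors. It is finite because the `M v` are independent. Going
once along a closed path at `v` is a surjective, hence bijective, operator on `M v`. It follows that
an arrow leaving a cycle acts as zero, so inside the support nothing outside a cycle can be reached
from it. If the support is nonempty and contains no sink, (CK2) allows arrows to be followed inside
it until a cycle closes up. The sink or cycle found in this way is automatically maximal with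
finitely many predecessors (`exists_basePt_mem`). Applied to submodules and quotients, this says
that whatever vanishes at all base points is zero (`eq_bot_of_basePt`, `le_of_basePt`).

Conversely, let `Y` be a subspace of `M v₀` at a base point, invariant under the closed path.
Multiplying `Y` by dual arrows generates a submodule that is supported on the predecessors of `v₀`
and has nothing but `Y` at `v₀` (`IsBase.exists_submodule`). Different ends do not reach one
another, so the largest submodules supported on the predecessors of the single ends form a direct
decomposition. It is functorial because supports are.

On one such summand, restriction to the base point identifies the lattice of submodules with that of
an `F[X]`-module, `X` acting as the closed path (`fibOrderIso`), and isomorphisms lift from the base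
point (`nonempty_equiv_of_fib`). Indecomposability, simplicity and isomorphism thus become questions
of linear algebra at a sink, where `X` acts as the identity. At a cycle they become questions about
torsion modules over the principal ideal domain `F[X]`.

Every automorphism of a finite dimensional space `W` is realized at a base point (`exists_module`):
the module consists of the `W`-valued functions on the finite set of paths that meet the base point
only at their end, with the automorphism inserted at the base point. -/

set_option linter.unusedSectionVars false

namespace DiGraph

/-! ### Generators and relations as operators on right modules -/

section ScalarAlgebra

variable (F : Type uF) [Field F] {V : Type uV} {E : Type uE} (Γ : DiGraph V E)

/-- Right multiplication by a vertex. -/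
def vtx (v : V) : Scalars F Γ := act F Γ (lgen F Γ (.vertex v))

/-- Right multiplication by an arrow. -/
def arr (e : E) : Scalars F Γ := act F Γ (lgen F Γ (.arrow e))

/-- Right multiplication by a dual arrow. -/
def dua (e : E) : Scalars F Γ := act F Γ (lgen F Γ (.dual e))

theorem act_add (a b : LeavittPathAlgebra F Γ) : act F Γ (a + b) = act F Γ a + act F Γ b := by
  unfold act
  rw [Unitization.inr_add]
  rfl

theorem act_zero : act F Γ 0 = 0 := by
  unfold act
  rw [Unitization.inr_zero]
  rfl

theorem act_smul (c : F) (a : LeavittPathAlgebra F Γ) : act F Γ (c • a) = c • act F Γ a := by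
  unfold act
  rw [Unitization.inr_smul]
  rfl

/-- Right multiplication by `a * b` applies `a` first, whence the reversed order. -/
theorem act_mul (a b : LeavittPathAlgebra F Γ) : act F Γ (a * b) = act F Γ b * act F Γ a := by
  unfold act
  rw [Unitization.inr_mul]
  rfl

/-- Right multiplication, as a linear map. -/
def actₗ : LeavittPathAlgebra F Γ →ₗ[F] Scalars F Γ where
  toFun := act F Γ
  map_add' := act_add F Γ
  map_smul' := act_smul F Γ

theorem actₗ_apply (a : LeavittPathAlgebra F Γ) : actₗ F Γ a = act F Γ a := rfl

theorem scalars_eq (s : Scalars F Γ) :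
    ∃ (c : F) (a : LeavittPathAlgebra F Γ), s = algebraMap F (Scalars F Γ) c + act F Γ a := by
  refine ⟨(MulOpposite.unop s).fst, (MulOpposite.unop s).snd, ?_⟩
  apply MulOpposite.unop_injective
  exact (Unitization.inl_fst_add_inr_snd_eq (MulOpposite.unop s)).symm

theorem leavitt_induction {p : LeavittPathAlgebra F Γ → Prop} (hgen : ∀ x, p (lgen F Γ x))
    (hadd : ∀ a b, p a → p b → p (a + b)) (hzero : p 0)
    (hmul : ∀ a b, p a → p b → p (a * b)) (hsmul : ∀ (c : F) a, p a → p (c • a))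
    (a : LeavittPathAlgebra F Γ) : p a := by
  obtain ⟨a, ha⟩ := a
  induction ha using NonUnitalAlgebra.adjoin_induction with
  | mem x hx => obtain ⟨g, rfl⟩ := hx; exact hgen g
  | add x y hx hy h1 h2 => exact hadd _ _ h1 h2
  | zero => exact hzero
  | mul x y hx hy h1 h2 => exact hmul _ _ h1 h2
  | smul r x hx h => exact hsmul r _ h

theorem genQuot_rel {x y : FreeAlgebra F (Gen V E)} (h : LeavittRel F Γ x y) :
    RingQuot.mkAlgHom F (LeavittRel F Γ) x = RingQuot.mkAlgHom F (LeavittRel F Γ) y :=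
  RingQuot.mkAlgHom_rel F h

variable {F Γ}

theorem lgen_mul_eq {x y z : Gen V E} (h : LeavittRel F Γ (gen F x * gen F y) (gen F z)) :
    lgen F Γ x * lgen F Γ y = lgen F Γ z := by
  apply Subtype.ext
  have := genQuot_rel F Γ h
  rw [map_mul] at this
  exact this

theorem lgen_mul_eq_zero {x y : Gen V E} (h : LeavittRel F Γ (gen F x * gen F y) 0) :
    lgen F Γ x * lgen F Γ y = 0 := by
  apply Subtype.ext
  have := genQuot_rel F Γ h
  rw [map_mul, map_zero] at this
  exact this

theorem vtx_mul_self (v : V) : vtx F Γ v * vtx F Γ v = vtx F Γ v := by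
  rw [vtx, ← act_mul, lgen_mul_eq (.vertex_mul_self v)]

theorem vtx_mul_of_ne {v w : V} (h : v ≠ w) : vtx F Γ v * vtx F Γ w = 0 := by
  rw [vtx, vtx, ← act_mul, lgen_mul_eq_zero (.vertex_mul_of_ne w v h.symm), act_zero]

theorem arr_mul_vtx (e : E) : arr F Γ e * vtx F Γ (Γ.s e) = arr F Γ e := by
  rw [vtx, arr, ← act_mul, lgen_mul_eq (.source_mul e)]

theorem vtx_mul_arr (e : E) : vtx F Γ (Γ.t e) * arr F Γ e = arr F Γ e := by
  rw [vtx, arr, ← act_mul, lgen_mul_eq (.mul_target e)]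

theorem dua_mul_vtx (e : E) : dua F Γ e * vtx F Γ (Γ.t e) = dua F Γ e := by
  rw [vtx, dua, ← act_mul, lgen_mul_eq (.target_mul_dual e)]

theorem vtx_mul_dua (e : E) : vtx F Γ (Γ.s e) * dua F Γ e = dua F Γ e := by
  rw [vtx, dua, ← act_mul, lgen_mul_eq (.dual_mul_source e)]

theorem arr_mul_dua (e : E) : arr F Γ e * dua F Γ e = vtx F Γ (Γ.t e) := by
  rw [vtx, arr, dua, ← act_mul, lgen_mul_eq (.dual_mul_self e)]

theorem arr_mul_dua_of_ne {e f : E} (h : e ≠ f) : arr F Γ e * dua F Γ f = 0 := by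
  rw [arr, dua, ← act_mul, lgen_mul_eq_zero (.dual_mul_of_ne f e h.symm), act_zero]

theorem vtx_eq_sum (v : V) (hfin : {e : E | Γ.s e = v}.Finite)
    (hne : {e : E | Γ.s e = v}.Nonempty) :
    vtx F Γ v = ∑ e ∈ hfin.toFinset, dua F Γ e * arr F Γ e := by
  have h : lgen F Γ (.vertex v) =
      ∑ e ∈ hfin.toFinset, lgen F Γ (.arrow e) * lgen F Γ (.dual e) := by
    have h1 := genQuot_rel F Γ (.vertex_eq_sum v hfin hne)
    rw [map_sum] at h1
    apply Subtype.ext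
    refine h1.trans ?_
    have h2 : ((∑ e ∈ hfin.toFinset, lgen F Γ (.arrow e) * lgen F Γ (.dual e) :
        LeavittPathAlgebra F Γ)).1 = ∑ e ∈ hfin.toFinset,
          (lgen F Γ (.arrow e) * lgen F Γ (.dual e) : LeavittPathAlgebra F Γ).1 :=
      map_sum (NonUnitalSubalgebraClass.subtype
        (NonUnitalAlgebra.adjoin F (Set.range (genQuot F Γ)))) _ _
    refine Eq.trans ?_ h2.symm
    refine Finset.sum_congr rfl fun e _ => ?_
    rw [map_mul]
    rfl
  rw [vtx, h, ← actₗ_apply, map_sum]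
  refine Finset.sum_congr rfl fun e _ => ?_
  rw [actₗ_apply, act_mul]
  rfl

theorem arr_mul_vtx_of_ne {v : V} {e : E} (h : Γ.s e ≠ v) : arr F Γ e * vtx F Γ v = 0 := by
  rw [← arr_mul_vtx, mul_assoc, vtx_mul_of_ne h, mul_zero]

variable (F Γ) in
@[simp]
theorem pathAct_nil : pathAct F Γ [] = 1 := rfl

variable (F Γ) in
theorem pathAct_cons (e : E) (l : List E) :
    pathAct F Γ (e :: l) = pathAct F Γ l * arr F Γ e := rfl

theorem pathAct_append (l l' : List E) :
    pathAct F Γ (l ++ l') = pathAct F Γ l' * pathAct F Γ l := by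
  induction l with
  | nil => simp
  | cons e l ih => rw [List.cons_append, pathAct_cons, ih, pathAct_cons, mul_assoc]

end ScalarAlgebra

/-! ### Stable subspaces, vertex spaces and local units -/

section Invariance

variable {F : Type uF} [Field F] {V : Type uV} {E : Type uE} {Γ : DiGraph V E}
  {X : Type*} [AddCommGroup X] [Module F X] [Module (Scalars F Γ) X]
  [IsScalarTower F (Scalars F Γ) X]

/-- A subspace that is stable under the generators is stable under all scalars. -/
theorem smul_mem_of_gen {N : Submodule F X} (hv : ∀ v, ∀ m ∈ N, vtx F Γ v • m ∈ N)
    (ha : ∀ e, ∀ m ∈ N, arr F Γ e • m ∈ N) (hd : ∀ e, ∀ m ∈ N, dua F Γ e • m ∈ N)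
    (s : Scalars F Γ) {m : X} (hm : m ∈ N) : s • m ∈ N := by
  obtain ⟨c, a, rfl⟩ := scalars_eq F Γ s
  rw [add_smul, algebraMap_smul]
  refine N.add_mem (N.smul_mem c hm) ?_
  have key : ∀ n ∈ N, act F Γ a • n ∈ N := by
    refine leavitt_induction F Γ (p := fun a => ∀ n ∈ N, act F Γ a • n ∈ N) ?_ ?_ ?_ ?_ ?_ a
    · rintro (v | e | e) n hn
      exacts [hv v n hn, ha e n hn, hd e n hn]
    · intro a b h1 h2 n hn
      rw [act_add, add_smul]
      exact N.add_mem (h1 n hn) (h2 n hn)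
    · intro n _
      rw [act_zero, zero_smul]
      exact N.zero_mem
    · intro a b h1 h2 n hn
      rw [act_mul, mul_smul]
      exact h2 _ (h1 n hn)
    · intro c a h n hn
      rw [act_smul, smul_assoc]
      exact N.smul_mem c (h n hn)
  exact key m hm

/-- The submodule carried by a subspace that is stable under the generators. -/
def submoduleOfGen (N : Submodule F X) (hv : ∀ v, ∀ m ∈ N, vtx F Γ v • m ∈ N)
    (ha : ∀ e, ∀ m ∈ N, arr F Γ e • m ∈ N) (hd : ∀ e, ∀ m ∈ N, dua F Γ e • m ∈ N) :
    Submodule (Scalars F Γ) X where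
  carrier := N
  add_mem' := N.add_mem
  zero_mem' := N.zero_mem
  smul_mem' s _ hm := smul_mem_of_gen hv ha hd s hm

theorem mem_submoduleOfGen {N : Submodule F X} {hv ha hd} {m : X} :
    m ∈ submoduleOfGen (Γ := Γ) N hv ha hd ↔ m ∈ N := Iff.rfl

theorem mem_vertexSpace {v : V} {m : X} : m ∈ vertexSpace F Γ X v ↔ vtx F Γ v • m = m := by
  constructor
  · rintro ⟨n, rfl⟩
    change vtx F Γ v • vtx F Γ v • n = vtx F Γ v • n
    rw [← mul_smul, vtx_mul_self]
  · intro h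
    exact ⟨m, h⟩

theorem vtx_smul_mem (v : V) (m : X) : vtx F Γ v • m ∈ vertexSpace F Γ X v := ⟨m, rfl⟩

theorem vertexSpace_eq_bot {v : V} :
    vertexSpace F Γ X v = ⊥ ↔ ∀ m : X, vtx F Γ v • m = 0 := by
  rw [vertexSpace, LinearMap.range_eq_bot]
  exact ⟨fun h m => LinearMap.congr_fun h m, fun h => LinearMap.ext h⟩

theorem vtx_smul_of_mem {v : V} {m : X} (hm : m ∈ vertexSpace F Γ X v) : vtx F Γ v • m = m :=
  mem_vertexSpace.1 hm

theorem vtx_smul_of_mem_of_ne {v w : V} {m : X} (hm : m ∈ vertexSpace F Γ X v) (h : w ≠ v) :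
    vtx F Γ w • m = 0 := by
  rw [← vtx_smul_of_mem hm, ← mul_smul, vtx_mul_of_ne h, zero_smul]

theorem arr_smul_mem (e : E) (m : X) : arr F Γ e • m ∈ vertexSpace F Γ X (Γ.t e) := by
  rw [mem_vertexSpace, ← mul_smul, vtx_mul_arr]

theorem dua_smul_mem (e : E) (m : X) : dua F Γ e • m ∈ vertexSpace F Γ X (Γ.s e) := by
  rw [mem_vertexSpace, ← mul_smul, vtx_mul_dua]

/-- This is (CK1) on vectors: the dual arrow is a section of the arrow, which therefore maps onto
the space at its target. -/
theorem arr_dua_smul {e : E} {m : X} (hm : m ∈ vertexSpace F Γ X (Γ.t e)) :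
    arr F Γ e • dua F Γ e • m = m := by
  rw [← mul_smul, arr_mul_dua, vtx_smul_of_mem hm]

theorem arr_smul_of_ne {e : E} {v : V} {m : X} (hm : m ∈ vertexSpace F Γ X v) (h : Γ.s e ≠ v) :
    arr F Γ e • m = 0 := by
  rw [← vtx_smul_of_mem hm, ← mul_smul, arr_mul_vtx_of_ne h, zero_smul]

theorem eq_sum_of_mem {v : V} (hfin : {e : E | Γ.s e = v}.Finite)
    (hne : {e : E | Γ.s e = v}.Nonempty) {m : X} (hm : m ∈ vertexSpace F Γ X v) :
    m = ∑ e ∈ hfin.toFinset, dua F Γ e • arr F Γ e • m := by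
  conv_lhs => rw [← vtx_smul_of_mem hm, vtx_eq_sum v hfin hne, Finset.sum_smul]
  exact Finset.sum_congr rfl fun e _ => mul_smul _ _ _

/-- In a unital module every element has a local unit. -/
theorem IsUnital.exists_sum (h : IsUnital F Γ X) (m : X) :
    ∃ S : Finset V, ∑ v ∈ S, vtx F Γ v • m = m := by
  classical
  -- Each generator multiplies into a single vertex space, and a product lands where its last factor
  -- puts it.
  have key : ∀ (a : LeavittPathAlgebra F Γ) (n : X),
      act F Γ a • n ∈ ⨆ v, vertexSpace F Γ X v := by
    refine leavitt_induction F Γ ?_ ?_ ?_ ?_ ?_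
    · rintro (v | e | e) n
      · exact Submodule.mem_iSup_of_mem v (vtx_smul_mem v n)
      · exact Submodule.mem_iSup_of_mem (Γ.t e) (arr_smul_mem e n)
      · exact Submodule.mem_iSup_of_mem (Γ.s e) (dua_smul_mem e n)
    · intro a b h1 h2 n
      rw [act_add, add_smul]
      exact Submodule.add_mem _ (h1 n) (h2 n)
    · intro n
      rw [act_zero, zero_smul]
      exact Submodule.zero_mem _
    · intro a b h1 h2 n
      rw [act_mul, mul_smul]
      exact h2 _
    · intro c a h n
      rw [act_smul, smul_assoc]
      exact Submodule.smul_mem _ c (h n)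
  have hm : m ∈ ⨆ v, vertexSpace F Γ X v := by
    have : AddSubgroup.closure {x : X | ∃ (n : X) (a : LeavittPathAlgebra F Γ),
        x = act F Γ a • n} ≤ (⨆ v, vertexSpace F Γ X v).toAddSubgroup := by
      rw [AddSubgroup.closure_le]
      rintro x ⟨n, a, rfl⟩
      exact key a n
    exact this (h m)
  -- A local unit may be enlarged, since vertices outside `S` kill `x` by orthogonality; this lets
  -- two elements share one.
  have large : ∀ (S T : Finset V) (x : X), S ⊆ T → ∑ v ∈ S, vtx F Γ v • x = x →
      ∑ v ∈ T, vtx F Γ v • x = x := by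
    intro S T x hST hS
    refine (Finset.sum_subset hST fun v _ hv => ?_).symm.trans hS
    rw [← hS, Finset.smul_sum]
    refine Finset.sum_eq_zero fun w hw => ?_
    rw [← mul_smul, vtx_mul_of_ne, zero_smul]
    rintro rfl
    exact hv hw
  induction hm using Submodule.iSup_induction' with
  | mem v x hx =>
    exact ⟨{v}, by rw [Finset.sum_singleton, vtx_smul_of_mem hx]⟩
  | zero => exact ⟨∅, by simp⟩
  | add x y _ _ hx hy =>
    obtain ⟨S, hS⟩ := hx
    obtain ⟨T, hT⟩ := hy
    refine ⟨S ∪ T, ?_⟩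
    simp only [smul_add, Finset.sum_add_distrib]
    rw [large S (S ∪ T) x Finset.subset_union_left hS,
      large T (S ∪ T) y Finset.subset_union_right hT]

theorem isUnital_of_exists_sum (h : ∀ m : X, ∃ S : Finset V, ∑ v ∈ S, vtx F Γ v • m = m) :
    IsUnital F Γ X := by
  intro m
  obtain ⟨S, hS⟩ := h m
  rw [← hS]
  exact AddSubgroup.sum_mem _ fun v _ => AddSubgroup.subset_closure ⟨m, _, rfl⟩

theorem IsUnital.submodule (h : IsUnital F Γ X) (N : Submodule (Scalars F Γ) X) :
    IsUnital F Γ N := by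
  refine isUnital_of_exists_sum fun m => ?_
  obtain ⟨S, hS⟩ := h.exists_sum (m : X)
  refine ⟨S, Subtype.ext ?_⟩
  simpa using hS

theorem IsUnital.quotient (h : IsUnital F Γ X) (N : Submodule (Scalars F Γ) X) :
    IsUnital F Γ (X ⧸ N) := by
  refine isUnital_of_exists_sum fun m => ?_
  obtain ⟨m, rfl⟩ := N.mkQ_surjective m
  obtain ⟨S, hS⟩ := h.exists_sum m
  refine ⟨S, ?_⟩
  conv_rhs => rw [← hS, map_sum]
  exact Finset.sum_congr rfl fun v _ => rfl

theorem IsUnital.eq_zero (h : IsUnital F Γ X) {m : X} (hm : ∀ v, vtx F Γ v • m = 0) : m = 0 := by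
  obtain ⟨S, hS⟩ := h.exists_sum m
  rw [← hS]
  exact Finset.sum_eq_zero fun v _ => hm v

/-- Needed for the graph of an isomorphism at the base point, which generates a submodule of the
product. -/
theorem IsUnital.prod {X' : Type*} [AddCommGroup X'] [Module F X'] [Module (Scalars F Γ) X']
    [IsScalarTower F (Scalars F Γ) X'] (h : IsUnital F Γ X) (h' : IsUnital F Γ X') :
    IsUnital F Γ (X × X') := by
  intro m
  have h1 : ∀ x : X, ((x, 0) : X × X') ∈ AddSubgroup.closure
      {x : X × X' | ∃ (n : X × X') (a : LeavittPathAlgebra F Γ), x = act F Γ a • n} := by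
    intro x
    induction h x using AddSubgroup.closure_induction with
    | mem x hx =>
      obtain ⟨n, a, rfl⟩ := hx
      exact AddSubgroup.subset_closure ⟨(n, 0), a, by simp⟩
    | zero => exact AddSubgroup.zero_mem _
    | add x y _ _ hx hy => simpa using AddSubgroup.add_mem _ hx hy
    | neg x _ hx => simpa using AddSubgroup.neg_mem _ hx
  have h2 : ∀ x : X', ((0, x) : X × X') ∈ AddSubgroup.closure
      {x : X × X' | ∃ (n : X × X') (a : LeavittPathAlgebra F Γ), x = act F Γ a • n} := by
    intro x
    induction h' x using AddSubgroup.closure_induction with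
    | mem x hx =>
      obtain ⟨n, a, rfl⟩ := hx
      exact AddSubgroup.subset_closure ⟨(0, n), a, by simp⟩
    | zero => exact AddSubgroup.zero_mem _
    | add x y _ _ hx hy => simpa using AddSubgroup.add_mem _ hx hy
    | neg x _ hx => simpa using AddSubgroup.neg_mem _ hx
  simpa using AddSubgroup.add_mem _ (h1 m.1) (h2 m.2)

end Invariance

end DiGraph

namespace DiGraph

/-! ### Paths and cycles -/

section Paths

variable {V : Type uV} {E : Type uE} (Γ : DiGraph V E)

/-- `Γ.IsPath v l w`: the list of arrows `l` is a path from `v` to `w`. -/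
def IsPath : V → List E → V → Prop
  | v, [], w => v = w
  | v, e :: l, w => Γ.s e = v ∧ IsPath (Γ.t e) l w

variable {Γ}

@[simp]
theorem isPath_nil {v w : V} : Γ.IsPath v [] w ↔ v = w := Iff.rfl

@[simp]
theorem isPath_cons {v w : V} {e : E} {l : List E} :
    Γ.IsPath v (e :: l) w ↔ Γ.s e = v ∧ Γ.IsPath (Γ.t e) l w := Iff.rfl

theorem isPath_append {v w : V} {l l' : List E} :
    Γ.IsPath v (l ++ l') w ↔ ∃ x, Γ.IsPath v l x ∧ Γ.IsPath x l' w := by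
  induction l generalizing v with
  | nil => simp
  | cons e l ih => simp [ih, and_assoc]

theorem reaches_refl (v : V) : Γ.Reaches v v := Relation.ReflTransGen.refl

theorem Reaches.trans {u v w : V} (h : Γ.Reaches u v) (h' : Γ.Reaches v w) : Γ.Reaches u w :=
  Relation.ReflTransGen.trans h h'

theorem reaches_arrow (e : E) : Γ.Reaches (Γ.s e) (Γ.t e) :=
  Relation.ReflTransGen.single ⟨e, rfl, rfl⟩

theorem IsPath.reaches {v w : V} {l : List E} (h : Γ.IsPath v l w) : Γ.Reaches v w := by
  induction l generalizing v with
  | nil => cases h; exact reaches_refl _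
  | cons e l ih =>
    obtain ⟨rfl, h⟩ := h
    exact (reaches_arrow e).trans (ih h)

theorem IsPath.reaches_of_mem {v w : V} {l : List E} (h : Γ.IsPath v l w) {e : E} (he : e ∈ l) :
    Γ.Reaches v (Γ.s e) ∧ Γ.Reaches (Γ.t e) w := by
  induction l generalizing v with
  | nil => simp at he
  | cons f l ih =>
    obtain ⟨rfl, h⟩ := h
    rcases List.mem_cons.1 he with rfl | he
    · exact ⟨reaches_refl _, h.reaches⟩
    · exact ⟨(reaches_arrow f).trans (ih h he).1, (ih h he).2⟩

/-- A reachable vertex is reached along a path with distinct sources that only meets it at the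
end. -/
theorem Reaches.exists_simple {v w : V} (h : Γ.Reaches v w) :
    ∃ l, Γ.IsPath v l w ∧ (∀ e ∈ l, Γ.s e ≠ w) ∧ (l.map Γ.s).Nodup := by
  induction h using Relation.ReflTransGen.head_induction_on with
  | refl => exact ⟨[], rfl, by simp, by simp⟩
  | head h _ ih =>
    obtain ⟨e, rfl, rfl⟩ := h
    obtain ⟨l, hl, hw, hn⟩ := ih
    by_cases hew : Γ.s e = w
    · exact ⟨[], hew, by simp, by simp⟩
    -- If the new source already occurs on `l`, the detour is cut out by keeping only the part of
    -- `l` from that occurrence on.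
    by_cases hel : Γ.s e ∈ l.map Γ.s
    · obtain ⟨f, hf, hfe⟩ := List.mem_map.1 hel
      obtain ⟨l₁, l₂, rfl⟩ := List.append_of_mem hf
      obtain ⟨x, -, h2⟩ := isPath_append.1 hl
      refine ⟨f :: l₂, ⟨hfe, h2.2⟩, fun g hg => hw g (by simp_all), ?_⟩
      rw [List.map_append] at hn
      exact hn.of_append_right
    · exact ⟨e :: l, ⟨rfl, hl⟩, by simpa using ⟨hew, hw⟩, by
        rw [List.map_cons]; exact List.nodup_cons.2 ⟨hel, hn⟩⟩

/-- If there is at most one way to leave every vertex on the way to `w`, then the path to `w`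
that only meets `w` at the end is unique. -/
theorem IsPath.unique {v w : V} {l l' : List E} (h : Γ.IsPath v l w) (h' : Γ.IsPath v l' w)
    (hl : ∀ e ∈ l, Γ.s e ≠ w) (hl' : ∀ e ∈ l', Γ.s e ≠ w)
    (hdet : ∀ e ∈ l, ∀ f ∈ l', Γ.s e = Γ.s f → e = f) : l = l' := by
  induction l generalizing v l' with
  | nil =>
    cases h
    cases l' with
    | nil => rfl
    | cons f l' => exact absurd h'.1 (hl' f (by simp))
  | cons e l ih =>
    obtain ⟨rfl, h⟩ := h
    cases l' with
    | nil => exact absurd h' (hl e (by simp))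
    | cons f l' =>
      obtain ⟨hf, h'⟩ := h'
      obtain rfl := hdet e (by simp) f (by simp) hf.symm
      rw [ih h h' (fun e he => hl e (by simp [he])) (fun e he => hl' e (by simp [he]))
        fun e he f hf => hdet e (by simp [he]) f (by simp [hf])]

theorem isPath_iff_isChain {e : E} {l : List E} {w : V} :
    Γ.IsPath (Γ.s e) (e :: l) w ↔
      (e :: l).IsChain (fun e f => Γ.t e = Γ.s f) ∧ Γ.t ((e :: l).getLast (by simp)) = w := by
  induction l generalizing e with
  | nil => simp
  | cons f l ih =>
    rw [isPath_cons, List.isChain_cons_cons, List.getLast_cons (by simp)]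
    constructor
    · rintro ⟨-, h⟩
      have h1 := h.1
      rw [← h1] at h
      exact ⟨⟨h1.symm, (ih.1 h).1⟩, (ih.1 h).2⟩
    · rintro ⟨⟨h1, h2⟩, h3⟩
      refine ⟨rfl, ?_⟩
      rw [h1]
      exact ih.2 ⟨h2, h3⟩

theorem isCycle_coe {e : E} {l : List E} :
    Γ.IsCycle ((e :: l : List E) : Cycle E) ↔
      Γ.IsPath (Γ.s e) (e :: l) (Γ.s e) ∧ ((e :: l).map Γ.s).Nodup := by
  rw [IsCycle, Cycle.chain_coe_cons, Cycle.map_coe, Cycle.nodup_coe_iff, isPath_iff_isChain,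
    ← List.cons_append, List.isChain_append]
  simp [List.getLast?_eq_some_getLast]

theorem Cycle.exists_rep {C : Cycle E} (h : C ≠ Cycle.nil) :
    ∃ (e : E) (l : List E), ((e :: l : List E) : Cycle E) = C := by
  induction C using Cycle.induction_on with
  | nil => exact absurd rfl h
  | cons a l _ => exact ⟨a, l, rfl⟩

/-- A cycle can be started at each of its arrows. -/
theorem Cycle.exists_rep_of_mem {C : Cycle E} {e : E} (h : e ∈ C) :
    ∃ l : List E, ((e :: l : List E) : Cycle E) = C := by
  induction C using Quotient.inductionOn with
  | h L =>
    obtain ⟨l₁, l₂, rfl⟩ := List.append_of_mem (Cycle.mem_coe_iff.1 h)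
    refine ⟨l₂ ++ l₁, ?_⟩
    exact Cycle.coe_eq_coe.2 (List.isRotated_append (l := e :: l₂) (l' := l₁))

theorem IsCycle.eq_of_source_eq {C : Cycle E} (hC : Γ.IsCycle C) {e f : E} (he : e ∈ C)
    (hf : f ∈ C) (h : Γ.s e = Γ.s f) : e = f := by
  obtain ⟨a, l, rfl⟩ := Cycle.exists_rep hC.1
  exact List.inj_on_of_nodup_map (isCycle_coe.1 hC).2 he hf h

/-- Walking around a cycle. -/
theorem IsCycle.target_mem {C : Cycle E} (hC : Γ.IsCycle C) {e : E} (he : e ∈ C) :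
    Γ.t e ∈ Γ.cycleVertices C := by
  obtain ⟨l, rfl⟩ := Cycle.exists_rep_of_mem he
  have h := (isCycle_coe.1 hC).1.2
  cases l with
  | nil => exact ⟨e, he, (show Γ.t e = Γ.s e from h).symm⟩
  | cons f l => exact ⟨f, by simp, h.1⟩

theorem IsCycle.reaches {C : Cycle E} (hC : Γ.IsCycle C) {v w : V}
    (hv : v ∈ Γ.cycleVertices C) (hw : w ∈ Γ.cycleVertices C) : Γ.Reaches v w := by
  obtain ⟨e, he, rfl⟩ := hv
  obtain ⟨f, hf, rfl⟩ := hw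
  obtain ⟨l, rfl⟩ := Cycle.exists_rep_of_mem he
  exact ((isCycle_coe.1 hC).1.reaches_of_mem (Cycle.mem_coe_iff.1 hf)).1

/-- The vertices of a cycle reach one another, so any of them may serve as base point. -/
theorem IsCycle.cyclePred_eq {C : Cycle E} (hC : Γ.IsCycle C) {v : V}
    (hv : v ∈ Γ.cycleVertices C) : Γ.cyclePred C = Γ.pred v := by
  ext x
  exact ⟨fun ⟨w, hw, h⟩ => h.trans (hC.reaches hw hv), fun h => ⟨v, hv, h⟩⟩

/-- Two cycles with a common vertex are equal if there is no choice of arrows. -/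
theorem IsCycle.eq_of_common_vertex {C D : Cycle E} (hC : Γ.IsCycle C) (hD : Γ.IsCycle D) {v : V}
    (hv : v ∈ Γ.cycleVertices C) (hv' : v ∈ Γ.cycleVertices D)
    (h : ∀ e ∈ C, Γ.s e ∈ Γ.cycleVertices D → e ∈ D) : C = D := by
  obtain ⟨e, he, rfl⟩ := hv
  have heD := h e he hv'
  obtain ⟨l, rfl⟩ := Cycle.exists_rep_of_mem he
  obtain ⟨l', rfl⟩ := Cycle.exists_rep_of_mem heD
  obtain ⟨h1, h2⟩ := isCycle_coe.1 hC
  obtain ⟨h1', h2'⟩ := isCycle_coe.1 hD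
  have av : ∀ m : List E, ((e :: m).map Γ.s).Nodup → ∀ f ∈ m, Γ.s f ≠ Γ.s e := by
    intro m hm f hf hfe
    rw [List.map_cons, List.nodup_cons] at hm
    exact hm.1 (hfe ▸ List.mem_map_of_mem hf)
  -- Both cycles are written from the common arrow `e`; their tails return to its source, meet it
  -- only at the end, and have no choice of arrows on the way.
  rw [h1.2.unique h1'.2 (av l h2) (av l' h2')]
  intro a ha b hb hab
  have haD : a ∈ ((e :: l' : List E) : Cycle E) :=
    h a (by simp [ha]) ⟨b, by simp [hb], hab.symm⟩
  exact hD.eq_of_source_eq haD (by simp [hb]) hab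

/-- An arrow whose target leads back to its source lies on a cycle. -/
theorem exists_isCycle_of_reaches {e : E} (h : Γ.Reaches (Γ.t e) (Γ.s e)) :
    ∃ C, Γ.IsCycle C ∧ e ∈ C := by
  obtain ⟨l, hl, ha, hn⟩ := h.exists_simple
  refine ⟨(e :: l : List E), isCycle_coe.2 ⟨⟨rfl, hl⟩, ?_⟩, by simp⟩
  rw [List.map_cons, List.nodup_cons]
  refine ⟨fun hm => ?_, hn⟩
  obtain ⟨f, hf, hfe⟩ := List.mem_map.1 hm
  exact ha f hf hfe

/-- A self-map of a finite set of vertices along arrows produces a cycle in this set. -/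
theorem exists_isCycle_of_next {A : Set V} (hA : A.Finite) (hne : A.Nonempty)
    (next : ∀ v ∈ A, ∃ e, Γ.s e = v ∧ Γ.t e ∈ A) :
    ∃ C, Γ.IsCycle C ∧ Γ.cycleVertices C ⊆ A := by
  have := hA.to_subtype
  have : Nonempty E := ⟨(next _ hne.some_mem).choose⟩
  choose! a ha hta using next
  -- One arrow is fixed at each vertex of `A`. Iterating the resulting self-map of a finite set
  -- reaches a periodic point, whose orbit has distinct vertices and lifts to a cycle.
  let g : A → A := fun v => ⟨Γ.t (a v), hta v v.2⟩
  obtain ⟨x₀, hx₀⟩ := hne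
  obtain ⟨m, n, hmn, h⟩ := Finite.exists_ne_map_eq_of_infinite fun n : ℕ => g^[n] ⟨x₀, hx₀⟩
  wlog hlt : m < n generalizing m n
  · exact this n m hmn.symm h.symm (by omega)
  set x := g^[m] ⟨x₀, hx₀⟩ with hx
  have hper : x ∈ Function.periodicPts g := by
    refine ⟨n - m, by omega, ?_⟩
    change g^[n - m] x = x
    rw [hx, ← Function.iterate_add_apply, Nat.sub_add_cancel hlt.le]
    exact h.symm
  refine ⟨(Function.periodicOrbit g x).map fun v : A => a v, ⟨?_, ?_, ?_⟩, ?_⟩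
  · rw [Ne, Cycle.map_eq_nil, Function.periodicOrbit_eq_nil_iff_not_periodic_pt]
    exact fun h => h hper
  · rw [Cycle.chain_map, Function.periodicOrbit_chain' _ hper]
    intro k
    rw [Function.iterate_succ_apply', ha _ (Subtype.prop _)]
  · have : (Cycle.map Γ.s ((Function.periodicOrbit g x).map fun v : A => a v)) =
        (Function.periodicOrbit g x).map Subtype.val := by
      simp only [Function.periodicOrbit, Cycle.map_coe, List.map_map]
      congr 2
      funext k
      exact ha _ (Subtype.prop _)
    rw [this]
    have h3 := Function.nodup_periodicOrbit (f := g) (x := x)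
    rw [Function.periodicOrbit, Cycle.nodup_coe_iff] at h3
    rw [Function.periodicOrbit, Cycle.map_coe, Cycle.nodup_coe_iff]
    exact h3.map Subtype.val_injective
  · rintro v ⟨e, he, rfl⟩
    obtain ⟨y, -, rfl⟩ := Cycle.mem_map.1 he
    rw [ha _ y.2]
    exact y.2

end Paths

/-! ### Ends of the graph and their base points -/

section Base

variable {V : Type uV} {E : Type uE}

/-- A base point of a maximal sink or of a maximal cycle with finitely many predecessors, together
with the closed path that runs once around the cycle (the trivial path for a sink). -/
structure IsBase (Γ : DiGraph V E) (v : V) (l : List E) : Prop where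
  path : Γ.IsPath v l v
  nodup : (l.map Γ.s).Nodup
  sink : l = [] → Γ.IsSink v
  cycle : l ≠ [] → Γ.IsCycle l
  -- Maximality in the form in which it is used: an arrow upstream of the base point that lies on
  -- some closed path lies on `l`.
  mem_of_reaches : ∀ e, Γ.Reaches (Γ.s e) v → Γ.Reaches (Γ.t e) (Γ.s e) → e ∈ l
  finite : (Γ.pred v).Finite

variable {Γ : DiGraph V E}

theorem FinMaxSink.isBase (w : Γ.FinMaxSink) : Γ.IsBase w.1 [] where
  path := rfl
  nodup := by simp
  sink _ := w.2.1.1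
  cycle h := absurd rfl h
  mem_of_reaches e h1 h2 := by
    obtain ⟨C, hC, he⟩ := exists_isCycle_of_reaches h2
    exact absurd h1 (Set.disjoint_left.1 (w.2.1.2 C hC) ⟨e, he, rfl⟩)
  finite := w.2.2

theorem FinMaxCycle.isBase (C : Γ.FinMaxCycle) {e : E} {l : List E}
    (h : ((e :: l : List E) : Cycle E) = C.1) : Γ.IsBase (Γ.s e) (e :: l) where
  path := (isCycle_coe.1 (h ▸ C.2.1.1)).1
  nodup := (isCycle_coe.1 (h ▸ C.2.1.1)).2
  sink h := by simp at h
  cycle _ := h ▸ C.2.1.1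
  mem_of_reaches f h1 h2 := by
    obtain ⟨D, hD, hf⟩ := exists_isCycle_of_reaches h2
    have := C.2.1.2 D hD ⟨Γ.s f, ⟨f, hf, rfl⟩, Γ.s e, ⟨e, by rw [← h]; simp, rfl⟩, h1⟩
    rw [this, ← h] at hf
    exact hf
  finite := by
    rw [← C.2.1.1.cyclePred_eq ⟨e, by rw [← h]; simp, rfl⟩]
    exact C.2.2

theorem FinMaxCycle.exists_rep (C : Γ.FinMaxCycle) :
    ∃ x : E × List E, ((x.1 :: x.2 : List E) : Cycle E) = C.1 := by
  obtain ⟨e, l, h⟩ := Cycle.exists_rep C.2.1.1.1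
  exact ⟨(e, l), h⟩

/-- A chosen arrow of a cycle, followed by the rest of the cycle. -/
noncomputable def FinMaxCycle.rep (C : Γ.FinMaxCycle) : E × List E := C.exists_rep.choose

theorem FinMaxCycle.rep_spec (C : Γ.FinMaxCycle) :
    ((C.rep.1 :: C.rep.2 : List E) : Cycle E) = C.1 := C.exists_rep.choose_spec

/-- A chosen base point. -/
noncomputable def basePt : Γ.FinMaxSink ⊕ Γ.FinMaxCycle → V
  | Sum.inl w => w.1
  | Sum.inr C => Γ.s C.rep.1

/-- The closed path at the chosen base point. -/
noncomputable def basePath : Γ.FinMaxSink ⊕ Γ.FinMaxCycle → List E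
  | Sum.inl _ => []
  | Sum.inr C => C.rep.1 :: C.rep.2

theorem isBase (u : Γ.FinMaxSink ⊕ Γ.FinMaxCycle) : Γ.IsBase (basePt u) (basePath u) := by
  cases u with
  | inl w => exact w.isBase
  | inr C => exact C.isBase C.rep_spec

theorem FinMaxCycle.rep_mem (C : Γ.FinMaxCycle) : Γ.s C.rep.1 ∈ Γ.cycleVertices C.1 :=
  ⟨C.rep.1, C.rep_spec ▸ Cycle.mem_coe_iff.2 List.mem_cons_self, rfl⟩

theorem FinMaxCycle.endPred_eq (C : Γ.FinMaxCycle) {v : V} (hv : v ∈ Γ.cycleVertices C.1) :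
    Γ.endPred (Sum.inr C) = Γ.pred v :=
  C.2.1.1.cyclePred_eq hv

theorem endPred_eq (u : Γ.FinMaxSink ⊕ Γ.FinMaxCycle) : Γ.endPred u = Γ.pred (basePt u) := by
  cases u with
  | inl w => rfl
  | inr C => exact C.endPred_eq C.rep_mem

theorem IsSink.eq_of_reaches {v w : V} (hv : Γ.IsSink v) (h : Γ.Reaches v w) : v = w := by
  cases h using Relation.ReflTransGen.head_induction_on with
  | refl => rfl
  | head h _ => obtain ⟨e, he, -⟩ := h; exact absurd he (hv e)

/-- A sink reaches only itself, and maximality forbids a cycle from reaching another end. So the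
predecessors of an end contain no chosen base point but its own, which separates the summands. -/
theorem eq_of_reaches_basePt {u u' : Γ.FinMaxSink ⊕ Γ.FinMaxCycle}
    (h : Γ.Reaches (basePt u') (basePt u)) : u' = u := by
  rcases u' with w' | C'
  · have h1 : w'.1 = basePt u := w'.2.1.1.eq_of_reaches h
    rcases u with w | C
    · exact congrArg Sum.inl (Subtype.ext h1)
    · exact absurd h1.symm (w'.2.1.1 C.rep.1)
  · rcases u with w | C
    · exact absurd h (Set.disjoint_left.1 (w.2.1.2 C'.1 C'.2.1.1) C'.rep_mem)
    · exact congrArg Sum.inr (Subtype.ext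
        (C.2.1.2 C'.1 C'.2.1.1 ⟨_, C'.rep_mem, _, C.rep_mem, h⟩))

end Base

end DiGraph

namespace DiGraph

/-! ### The support of a finite dimensional module -/

section Support

variable {F : Type uF} [Field F] {V : Type uV} {E : Type uE} {Γ : DiGraph V E}
  {X : Type*} [AddCommGroup X] [Module F X] [Module (Scalars F Γ) X]
  [IsScalarTower F (Scalars F Γ) X]

theorem pathAct_smul_mem {v w : V} {l : List E} (h : Γ.IsPath v l w) {m : X}
    (hm : m ∈ vertexSpace F Γ X v) : pathAct F Γ l • m ∈ vertexSpace F Γ X w := by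
  induction l generalizing v m with
  | nil => cases h; simpa using hm
  | cons e l ih =>
    rw [pathAct_cons, mul_smul]
    exact ih h.2 (arr_smul_mem e m)

/-- Multiplying by the dual path gives the preimage, one arrow at a time by (CK1). -/
theorem exists_pathAct_smul_eq {v w : V} {l : List E} (h : Γ.IsPath v l w) {m : X}
    (hm : m ∈ vertexSpace F Γ X w) : ∃ n ∈ vertexSpace F Γ X v, pathAct F Γ l • n = m := by
  induction l generalizing v with
  | nil => cases h; exact ⟨m, hm, by simp⟩
  | cons e l ih =>
    obtain ⟨rfl, h⟩ := h
    obtain ⟨n, hn, rfl⟩ := ih h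
    refine ⟨dua F Γ e • n, dua_smul_mem e n, ?_⟩
    rw [pathAct_cons, mul_smul, arr_dua_smul hn]

variable (F Γ X) in
/-- Right multiplication by a closed path, as an operator on the space at its base point. -/
noncomputable def loopEnd (v : V) (l : List E) : Module.End F (vertexSpace F Γ X v) :=
  ((Algebra.lsmul F F X (vtx F Γ v)).rangeRestrict) ∘ₗ (Algebra.lsmul F F X (pathAct F Γ l)) ∘ₗ
    (vertexSpace F Γ X v).subtype

theorem coe_loopEnd {v : V} {l : List E} (h : Γ.IsPath v l v) (m : vertexSpace F Γ X v) :
    (loopEnd F Γ X v l m : X) = pathAct F Γ l • (m : X) :=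
  vtx_smul_of_mem (pathAct_smul_mem h m.2)

theorem mem_vertexSupport {v : V} : v ∈ vertexSupport F Γ X ↔ ∃ m : X, vtx F Γ v • m ≠ 0 := by
  change vertexSpace F Γ X v ≠ ⊥ ↔ _
  rw [Ne, vertexSpace_eq_bot, not_forall]

theorem notMem_vertexSupport {v : V} :
    v ∉ vertexSupport F Γ X ↔ ∀ m : X, vtx F Γ v • m = 0 := by
  rw [mem_vertexSupport]
  push Not
  rfl

theorem mem_vertexSupport_of_ne_zero {v : V} {m : X} (hm : m ∈ vertexSpace F Γ X v)
    (h : m ≠ 0) : v ∈ vertexSupport F Γ X :=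
  mem_vertexSupport.2 ⟨m, by rwa [vtx_smul_of_mem hm]⟩

/-- By (CK1) a nonzero vector at `t e` is recovered from its product with `e*`, a vector at `s e`
which is therefore nonzero. -/
theorem mem_vertexSupport_of_reaches {v w : V} (h : Γ.Reaches v w)
    (hw : w ∈ vertexSupport F Γ X) : v ∈ vertexSupport F Γ X := by
  induction h using Relation.ReflTransGen.head_induction_on with
  | refl => exact hw
  | head h _ ih =>
    obtain ⟨e, rfl, rfl⟩ := h
    obtain ⟨m, hm⟩ := mem_vertexSupport.1 ih
    refine mem_vertexSupport_of_ne_zero (dua_smul_mem e m) fun h0 => hm ?_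
    rw [← arr_mul_dua, mul_smul, h0, smul_zero]

/-- By (CK2), available because of row-finiteness, a vector at `v` is the sum of the `m e e*`; each
term would vanish if no target were in the support. -/
theorem exists_arrow_of_mem_vertexSupport (hΓ : Γ.RowFinite) {v : V}
    (hv : v ∈ vertexSupport F Γ X) (hs : ¬Γ.IsSink v) :
    ∃ e, Γ.s e = v ∧ Γ.t e ∈ vertexSupport F Γ X := by
  obtain ⟨m, hm⟩ := mem_vertexSupport.1 hv
  by_contra! hcon
  refine hm ?_
  simp only [IsSink, not_forall, not_not] at hs
  obtain ⟨e, he⟩ := hs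
  rw [eq_sum_of_mem (hΓ v) ⟨e, he⟩ (vtx_smul_mem v m)]
  refine Finset.sum_eq_zero fun f hf => ?_
  have h2 := notMem_vertexSupport.1 (hcon f (by simpa using hf)) (arr F Γ f • vtx F Γ v • m)
  rw [vtx_smul_of_mem (arr_smul_mem f _)] at h2
  rw [h2, smul_zero]

theorem vertexSpace_iSupIndep : iSupIndep (vertexSpace F Γ X) := by
  intro v
  rw [Submodule.disjoint_def]
  intro x hx hx'
  rw [← vtx_smul_of_mem hx]
  have : (⨆ w, ⨆ (_ : w ≠ v), vertexSpace F Γ X w) ≤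
      LinearMap.ker (Algebra.lsmul F F X (vtx F Γ v)) :=
    iSup₂_le fun w hw x hx => vtx_smul_of_mem_of_ne hx hw.symm
  exact this hx'

variable [FiniteDimensional F X]

/-- An independent family of subspaces of a finite dimensional space has only finitely many nonzero
members. -/
theorem vertexSupport_finite : (vertexSupport F Γ X).Finite :=
  WellFoundedGT.finite_ne_bot_of_iSupIndep vertexSpace_iSupIndep

theorem loopEnd_surjective {v : V} {l : List E} (h : Γ.IsPath v l v) :
    Function.Surjective (loopEnd F Γ X v l) := by
  intro m
  obtain ⟨n, hn, hnm⟩ := exists_pathAct_smul_eq h m.2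
  exact ⟨⟨n, hn⟩, Subtype.ext (by rw [coe_loopEnd h, hnm])⟩

/-- Here finite dimension enters: a surjective endomorphism is injective. This is what makes the
exits of a cycle act as zero. -/
theorem loopEnd_injective {v : V} {l : List E} (h : Γ.IsPath v l v) :
    Function.Injective (loopEnd F Γ X v l) :=
  LinearMap.injective_iff_surjective.2 (loopEnd_surjective h)

theorem eq_zero_of_pathAct_smul {v : V} {l : List E} (h : Γ.IsPath v l v) {m : X}
    (hm : m ∈ vertexSpace F Γ X v) (h0 : pathAct F Γ l • m = 0) : m = 0 := by
  have : (⟨m, hm⟩ : vertexSpace F Γ X v) = 0 := by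
    refine loopEnd_injective h (Subtype.ext ?_)
    rw [coe_loopEnd h, map_zero]
    exact h0
  exact congrArg Subtype.val this

/-- The first arrow of a closed path acts invertibly. -/
theorem dua_arr_smul_of_path {v : V} {e : E} {l : List E} (h : Γ.IsPath v (e :: l) v) {m : X}
    (hm : m ∈ vertexSpace F Γ X v) : dua F Γ e • arr F Γ e • m = m := by
  obtain ⟨rfl, h'⟩ := id h
  -- The difference of the two sides is killed by `e` by (CK1), hence by the whole closed path,
  -- hence it is zero.
  refine (sub_eq_zero.1 (eq_zero_of_pathAct_smul h
    (Submodule.sub_mem _ hm (dua_smul_mem e _)) ?_)).symm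
  rw [pathAct_cons, mul_smul, smul_sub, arr_dua_smul (arr_smul_mem e m), sub_self, smul_zero]

/-- Other arrows at the base point of a closed path act trivially. -/
theorem arr_smul_eq_zero_of_path {v : V} {e f : E} {l : List E} (h : Γ.IsPath v (e :: l) v)
    (hf : f ≠ e) {m : X} (hm : m ∈ vertexSpace F Γ X v) : arr F Γ f • m = 0 := by
  rw [← dua_arr_smul_of_path h hm, ← mul_smul, arr_mul_dua_of_ne hf, zero_smul]

theorem IsCycle.dua_arr_smul {C : Cycle E} (hC : Γ.IsCycle C) {e : E} (he : e ∈ C) {m : X}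
    (hm : m ∈ vertexSpace F Γ X (Γ.s e)) : dua F Γ e • arr F Γ e • m = m := by
  obtain ⟨l, rfl⟩ := Cycle.exists_rep_of_mem he
  exact dua_arr_smul_of_path (isCycle_coe.1 hC).1 hm

theorem IsCycle.arr_smul_eq_zero {C : Cycle E} (hC : Γ.IsCycle C) {f : E} (hf : f ∉ C)
    (hfC : Γ.s f ∈ Γ.cycleVertices C) (m : X) : arr F Γ f • m = 0 := by
  obtain ⟨e, he, hef⟩ := hfC
  obtain ⟨l, rfl⟩ := Cycle.exists_rep_of_mem he
  rw [← arr_mul_vtx, mul_smul]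
  refine arr_smul_eq_zero_of_path (hef ▸ (isCycle_coe.1 hC).1) ?_ (vtx_smul_mem _ m)
  rintro rfl
  exact hf he

/-- An arrow leaving the cycle acts as zero, yet by (CK1) it maps onto the space at its target; so
that space is zero. -/
theorem IsCycle.mem_of_target_mem {C : Cycle E} (hC : Γ.IsCycle C) {f : E}
    (hfC : Γ.s f ∈ Γ.cycleVertices C) (hf : Γ.t f ∈ vertexSupport F Γ X) : f ∈ C := by
  by_contra hcon
  obtain ⟨m, hm⟩ := mem_vertexSupport.1 hf
  refine hm ?_
  rw [← arr_dua_smul (vtx_smul_mem (Γ.t f) m)]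
  exact hC.arr_smul_eq_zero hcon hfC _

theorem IsCycle.mem_cycleVertices_of_reaches {C : Cycle E} (hC : Γ.IsCycle C) {v w : V}
    (hv : v ∈ Γ.cycleVertices C) (h : Γ.Reaches v w) (hw : w ∈ vertexSupport F Γ X) :
    w ∈ Γ.cycleVertices C := by
  induction h using Relation.ReflTransGen.head_induction_on with
  | refl => exact hv
  | head h h' ih =>
    obtain ⟨e, rfl, rfl⟩ := h
    exact ih (hC.target_mem (hC.mem_of_target_mem hv (mem_vertexSupport_of_reaches h' hw)))

/-- The support of a nonzero finite dimensional module contains a maximal sink or a maximal cycle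
with finitely many predecessors. -/
theorem exists_basePt_mem (hΓ : Γ.RowFinite) (hX : IsUnital F Γ X) [Nontrivial X] :
    ∃ u : Γ.FinMaxSink ⊕ Γ.FinMaxCycle, basePt u ∈ vertexSupport F Γ X := by
  have hpred : ∀ w ∈ vertexSupport F Γ X, (Γ.pred w).Finite := fun w hw =>
    (vertexSupport_finite (F := F) (X := X)).subset fun v hv => mem_vertexSupport_of_reaches hv hw
  by_cases hs : ∃ w ∈ vertexSupport F Γ X, Γ.IsSink w
  · obtain ⟨w, hw, hsink⟩ := hs
    refine ⟨Sum.inl ⟨w, ⟨hsink, fun C hC => Set.disjoint_left.2 fun v hv hvw => ?_⟩,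
      hpred w hw⟩, hw⟩
    obtain ⟨e, -, he⟩ := hC.mem_cycleVertices_of_reaches hv hvw hw
    exact hsink e he
  · push Not at hs
    have hne : (vertexSupport F Γ X).Nonempty := by
      obtain ⟨m, hm⟩ := exists_ne (0 : X)
      by_contra hcon
      refine hm (hX.eq_zero fun v => ?_)
      exact notMem_vertexSupport.1 (fun h => hcon ⟨v, h⟩) m
    -- Without sinks in the support, every vertex of it has an arrow that stays in it.
    obtain ⟨C, hC, hsub⟩ := exists_isCycle_of_next (vertexSupport_finite (F := F) (X := X)) hne
      fun v hv => exists_arrow_of_mem_vertexSupport hΓ hv (hs v hv)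
    -- A cycle `D` that reaches `C` cannot be left inside the support, so it already contains a
    -- vertex of `C`; and the arrows of `C` stay in the support, so those starting on `D` belong to
    -- `D`.
    have hmax : Γ.IsMaximalCycle C := by
      refine ⟨hC, fun D hD ⟨v, hv, w, hw, hvw⟩ => ?_⟩
      refine (hC.eq_of_common_vertex hD hw
        (hD.mem_cycleVertices_of_reaches hv hvw (hsub hw)) fun e he heD => ?_).symm
      exact hD.mem_of_target_mem heD (hsub (hC.target_mem he))
    have hfin : (Γ.cyclePred C).Finite := by
      obtain ⟨e, l, h⟩ := Cycle.exists_rep hC.1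
      have he : Γ.s e ∈ Γ.cycleVertices C := ⟨e, h ▸ Cycle.mem_coe_iff.2 List.mem_cons_self, rfl⟩
      rw [hC.cyclePred_eq he]
      exact hpred _ (hsub he)
    exact ⟨Sum.inr ⟨C, hmax, hfin⟩, hsub (FinMaxCycle.rep_mem (⟨C, hmax, hfin⟩ : Γ.FinMaxCycle))⟩

end Support

/-! ### Submodules generated at a base point -/

section Generated

variable {F : Type uF} [Field F] {V : Type uV} {E : Type uE} {Γ : DiGraph V E}
  {X : Type*} [AddCommGroup X] [Module F X] [Module (Scalars F Γ) X]
  [IsScalarTower F (Scalars F Γ) X]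

/-- The elements obtained from a subspace by multiplying with dual arrows. -/
inductive DualOrbit (Y : Submodule F X) : X → Prop
  | base {y : X} (hy : y ∈ Y) : DualOrbit Y y
  | dual (e : E) {m : X} (hm : DualOrbit Y m) : DualOrbit Y (dua F Γ e • m)

variable (Γ) in
/-- The subspace spanned by the products with dual paths. -/
def dualSpan (Y : Submodule F X) : Submodule F X := Submodule.span F {m | DualOrbit (Γ := Γ) Y m}

variable {Y : Submodule F X}

theorem le_dualSpan : Y ≤ dualSpan Γ Y := fun _ hy => Submodule.subset_span (.base hy)

theorem smul_mem_dualSpan_of_orbit {s : Scalars F Γ}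
    (h : ∀ m, DualOrbit (Γ := Γ) Y m → s • m ∈ dualSpan Γ Y) {m : X} (hm : m ∈ dualSpan Γ Y) :
    s • m ∈ dualSpan Γ Y := by
  have : dualSpan Γ Y ≤ (dualSpan Γ Y).comap (Algebra.lsmul F F X s) := Submodule.span_le.2 h
  exact this hm

theorem dua_smul_mem_dualSpan (e : E) {m : X} (hm : m ∈ dualSpan Γ Y) :
    dua F Γ e • m ∈ dualSpan Γ Y :=
  smul_mem_dualSpan_of_orbit (fun _ h => Submodule.subset_span (.dual e h)) hm

theorem vtx_smul_mem_dualSpan {v₀ : V} (hY : Y ≤ vertexSpace F Γ X v₀) (v : V) {m : X}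
    (hm : m ∈ dualSpan Γ Y) : vtx F Γ v • m ∈ dualSpan Γ Y := by
  refine smul_mem_dualSpan_of_orbit (fun m hm => ?_) hm
  cases hm with
  | base hy =>
    by_cases h : v = v₀
    · subst h
      rw [vtx_smul_of_mem (hY hy)]
      exact le_dualSpan hy
    · rw [vtx_smul_of_mem_of_ne (hY hy) h]
      exact Submodule.zero_mem _
  | dual e h =>
    by_cases hv : v = Γ.s e
    · subst hv
      rw [vtx_smul_of_mem (dua_smul_mem e _)]
      exact Submodule.subset_span (.dual e h)
    · rw [vtx_smul_of_mem_of_ne (dua_smul_mem e _) hv]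
      exact Submodule.zero_mem _

variable [FiniteDimensional F X]

/-- On a cycle the dual arrow inverts the arrow, so moving along the cycle is undone by dual arrows,
under which the span is stable. -/
theorem mem_dualSpan_of_pathAct_smul {C : Cycle E} (hC : Γ.IsCycle C) {v w : V} {l : List E}
    (hl : Γ.IsPath v l w) (hlC : ∀ e ∈ l, e ∈ C) {m : X} (hm : m ∈ vertexSpace F Γ X v)
    (h : pathAct F Γ l • m ∈ dualSpan Γ Y) : m ∈ dualSpan Γ Y := by
  induction l generalizing v m with
  | nil => simpa using h
  | cons e l ih =>
    obtain ⟨rfl, hl⟩ := hl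
    rw [← hC.dua_arr_smul (hlC e (by simp)) hm]
    refine dua_smul_mem_dualSpan e (ih hl (fun f hf => hlC f (by simp [hf])) (arr_smul_mem e m) ?_)
    rwa [pathAct_cons, mul_smul] at h

/-- An arrow following a dual arrow is resolved by (CK1). On `Y` itself only the first arrow of `l`
can act nontrivially, and its effect is recovered from the full turn, which stays in `Y`, by undoing
the remaining arrows. -/
theorem IsBase.arr_smul_mem_dualSpan {v : V} {l : List E} (hb : Γ.IsBase v l)
    (hY : Y ≤ vertexSpace F Γ X v) (hT : ∀ y ∈ Y, pathAct F Γ l • y ∈ Y) (f : E) {m : X}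
    (hm : m ∈ dualSpan Γ Y) : arr F Γ f • m ∈ dualSpan Γ Y := by
  refine smul_mem_dualSpan_of_orbit (fun m hm => ?_) hm
  cases hm with
  | base hy =>
    by_cases hf : Γ.s f = v
    swap
    · rw [arr_smul_of_ne (hY hy) hf]
      exact Submodule.zero_mem _
    cases l with
    | nil => exact absurd hf (hb.sink rfl f)
    | cons e l =>
      by_cases hfe : f = e
      · subst hfe
        have hC := hb.cycle (by simp)
        refine mem_dualSpan_of_pathAct_smul hC hb.path.2 (fun e he => by simp [he])
          (arr_smul_mem f _) ?_
        rw [← mul_smul, ← pathAct_cons]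
        exact le_dualSpan (hT _ hy)
      · rw [arr_smul_eq_zero_of_path hb.path hfe (hY hy)]
        exact Submodule.zero_mem _
  | @dual e n h =>
    rw [← mul_smul]
    by_cases hef : f = e
    · subst hef
      rw [arr_mul_dua]
      exact vtx_smul_mem_dualSpan hY _ (Submodule.subset_span h)
    · rw [arr_mul_dua_of_ne hef, zero_smul]
      exact Submodule.zero_mem _

/-- An invariant subspace is mapped onto itself. -/
theorem mem_of_pathAct_smul_mem {v : V} {l : List E} (hl : Γ.IsPath v l v)
    (hY : Y ≤ vertexSpace F Γ X v) (hT : ∀ y ∈ Y, pathAct F Γ l • y ∈ Y) {m : X}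
    (hm : m ∈ vertexSpace F Γ X v) (h : pathAct F Γ l • m ∈ Y) : m ∈ Y := by
  let T : Y →ₗ[F] Y := (Algebra.lsmul F F X (pathAct F Γ l)).restrict hT
  have hinj : Function.Injective T := by
    rw [← LinearMap.ker_eq_bot, LinearMap.ker_eq_bot']
    intro y hy
    exact Subtype.ext (eq_zero_of_pathAct_smul hl (hY y.2) (congrArg Subtype.val hy))
  obtain ⟨y, hy⟩ := LinearMap.injective_iff_surjective.1 hinj ⟨_, h⟩
  have h1 : pathAct F Γ l • (y : X) = pathAct F Γ l • m := congrArg Subtype.val hy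
  have h2 : (y : X) - m = 0 :=
    eq_zero_of_pathAct_smul hl (Submodule.sub_mem _ (hY y.2) hm) (by rw [smul_sub, h1, sub_self])
  rw [← sub_eq_zero.1 h2]
  exact y.2

/-- Each arrow either kills the element or cancels its last dual arrow, which leaves a shorter
suffix of the loop. The induction therefore has to run over all nonempty suffixes of `l`, though
only `l` itself is wanted. -/
theorem IsBase.pathAct_smul_mem_of_dualOrbit {v : V} {l : List E} (hb : Γ.IsBase v l)
    (hY : Y ≤ vertexSpace F Γ X v) (hT : ∀ y ∈ Y, pathAct F Γ l • y ∈ Y) {m : X}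
    (hm : DualOrbit (Γ := Γ) Y m) {l₁ l₂ : List E} (hl : l = l₁ ++ l₂) (hne : l₂ ≠ []) :
    pathAct F Γ l₂ • m ∈ Y := by
  induction hm generalizing l₁ l₂ with
  | @base y hy =>
    rcases l₁ with _ | ⟨e, l₁⟩
    · simp only [List.nil_append] at hl
      subst hl
      exact hT y hy
    · cases l₂ with
      | nil => exact absurd rfl hne
      | cons f l₂ =>
        have hn := hb.nodup
        have h1 : Γ.s e = v := by
          have := hb.path
          rw [hl] at this
          exact this.1
        -- A proper suffix starts away from `v`, the sources being distinct, and so it kills `Y`.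
        rw [pathAct_cons, mul_smul, arr_smul_of_ne (hY hy), smul_zero]
        · exact Y.zero_mem
        · rw [← h1]
          intro h2
          rw [hl, List.cons_append, List.map_cons, List.nodup_cons] at hn
          exact hn.1 (by rw [← h2]; exact List.mem_map_of_mem (by simp))
  | @dual f m hm ih =>
    cases l₂ with
    | nil => exact absurd rfl hne
    | cons g l₂ =>
      rw [pathAct_cons, mul_smul]
      by_cases hgf : g = f
      swap
      · rw [← mul_smul (arr F Γ g), arr_mul_dua_of_ne hgf, zero_smul, smul_zero]
        exact Y.zero_mem
      subst hgf
      rw [← mul_smul (arr F Γ g), arr_mul_dua]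
      have hp := hb.path
      rw [hl, isPath_append] at hp
      obtain ⟨x, -, -, hp⟩ := hp
      cases l₂ with
      | nil =>
        -- The suffix is used up: the induction restarts with the whole of `l`, which is then
        -- cancelled because `l` maps `Y` onto itself.
        obtain rfl : Γ.t g = v := hp
        rw [pathAct_nil, one_smul]
        refine mem_of_pathAct_smul_mem hb.path hY hT (vtx_smul_mem _ m) ?_
        have := ih (l₁ := []) (l₂ := l) rfl (by rw [hl]; simp)
        cases l with
        | nil => simp at hl
        | cons e l =>
          rwa [← hb.path.1, pathAct_cons, ← mul_smul, mul_assoc, arr_mul_vtx, ← pathAct_cons]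
      | cons h l₂ =>
        rw [← hp.1, pathAct_cons, ← mul_smul, mul_assoc, arr_mul_vtx, ← pathAct_cons]
        exact ih (l₁ := l₁ ++ [g]) (by simp [hl]) (by simp)

/-- The generated submodule adds nothing at the base point. A dual arrow never leads to a sink, as a
sink emits no arrow. On a cycle, `l` maps the whole span into `Y`, and only elements of `Y` at `v`
are mapped there. -/
theorem IsBase.mem_of_mem_dualSpan {v : V} {l : List E} (hb : Γ.IsBase v l)
    (hY : Y ≤ vertexSpace F Γ X v) (hT : ∀ y ∈ Y, pathAct F Γ l • y ∈ Y) {m : X}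
    (hm : m ∈ dualSpan Γ Y) (hmv : m ∈ vertexSpace F Γ X v) : m ∈ Y := by
  by_cases hl : l = []
  · have hle : dualSpan Γ Y ≤ Y.comap (Algebra.lsmul F F X (vtx F Γ v)) := by
      refine Submodule.span_le.2 fun m hm => ?_
      change vtx F Γ v • m ∈ Y
      cases hm with
      | base hy => rwa [vtx_smul_of_mem (hY hy)]
      | dual e h =>
        rw [vtx_smul_of_mem_of_ne (dua_smul_mem e _) fun h => hb.sink hl e h.symm]
        exact Y.zero_mem
    rw [← vtx_smul_of_mem hmv]
    exact hle hm
  · have hle : dualSpan Γ Y ≤ Y.comap (Algebra.lsmul F F X (pathAct F Γ l)) :=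
      Submodule.span_le.2 fun m hm =>
        hb.pathAct_smul_mem_of_dualOrbit hY hT hm (List.nil_append l).symm hl
    exact mem_of_pathAct_smul_mem hb.path hY hT hmv (hle hm)

theorem DualOrbit.reaches {v₀ : V} (hY : Y ≤ vertexSpace F Γ X v₀) {m : X}
    (hm : DualOrbit (Γ := Γ) Y m) {v : V} (hv : vtx F Γ v • m ≠ 0) : Γ.Reaches v v₀ := by
  induction hm generalizing v with
  | base hy =>
    by_cases h : v = v₀
    · rw [h]
      exact reaches_refl _
    · exact absurd (vtx_smul_of_mem_of_ne (hY hy) h) hv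
  | dual e h ih =>
    by_cases h : v = Γ.s e
    · subst h
      refine (reaches_arrow e).trans (ih fun h0 => ?_)
      rw [← dua_mul_vtx, mul_smul, h0, smul_zero, smul_zero] at hv
      exact hv rfl
    · exact absurd (vtx_smul_of_mem_of_ne (dua_smul_mem e _) h) hv

theorem reaches_of_mem_dualSpan {v₀ : V} (hY : Y ≤ vertexSpace F Γ X v₀) {m : X}
    (hm : m ∈ dualSpan Γ Y) {v : V} (hv : vtx F Γ v • m ≠ 0) : Γ.Reaches v v₀ := by
  by_contra hcon
  have hle : dualSpan Γ Y ≤ LinearMap.ker (Algebra.lsmul F F X (vtx F Γ v)) := by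
    refine Submodule.span_le.2 fun m hm => ?_
    by_contra hne
    exact hcon (hm.reaches hY hne)
  exact hv (hle hm)

/-- Every invariant subspace at a base point is the space at the base point of a submodule that is
supported on the predecessors. -/
theorem IsBase.exists_submodule {v : V} {l : List E} (hb : Γ.IsBase v l)
    (hY : Y ≤ vertexSpace F Γ X v) (hT : ∀ y ∈ Y, pathAct F Γ l • y ∈ Y) :
    ∃ N : Submodule (Scalars F Γ) X, (∀ m ∈ vertexSpace F Γ X v, m ∈ N ↔ m ∈ Y) ∧
      ∀ m ∈ N, ∀ w, ¬Γ.Reaches w v → vtx F Γ w • m = 0 := by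
  refine ⟨submoduleOfGen (dualSpan Γ Y) (fun w m hm => vtx_smul_mem_dualSpan hY w hm)
    (fun f m hm => hb.arr_smul_mem_dualSpan hY hT f hm)
    (fun e m hm => dua_smul_mem_dualSpan e hm), fun m hm => ?_, fun m hm w hw => ?_⟩
  · rw [mem_submoduleOfGen]
    exact ⟨fun h => hb.mem_of_mem_dualSpan hY hT h hm, fun h => le_dualSpan h⟩
  · by_contra h
    exact hw (reaches_of_mem_dualSpan hY hm h)

end Generated

end DiGraph

namespace DiGraph

/-! ### The decomposition along the ends -/

section Decomposition

variable {F : Type uF} [Field F] {V : Type uV} {E : Type uE} {Γ : DiGraph V E}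
  {X : Type*} [AddCommGroup X] [Module F X] [Module (Scalars F Γ) X]
  [IsScalarTower F (Scalars F Γ) X]
  {X' : Type*} [AddCommGroup X'] [Module F X'] [Module (Scalars F Γ) X']
  [IsScalarTower F (Scalars F Γ) X']

variable (F Γ X) in
/-- The largest submodule supported on `A`. -/
def suppPart (A : Set V) : Submodule (Scalars F Γ) X where
  carrier := {m | ∀ a : Scalars F Γ, ∀ v ∉ A, vtx F Γ v • a • m = 0}
  add_mem' h1 h2 a v hv := by rw [smul_add, smul_add, h1 a v hv, h2 a v hv, add_zero]
  zero_mem' a v _ := by rw [smul_zero, smul_zero]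
  smul_mem' s m h a v hv := by rw [smul_smul a s]; exact h _ v hv

variable (F Γ X) in
/-- The submodule of those elements all of whose multiples have components at `v` that are
annihilated by an element of `T`, acting through the path `l`. -/
def torsPart (v : V) (l : List E) (T : Submonoid F[X]) : Submodule (Scalars F Γ) X where
  carrier := {m | ∀ a : Scalars F Γ, ∃ h ∈ T, aeval (pathAct F Γ l) h • vtx F Γ v • a • m = 0}
  add_mem' := by
    intro m n h1 h2 a
    obtain ⟨p, hp, hp0⟩ := h1 a
    obtain ⟨q, hq, hq0⟩ := h2 a
    refine ⟨p * q, T.mul_mem hp hq, ?_⟩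
    rw [smul_add, smul_add, smul_add, map_mul, mul_smul, mul_smul, hq0, ← mul_smul,
      ← map_mul, mul_comm p q, map_mul, mul_smul, hp0, smul_zero, smul_zero, add_zero]
  zero_mem' a := ⟨1, T.one_mem, by simp⟩
  smul_mem' s m h a := by
    obtain ⟨p, hp, hp0⟩ := h (a * s)
    exact ⟨p, hp, by rwa [mul_smul a s] at hp0⟩

theorem vtx_smul_of_mem_suppPart {A : Set V} {m : X} (hm : m ∈ suppPart F Γ X A) {v : V}
    (hv : v ∉ A) : vtx F Γ v • m = 0 := by
  simpa using hm 1 v hv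

theorem le_suppPart {A : Set V} {N : Submodule (Scalars F Γ) X}
    (h : ∀ m ∈ N, ∀ v ∉ A, vtx F Γ v • m = 0) : N ≤ suppPart F Γ X A :=
  fun _ hm a v hv => h _ (N.smul_mem a hm) v hv

theorem suppPart_mono {A B : Set V} (h : A ⊆ B) : suppPart F Γ X A ≤ suppPart F Γ X B :=
  fun _ hm a v hv => hm a v fun h' => hv (h h')

theorem suppPart_map (g : X →ₗ[Scalars F Γ] X') (A : Set V) :
    (suppPart F Γ X A).map g ≤ suppPart F Γ X' A := by
  rintro _ ⟨m, hm, rfl⟩ a v hv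
  rw [← map_smul, ← map_smul, hm a v hv, map_zero]

theorem torsPart_map (g : X →ₗ[Scalars F Γ] X') (v : V) (l : List E) (T : Submonoid F[X]) :
    (torsPart F Γ X v l T).map g ≤ torsPart F Γ X' v l T := by
  rintro _ ⟨m, hm, rfl⟩ a
  obtain ⟨h, hT, h0⟩ := hm a
  exact ⟨h, hT, by rw [← map_smul, ← map_smul, ← map_smul, h0, map_zero]⟩

theorem aeval_smul_mem {v : V} {l : List E} (hl : Γ.IsPath v l v) (p : F[X]) {m : X}
    (hm : m ∈ vertexSpace F Γ X v) : aeval (pathAct F Γ l) p • m ∈ vertexSpace F Γ X v := by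
  induction p using Polynomial.induction_on generalizing m with
  | C a =>
    rw [aeval_C, algebraMap_smul]
    exact Submodule.smul_mem _ _ hm
  | add p q hp hq =>
    rw [map_add, add_smul]
    exact Submodule.add_mem _ (hp hm) (hq hm)
  | monomial n a h =>
    rw [pow_succ, ← mul_assoc, map_mul, mul_smul, aeval_X]
    exact h (pathAct_smul_mem hl hm)

variable [FiniteDimensional F X]

/-- The test for vanishing on which all comparisons rest: a nonzero submodule has a base point in
its support. -/
theorem eq_bot_of_basePt (hΓ : Γ.RowFinite) (hX : IsUnital F Γ X) {N : Submodule (Scalars F Γ) X}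
    (h : ∀ u : Γ.FinMaxSink ⊕ Γ.FinMaxCycle, ∀ m ∈ N, vtx F Γ (basePt u) • m = 0) : N = ⊥ := by
  by_contra hne
  have : Nontrivial N := Submodule.nontrivial_iff_ne_bot.2 hne
  have : FiniteDimensional F N := inferInstanceAs (FiniteDimensional F (N.restrictScalars F))
  obtain ⟨u, hu⟩ := exists_basePt_mem hΓ (hX.submodule N)
  obtain ⟨m, hm⟩ := mem_vertexSupport.1 hu
  exact hm (Subtype.ext (h u m m.2))

instance (N : Submodule (Scalars F Γ) X) : FiniteDimensional F N :=
  inferInstanceAs (FiniteDimensional F (N.restrictScalars F))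

instance (N : Submodule (Scalars F Γ) X) : FiniteDimensional F (X ⧸ N) :=
  Module.Finite.of_surjective (N.mkQ.restrictScalars F) N.mkQ_surjective

/-- Submodules that are supported on the predecessors of an end are determined at its base
point. -/
theorem le_of_basePt (hΓ : Γ.RowFinite) (hX : IsUnital F Γ X)
    (u : Γ.FinMaxSink ⊕ Γ.FinMaxCycle) {N N' : Submodule (Scalars F Γ) X}
    (hN : N ≤ suppPart F Γ X (Γ.endPred u))
    (h : ∀ m ∈ N, m ∈ vertexSpace F Γ X (basePt u) → m ∈ N') : N ≤ N' := by
  -- In the quotient by `N'` the image of `N` vanishes at the base point of `u` by `h`, and at all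
  -- the others because of its support.
  have hbot : N.map N'.mkQ = ⊥ := by
    refine eq_bot_of_basePt hΓ (hX.quotient N') fun u' m hm => ?_
    obtain ⟨n, hn, rfl⟩ := hm
    rw [← map_smul]
    by_cases hu : u' = u
    · subst hu
      rw [Submodule.mkQ_apply, Submodule.Quotient.mk_eq_zero]
      exact h _ (N.smul_mem _ hn) (vtx_smul_mem _ n)
    · rw [vtx_smul_of_mem_suppPart (hN hn), map_zero]
      rw [endPred_eq]
      exact fun hr => hu (eq_of_reaches_basePt hr)
  intro m hm
  have h0 : N'.mkQ m ∈ N.map N'.mkQ := ⟨m, hm, rfl⟩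
  rwa [hbot, Submodule.mem_bot, Submodule.mkQ_apply, Submodule.Quotient.mk_eq_zero] at h0

theorem mem_suppPart_of_mem_basePt (u : Γ.FinMaxSink ⊕ Γ.FinMaxCycle) {m : X}
    (hm : m ∈ vertexSpace F Γ X (basePt u)) : m ∈ suppPart F Γ X (Γ.endPred u) := by
  obtain ⟨N, h1, h2⟩ := (isBase u).exists_submodule le_rfl
    fun y hy => pathAct_smul_mem (F := F) (X := X) (isBase u).path hy
  refine le_suppPart (N := N) (fun m hm v hv => h2 m hm v ?_) ((h1 m hm).2 hm)
  rwa [endPred_eq] at hv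

/-- The space at each base point lies in the corresponding part, so the quotient by the sum of all
parts has no base point in its support. -/
theorem iSup_suppPart (hΓ : Γ.RowFinite) (hX : IsUnital F Γ X) :
    ⨆ u : Γ.FinMaxSink ⊕ Γ.FinMaxCycle, suppPart F Γ X (Γ.endPred u) = ⊤ := by
  set N : Submodule (Scalars F Γ) X :=
    ⨆ u : Γ.FinMaxSink ⊕ Γ.FinMaxCycle, suppPart F Γ X (Γ.endPred u) with hN
  have hbot : (⊤ : Submodule (Scalars F Γ) (X ⧸ N)) = ⊥ := by
    refine eq_bot_of_basePt hΓ (hX.quotient N) fun u m _ => ?_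
    obtain ⟨m, rfl⟩ := N.mkQ_surjective m
    rw [← map_smul, Submodule.mkQ_apply, Submodule.Quotient.mk_eq_zero, hN]
    exact Submodule.mem_iSup_of_mem u (mem_suppPart_of_mem_basePt u (vtx_smul_mem _ m))
  refine eq_top_iff.2 fun m _ => ?_
  have h0 : N.mkQ m ∈ (⊤ : Submodule (Scalars F Γ) (X ⧸ N)) := trivial
  rwa [hbot, Submodule.mem_bot, Submodule.mkQ_apply, Submodule.Quotient.mk_eq_zero] at h0

theorem iSupIndep_suppPart (hΓ : Γ.RowFinite) (hX : IsUnital F Γ X) :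
    iSupIndep fun u : Γ.FinMaxSink ⊕ Γ.FinMaxCycle => suppPart F Γ X (Γ.endPred u) := by
  intro u
  rw [disjoint_iff]
  refine eq_bot_of_basePt hΓ hX fun u' m hm => ?_
  by_cases hu : u' = u
  · subst hu
    -- All other parts avoid the base point of `u'`, since `u'` does not reach the other ends.
    have hle : ⨆ u, ⨆ (_ : u ≠ u'), suppPart F Γ X (Γ.endPred u) ≤
        suppPart F Γ X {basePt u'}ᶜ := by
      refine iSup₂_le fun u hu => suppPart_mono ?_
      rw [endPred_eq]
      rintro v hv rfl
      exact hu (eq_of_reaches_basePt hv).symm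
    exact vtx_smul_of_mem_suppPart (hle hm.2) (by simp)
  · refine vtx_smul_of_mem_suppPart hm.1 ?_
    rw [endPred_eq]
    exact fun hr => hu (eq_of_reaches_basePt hr)

theorem basePt_mem_vertexSupport (hΓ : Γ.RowFinite) (hX : IsUnital F Γ X)
    (u : Γ.FinMaxSink ⊕ Γ.FinMaxCycle) {N : Submodule (Scalars F Γ) X}
    (hN : N ≤ suppPart F Γ X (Γ.endPred u)) (hne : N ≠ ⊥) : basePt u ∈ vertexSupport F Γ N := by
  by_contra hcon
  refine hne (le_bot_iff.1 (le_of_basePt hΓ hX u hN fun m hm hmu => ?_))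
  have := notMem_vertexSupport.1 hcon ⟨m, hm⟩
  rw [Submodule.mem_bot, ← vtx_smul_of_mem hmu]
  exact congrArg Subtype.val this

theorem vertexSupport_suppPart (hΓ : Γ.RowFinite) (hX : IsUnital F Γ X)
    (u : Γ.FinMaxSink ⊕ Γ.FinMaxCycle) (hne : suppPart F Γ X (Γ.endPred u) ≠ ⊥) :
    vertexSupport F Γ (suppPart F Γ X (Γ.endPred u)) = Γ.endPred u := by
  ext v
  constructor
  · intro hv
    by_contra hcon
    obtain ⟨m, hm⟩ := mem_vertexSupport.1 hv
    exact hm (Subtype.ext (vtx_smul_of_mem_suppPart m.2 hcon))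
  · intro hv
    rw [endPred_eq] at hv
    exact mem_vertexSupport_of_reaches hv (basePt_mem_vertexSupport hΓ hX u le_rfl hne)

end Decomposition

/-! ### The primary decomposition at a cycle -/

section Primary

variable {F : Type uF} [Field F] {V : Type uV} {E : Type uE} {Γ : DiGraph V E}
  {X : Type*} [AddCommGroup X] [Module F X] [Module (Scalars F Γ) X]
  [IsScalarTower F (Scalars F Γ) X]
  {X' : Type*} [AddCommGroup X'] [Module F X'] [Module (Scalars F Γ) X']
  [IsScalarTower F (Scalars F Γ) X']

variable (F Γ X) in
/-- The `f`-primary part of the summand belonging to a maximal cycle. -/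
noncomputable def primPart (C : Γ.FinMaxCycle) (f : IrredPoly F) : Submodule (Scalars F Γ) X :=
  suppPart F Γ X (Γ.endPred (Sum.inr C)) ⊓
    torsPart F Γ X (basePt (Sum.inr C)) (basePath (Sum.inr C)) (Submonoid.powers f.1)

theorem primPart_map (g : X →ₗ[Scalars F Γ] X') (C : Γ.FinMaxCycle) (f : IrredPoly F) :
    (primPart F Γ X C f).map g ≤ primPart F Γ X' C f := by
  rintro _ ⟨m, hm, rfl⟩
  exact ⟨suppPart_map g _ ⟨m, hm.1, rfl⟩, torsPart_map g _ _ _ ⟨m, hm.2, rfl⟩⟩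

/-- The normalization `f(0) = 1` leaves at most one polynomial in each class of associates. -/
theorem IrredPoly.isCoprime {f g : IrredPoly F} (h : f ≠ g) : IsCoprime f.1 g.1 := by
  rcases EuclideanDomain.dvd_or_coprime f.1 g.1 f.2.1 with hd | hc
  swap
  · exact hc
  · refine absurd (Subtype.ext ?_) h
    obtain ⟨u, hu⟩ := f.2.1.associated_of_dvd g.2.1 hd
    obtain ⟨c, hc, hcu⟩ := Polynomial.isUnit_iff.1 u.isUnit
    have h1 := congrArg (eval 0) hu
    rw [eval_mul, f.2.2, g.2.2, one_mul, ← hcu, eval_C] at h1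
    rw [← hu, ← hcu, h1, C_1, mul_one]

variable [FiniteDimensional F X]

/-- The kernel of `p` at the base point is invariant under the closed path, so it generates a
submodule with no further elements there. Torsion at the base point thus passes to all multiples, as
`torsPart` demands. -/
theorem smul_mem_of_aeval_smul (u : Γ.FinMaxSink ⊕ Γ.FinMaxCycle) (p : F[X]) {m : X}
    (hm : m ∈ vertexSpace F Γ X (basePt u))
    (h : aeval (pathAct F Γ (basePath u)) p • m = 0) (a : Scalars F Γ) :
    aeval (pathAct F Γ (basePath u)) p • vtx F Γ (basePt u) • a • m = 0 := by
  let Y : Submodule F X := vertexSpace F Γ X (basePt u) ⊓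
    LinearMap.ker (Algebra.lsmul F F X (aeval (pathAct F Γ (basePath u)) p))
  obtain ⟨N, h1, -⟩ := (isBase u).exists_submodule (Y := Y) inf_le_left (by
    rintro y ⟨hy, hy0⟩
    refine ⟨pathAct_smul_mem (isBase u).path hy, ?_⟩
    change aeval (pathAct F Γ (basePath u)) p • pathAct F Γ (basePath u) • y = 0
    have hy0' : aeval (pathAct F Γ (basePath u)) p • y = 0 := hy0
    have hc := congrArg (aeval (pathAct F Γ (basePath u))) (X_mul (p := p))
    rw [map_mul, map_mul, aeval_X] at hc
    rw [← mul_smul, ← hc, mul_smul, hy0', smul_zero])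
  have hN : m ∈ N := (h1 m hm).2 ⟨hm, h⟩
  exact ((h1 _ (vtx_smul_mem _ _)).1 (N.smul_mem _ (N.smul_mem a hN))).2

theorem eq_zero_of_pathAct_pow_smul {v : V} {l : List E} (h : Γ.IsPath v l v) (i : ℕ) {m : X}
    (hm : m ∈ vertexSpace F Γ X v) (h0 : pathAct F Γ l ^ i • m = 0) : m = 0 := by
  induction i generalizing m with
  | zero => simpa using h0
  | succ i ih =>
    rw [pow_succ, mul_smul] at h0
    exact eq_zero_of_pathAct_smul h hm (ih (pathAct_smul_mem h hm) h0)

/-- A prime with `q(0) = 0` is associated to `X` and contributes nothing, as the closed path acts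
injectively; any other prime is normalized by dividing by `q(0)`. -/
theorem mem_iSup_primPart_of_prime (K : Γ.FinMaxCycle) {q : F[X]} (hq : Prime q) (i : ℕ) {m : X}
    (hm : m ∈ vertexSpace F Γ X (basePt (Sum.inr K)))
    (h : aeval (pathAct F Γ (basePath (Sum.inr K))) (q ^ i) • m = 0) :
    m ∈ ⨆ f, primPart F Γ X K f := by
  have hb := isBase (Sum.inr K : Γ.FinMaxSink ⊕ Γ.FinMaxCycle)
  by_cases hq0 : q.eval 0 = 0
  · have hX : (Polynomial.X : F[X]) ∣ q := by
      rw [X_dvd_iff, coeff_zero_eq_eval_zero, hq0]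
    obtain ⟨c, hc⟩ := (irreducible_X.associated_of_dvd hq.irreducible hX).symm
    have h1 : pathAct F Γ (basePath (Sum.inr K)) ^ i • m = 0 := by
      rw [← aeval_X (R := F) (pathAct F Γ (basePath (Sum.inr K))), ← map_pow, ← hc, mul_pow,
        mul_comm, map_mul, mul_smul, h, smul_zero]
    rw [eq_zero_of_pathAct_pow_smul hb.path i hm h1]
    exact Submodule.zero_mem _
  · let f : IrredPoly F := ⟨Polynomial.C (q.eval 0)⁻¹ * q, by
      rw [irreducible_isUnit_mul (isUnit_C.2 (isUnit_iff_ne_zero.2 (inv_ne_zero hq0)))]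
      exact hq.irreducible, by rw [eval_mul, eval_C, inv_mul_cancel₀ hq0]⟩
    refine Submodule.mem_iSup_of_mem f ⟨mem_suppPart_of_mem_basePt _ hm, fun a =>
      ⟨f.1 ^ i, ⟨i, rfl⟩, smul_mem_of_aeval_smul _ _ hm ?_ a⟩⟩
    change aeval _ ((Polynomial.C _ * q) ^ i) • m = 0
    rw [mul_pow, map_mul, mul_smul, h, smul_zero]

/-- Induction over coprime factorizations: a Bézout relation for `a` and `b` splits `m` into a part
killed by `b` and a part killed by `a`. -/
theorem mem_iSup_primPart (K : Γ.FinMaxCycle) {p : F[X]} (hp : p ≠ 0) {m : X}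
    (hm : m ∈ vertexSpace F Γ X (basePt (Sum.inr K)))
    (h : aeval (pathAct F Γ (basePath (Sum.inr K))) p • m = 0) :
    m ∈ ⨆ f, primPart F Γ X K f := by
  have hb := isBase (Sum.inr K : Γ.FinMaxSink ⊕ Γ.FinMaxCycle)
  induction p using UniqueFactorizationMonoid.induction_on_coprime generalizing m with
  | h0 => exact absurd rfl hp
  | @h1 q hq =>
    obtain ⟨q, rfl⟩ := hq
    have h1 : m = 0 := by
      have h2 := congrArg (aeval (pathAct F Γ (basePath (Sum.inr K))) (↑q⁻¹ : F[X]) • ·) h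
      simpa only [← mul_smul, ← map_mul, Units.inv_mul, map_one, one_smul, smul_zero] using h2
    rw [h1]
    exact Submodule.zero_mem _
  | @hpr q i hq => exact mem_iSup_primPart_of_prime K hq i hm h
  | @hcp a b hrel ha hb' =>
    obtain ⟨r, s, hrs⟩ := hrel.isCoprime
    have h1 : m = aeval (pathAct F Γ (basePath (Sum.inr K))) (r * a) • m +
        aeval (pathAct F Γ (basePath (Sum.inr K))) (s * b) • m := by
      rw [← add_smul, ← map_add, hrs, map_one, one_smul]
    rw [h1]
    refine Submodule.add_mem _ (hb' (right_ne_zero_of_mul hp) (aeval_smul_mem hb.path _ hm) ?_)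
      (ha (left_ne_zero_of_mul hp) (aeval_smul_mem hb.path _ hm) ?_)
    · rw [← mul_smul, ← map_mul, show b * (r * a) = r * (a * b) by ring, map_mul, mul_smul, h,
        smul_zero]
    · rw [← mul_smul, ← map_mul, show a * (s * b) = s * (a * b) by ring, map_mul, mul_smul, h,
        smul_zero]

theorem iSup_primPart (hΓ : Γ.RowFinite) (hX : IsUnital F Γ X) (C : Γ.FinMaxCycle) :
    ⨆ f, primPart F Γ X C f = suppPart F Γ X (Γ.endPred (Sum.inr C)) := by
  refine le_antisymm (iSup_le fun f => inf_le_left) ?_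
  refine le_of_basePt hΓ hX (Sum.inr C) le_rfl fun m _ hm => ?_
  let c := pathAct F Γ (basePath (Sum.inr C : Γ.FinMaxSink ⊕ Γ.FinMaxCycle))
  let T : Module.End F X := Algebra.lsmul F F X c
  -- The minimal polynomial of the closed path on all of `X` is a nonzero polynomial killing `m`.
  refine mem_iSup_primPart C (minpoly.ne_zero (Algebra.IsIntegral.isIntegral (R := F) T)) hm ?_
  have h := minpoly.aeval F T
  rw [aeval_algHom_apply] at h
  exact LinearMap.congr_fun h m

/-- The polynomials that are prime to a given one. -/
def coprimeSubmonoid (f : F[X]) : Submonoid F[X] where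
  carrier := {g | IsCoprime f g}
  mul_mem' h1 h2 := h1.mul_right h2
  one_mem' := isCoprime_one_right

/-- The sum of the other parts is torsion for polynomials prime to `f`; an element that is also
killed by a power of `f` vanishes by Bézout. -/
theorem iSupIndep_primPart (hΓ : Γ.RowFinite) (hX : IsUnital F Γ X) (C : Γ.FinMaxCycle) :
    iSupIndep (primPart F Γ X C) := by
  intro f
  rw [disjoint_iff]
  have hle : ⨆ g, ⨆ (_ : g ≠ f), primPart F Γ X C g ≤
      torsPart F Γ X (basePt (Sum.inr C)) (basePath (Sum.inr C)) (coprimeSubmonoid f.1) := by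
    refine iSup₂_le fun g hg m hm a => ?_
    obtain ⟨h, ⟨k, rfl⟩, h0⟩ := hm.2 a
    exact ⟨_, (IrredPoly.isCoprime hg.symm).pow_right, h0⟩
  refine le_bot_iff.1 (le_of_basePt hΓ hX (Sum.inr C) (inf_le_left.trans inf_le_left)
    fun m hm hmC => ?_)
  obtain ⟨p, ⟨k, rfl⟩, hp⟩ := hm.1.2 1
  obtain ⟨q, hq, hq0⟩ := hle hm.2 1
  rw [one_smul, vtx_smul_of_mem hmC] at hp hq0
  obtain ⟨r, s, hrs⟩ := IsCoprime.pow_left (m := k) hq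
  have h1 : m = aeval (pathAct F Γ (basePath (Sum.inr C))) (r * f.1 ^ k) • m +
      aeval (pathAct F Γ (basePath (Sum.inr C))) (s * q) • m := by
    rw [← add_smul, ← map_add, hrs, map_one, one_smul]
  have hp' : aeval (pathAct F Γ (basePath (Sum.inr C))) (f.1 ^ k) • m = 0 := hp
  rw [map_mul, map_mul, mul_smul, mul_smul, hp', hq0, smul_zero, smul_zero, add_zero] at h1
  exact h1

end Primary

end DiGraph

namespace DiGraph

/-! ### Indecomposability, simplicity and lattices of submodules -/

section Lattice

variable {R : Type*} {M : Type*} [Ring R] [AddCommGroup M] [Module R M]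
  {R' : Type*} {M' : Type*} [Ring R'] [AddCommGroup M'] [Module R' M']

/-- Only the lattice of submodules matters, so modules over different rings can be compared. -/
theorem isIndecomposable_congr (e : Submodule R M ≃o Submodule R' M') :
    IsIndecomposable R M ↔ IsIndecomposable R' M' := by
  unfold IsIndecomposable
  rw [← Submodule.nontrivial_iff R (M := M), ← Submodule.nontrivial_iff R' (M := M'), e.toEquiv.nontrivial_congr]
  refine and_congr_right fun _ => ⟨fun h A B hAB => ?_, fun h A B hAB => ?_⟩
  · simpa using h (e.symm A) (e.symm B) ((OrderIso.isCompl_iff e.symm).1 hAB)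
  · simpa using h (e A) (e B) ((OrderIso.isCompl_iff e).1 hAB)

theorem isSimpleModule_congr (e : Submodule R M ≃o Submodule R' M') :
    IsSimpleModule R M ↔ IsSimpleModule R' M' := by
  rw [isSimpleModule_iff, isSimpleModule_iff]
  exact e.isSimpleOrder_iff

theorem _root_.IsSimpleModule.isIndecomposable [IsSimpleModule R M] : IsIndecomposable R M := by
  refine ⟨IsSimpleModule.nontrivial R M, fun A B hAB => ?_⟩
  rcases eq_bot_or_eq_top A with h | h
  · exact Or.inl h
  · refine Or.inr ?_
    rw [h] at hAB
    simpa using hAB.disjoint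

theorem isIndecomposable_iff_finrank_eq_one {K W : Type*} [Field K] [AddCommGroup W] [Module K W] :
    IsIndecomposable K W ↔ Module.finrank K W = 1 := by
  rw [← isSimpleModule_iff_finrank_eq_one]
  refine ⟨fun ⟨h1, h2⟩ => ?_, fun h => h.isIndecomposable⟩
  rw [isSimpleModule_iff]
  refine { eq_bot_or_eq_top := fun A => ?_ }
  obtain ⟨B, hB⟩ := exists_isCompl A
  refine (h2 A B hB).imp_right fun h => ?_
  rw [h] at hB
  simpa using hB.codisjoint

theorem disjoint_iSup_ne_sup {ι : Type*} {A : ι → Submodule R M} {B : Submodule R M}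
    (hA : iSupIndep A) (h : Disjoint (⨆ i, A i) B) (i : ι) :
    Disjoint (A i) ((⨆ j, ⨆ (_ : j ≠ i), A j) ⊔ B) :=
  (hA i).disjoint_sup_right_of_disjoint_sup_left
    (h.mono_left (sup_le (le_iSup A i) (iSup₂_le fun j _ => le_iSup A j)))

theorem iSupIndep_sumElim {ι κ : Type*} {A : ι → Submodule R M} {B : κ → Submodule R M}
    (hA : iSupIndep A) (hB : iSupIndep B) (h : Disjoint (⨆ i, A i) (⨆ j, B j)) :
    iSupIndep (Sum.elim A B) := by
  rintro (i | j)
  · refine (disjoint_iSup_ne_sup hA h i).mono_right (iSup₂_le ?_)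
    rintro (i' | j') hne
    · exact le_sup_of_le_left (le_iSup₂_of_le i' (by simpa using hne) le_rfl)
    · exact le_sup_of_le_right (le_iSup B j')
  · refine (disjoint_iSup_ne_sup hB h.symm j).mono_right (iSup₂_le ?_)
    rintro (i' | j') hne
    · exact le_sup_of_le_right (le_iSup A i')
    · exact le_sup_of_le_left (le_iSup₂_of_le j' (by simpa using hne) le_rfl)

/-- Artinian modules are finite direct sums of indecomposable submodules. -/
theorem exists_isDirectSumOf_indecomposable [IsArtinian R M] (N : Submodule R M) :
    ∃ (k : ℕ) (Q : Fin k → Submodule R M),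
      IsDirectSumOf N Q ∧ ∀ i, IsIndecomposable R (Q i) := by
  induction N using WellFoundedLT.induction with
  | ind N ih =>
  by_cases hN : N = ⊥
  · exact ⟨0, Fin.elim0, ⟨iSupIndep_subsingleton _, by rw [hN, iSup_of_empty]⟩, fun i => i.elim0⟩
  by_cases hind : IsIndecomposable R N
  · exact ⟨1, fun _ => N, ⟨iSupIndep_subsingleton _, by simp⟩, fun _ => hind⟩
  · have hnt : Nontrivial N := N.nontrivial_iff_ne_bot.2 hN
    simp only [IsIndecomposable, hnt, true_and, not_forall, not_or] at hind
    obtain ⟨A, B, hAB, hA, hB⟩ := hind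
    have hd : Disjoint (A.map N.subtype) (B.map N.subtype) :=
      Submodule.disjoint_map N.subtype_injective hAB.disjoint
    have hs : A.map N.subtype ⊔ B.map N.subtype = N := by
      rw [← Submodule.map_sup, hAB.sup_eq_top, Submodule.map_subtype_top]
    have hinj := Submodule.map_injective_of_injective N.subtype_injective
    have hA' : A.map N.subtype ≠ ⊥ := fun h => hA (hinj (h.trans (Submodule.map_bot _).symm))
    have hB' : B.map N.subtype ≠ ⊥ := fun h => hB (hinj (h.trans (Submodule.map_bot _).symm))
    -- Each of the two images is strictly smaller than `N` because the other one is nonzero.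
    obtain ⟨k, Q, ⟨hQ1, hQ2⟩, hQ⟩ := ih (A.map N.subtype)
      (lt_of_le_of_ne (Submodule.map_subtype_le _ _) fun h => hB' (by
        rw [h] at hd
        exact hd.symm.eq_bot_of_le (Submodule.map_subtype_le _ _)))
    obtain ⟨k', Q', ⟨hQ1', hQ2'⟩, hQ'⟩ := ih (B.map N.subtype)
      (lt_of_le_of_ne (Submodule.map_subtype_le _ _) fun h => hA' (by
        rw [h] at hd
        exact hd.eq_bot_of_le (Submodule.map_subtype_le _ _)))
    refine ⟨k + k', Sum.elim Q Q' ∘ finSumFinEquiv.symm, ⟨?_, ?_⟩, fun i => ?_⟩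
    · exact (iSupIndep_sumElim hQ1 hQ1' (by rwa [hQ2, hQ2'])).comp finSumFinEquiv.symm.injective
    · refine (finSumFinEquiv.symm.surjective.iSup_comp (Sum.elim Q Q')).trans ?_
      simp [iSup_sum, hQ2, hQ2', hs]
    · rw [Function.comp_apply]
      rcases finSumFinEquiv.symm i with j | j
      · exact hQ j
      · exact hQ' j

end Lattice

/-! ### Primary modules over the polynomial ring -/

section PID

/-- For a nonzero `A i`, its image and the kernel of the `i`-th component are complementary; the
image is nonzero, so the kernel is zero. -/
theorem exists_equiv_of_isIndecomposable {R : Type*} [CommRing R] {N : Type*} [AddCommGroup N]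
    [Module R N] {ι : Type*} [DecidableEq ι] {A : ι → Type*} [∀ i, AddCommGroup (A i)]
    [∀ i, Module R (A i)] (e : N ≃ₗ[R] DirectSum ι A) (hN : IsIndecomposable R N) :
    ∃ i, Nonempty (N ≃ₗ[R] A i) := by
  rw [isIndecomposable_congr (Submodule.orderIsoMapComap e)] at hN
  obtain ⟨hnt, hN⟩ := hN
  obtain ⟨x, hx⟩ := exists_ne (0 : DirectSum ι A)
  obtain ⟨i, hi⟩ : ∃ i, x i ≠ 0 := by
    by_contra! h
    exact hx (DFinsupp.ext h)
  have hc : (DirectSum.component R ι A i) ∘ₗ (DirectSum.lof R ι A i) = LinearMap.id :=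
    LinearMap.ext fun a => DirectSum.component.lof_self R i a
  have hcompl : IsCompl (LinearMap.range (DirectSum.lof R ι A i))
      (LinearMap.ker (DirectSum.component R ι A i)) := by
    constructor
    · rw [Submodule.disjoint_def]
      rintro _ ⟨a, rfl⟩ h
      have : a = 0 := (LinearMap.congr_fun hc a).symm.trans h
      rw [this, map_zero]
    · rw [codisjoint_iff, eq_top_iff]
      intro y _
      rw [← add_sub_cancel (DirectSum.lof R ι A i (DirectSum.component R ι A i y)) y]
      refine Submodule.add_mem_sup ⟨_, rfl⟩ ?_
      rw [LinearMap.mem_ker, map_sub, sub_eq_zero]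
      exact (LinearMap.congr_fun hc _).symm
  refine ⟨i, ⟨e.trans (LinearEquiv.ofBijective (DirectSum.component R ι A i)
    ⟨LinearMap.ker_eq_bot.1 ((hN _ _ hcompl).resolve_left fun h => hi ?_),
      fun a => ⟨DirectSum.lof R ι A i a, LinearMap.congr_fun hc a⟩⟩)⟩⟩
  have h1 : DirectSum.lof R ι A i (x i) = 0 := LinearMap.congr_fun (LinearMap.range_eq_bot.1 h) _
  have h2 := LinearMap.congr_fun hc (x i)
  rw [LinearMap.comp_apply, h1, map_zero] at h2
  exact h2.symm

variable {F : Type uF} [Field F] {f : F[X]}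

theorem finrank_quotient_pow (f : F[X]) (n : ℕ) :
    Module.finrank F (F[X] ⧸ Ideal.span {f ^ n}) = n * f.natDegree := by
  rw [finrank_quotient_span_eq_natDegree, natDegree_pow]

theorem eq_of_quotient_pow_equiv (hf : Irreducible f) {n m : ℕ}
    (e : (F[X] ⧸ Ideal.span {f ^ n}) ≃ₗ[F] (F[X] ⧸ Ideal.span {f ^ m})) : n = m := by
  have h := e.finrank_eq
  rw [finrank_quotient_pow f n, finrank_quotient_pow f m] at h
  exact Nat.eq_of_mul_eq_mul_right hf.natDegree_pos h

/-- Primary indecomposable modules are cyclic. -/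
theorem exists_equiv_quotient_pow (hf : Irreducible f) {N : Type*} [AddCommGroup N] [Module F[X] N]
    [Module.Finite F[X] N] (hN : Module.IsTorsion' N (Submonoid.powers f))
    (hind : IsIndecomposable F[X] N) :
    ∃ n, 1 ≤ n ∧ Nonempty ((F[X] ⧸ Ideal.span {f ^ n}) ≃ₗ[F[X]] N) := by
  obtain ⟨d, k, ⟨e⟩⟩ := Module.torsion_by_prime_power_decomposition hf hN
  obtain ⟨i, ⟨e'⟩⟩ := exists_equiv_of_isIndecomposable e hind
  refine ⟨k i, Nat.one_le_iff_ne_zero.2 fun h0 => ?_, ⟨e'.symm⟩⟩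
  have := hind.1
  have := e'.symm.toEquiv.nontrivial
  rw [Submodule.Quotient.nontrivial_iff, h0, pow_zero] at this
  exact this Ideal.span_singleton_one

/-- Every nonzero submodule contains the class of the last power of `f` that is not zero, so two
nonzero submodules are never disjoint. -/
theorem isIndecomposable_quotient_pow (hf : Irreducible f) {n : ℕ} (hn : 1 ≤ n) :
    IsIndecomposable F[X] (F[X] ⧸ Ideal.span {f ^ n}) := by
  obtain ⟨n, rfl⟩ := Nat.exists_eq_add_of_le' hn
  have hz : Ideal.Quotient.mk (Ideal.span {f ^ (n + 1)}) (f ^ n) ≠ 0 := by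
    rw [Ne, Ideal.Quotient.eq_zero_iff_mem, Ideal.mem_span_singleton,
      pow_dvd_pow_iff hf.ne_zero hf.not_isUnit]
    omega
  have key : ∀ A : Submodule F[X] (F[X] ⧸ Ideal.span {f ^ (n + 1)}), A ≠ ⊥ →
      Ideal.Quotient.mk (Ideal.span {f ^ (n + 1)}) (f ^ n) ∈ A := by
    intro A hA
    obtain ⟨x, hx, hx0⟩ := A.ne_bot_iff.1 hA
    obtain ⟨g, rfl⟩ := Ideal.Quotient.mk_surjective x
    have hg0 : ¬ f ^ (n + 1) ∣ g := by
      rwa [Ne, Ideal.Quotient.eq_zero_iff_mem, Ideal.mem_span_singleton] at hx0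
    -- The greatest common divisor `d` is a power of `f` up to a unit, with exponent at most `n`
    -- since `f ^ (n + 1)` does not divide `g`. Hence `f ^ n` is a combination of `g` and `f ^ (n +
    -- 1)`.
    obtain ⟨d, hd⟩ := (IsPrincipalIdealRing.principal (Ideal.span {g, f ^ (n + 1)})).1
    rw [Ideal.submodule_span_eq] at hd
    have hdg : d ∣ g := by
      rw [← Ideal.mem_span_singleton, ← hd]
      exact Ideal.subset_span (by simp)
    have hdf : d ∣ f ^ (n + 1) := by
      rw [← Ideal.mem_span_singleton, ← hd]
      exact Ideal.subset_span (by simp)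
    obtain ⟨j, hj, hassoc⟩ := (dvd_prime_pow hf.prime (n + 1)).1 hdf
    have hjn : j ≤ n := by
      by_contra hcon
      obtain rfl : j = n + 1 := by omega
      exact hg0 (hassoc.symm.dvd.trans hdg)
    have hdvd : d ∣ f ^ n := hassoc.dvd.trans (pow_dvd_pow f hjn)
    rw [← Ideal.mem_span_singleton, ← hd, Ideal.mem_span_pair] at hdvd
    obtain ⟨a, b, hab⟩ := hdvd
    have : Ideal.Quotient.mk (Ideal.span {f ^ (n + 1)}) (f ^ n) =
        a • Ideal.Quotient.mk (Ideal.span {f ^ (n + 1)}) g := by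
      rw [← hab, map_add, map_mul _ b, Ideal.Quotient.eq_zero_iff_mem.2
        (Ideal.mem_span_singleton_self (f ^ (n + 1))), mul_zero, add_zero]
      rfl
    rw [this]
    exact A.smul_mem a hx
  refine ⟨⟨_, _, hz⟩, fun A B hAB => ?_⟩
  by_contra! hcon
  exact hz ((Submodule.disjoint_def.1 hAB.disjoint) _ (key A hcon.1) (key B hcon.2))

theorem isSimpleModule_quotient_pow_iff (hf : Irreducible f) {n : ℕ} :
    IsSimpleModule F[X] (F[X] ⧸ Ideal.span {f ^ n}) ↔ n = 1 := by
  rw [isSimpleModule_iff_isCoatom]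
  refine Ideal.isMaximal_def.symm.trans ?_
  constructor
  · intro h
    have hne : f ^ n ≠ 0 := pow_ne_zero n hf.ne_zero
    have := (Ideal.span_singleton_prime hne).1 h.isPrime
    by_contra hn
    exact not_irreducible_pow hn this.irreducible
  · rintro rfl
    rw [pow_one]
    exact PrincipalIdealRing.isMaximal_of_irreducible hf

end PID

end DiGraph

namespace DiGraph

/-! ### Restriction to the base point -/

section Fib

variable {F : Type uF} [Field F] {V : Type uV} {E : Type uE} {Γ : DiGraph V E}
  {X : Type*} [AddCommGroup X] [Module F X] [Module (Scalars F Γ) X]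
  [IsScalarTower F (Scalars F Γ) X]

variable (F Γ X) in
/-- The space at a vertex as a module over the polynomial ring, the indeterminate acting by right
multiplication by a closed path. -/
abbrev Fib (v : V) (l : List E) : Type _ := Module.AEval' (loopEnd F Γ X v l)

/-- The element of the module given by an element of `Fib`. -/
noncomputable def fibVal (v : V) (l : List E) : Fib F Γ X v l →ₗ[F] X :=
  (vertexSpace F Γ X v).subtype ∘ₗ (Module.AEval'.of (loopEnd F Γ X v l)).symm.toLinearMap

theorem fibVal_mem {v : V} {l : List E} (x : Fib F Γ X v l) :
    fibVal v l x ∈ vertexSpace F Γ X v :=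
  Subtype.prop _

theorem fibVal_injective {v : V} {l : List E} :
    Function.Injective (fibVal (F := F) (Γ := Γ) (X := X) v l) :=
  Subtype.val_injective.comp (Module.AEval'.of _).symm.injective

theorem exists_fibVal_eq {v : V} (l : List E) {m : X} (hm : m ∈ vertexSpace F Γ X v) :
    ∃ x : Fib F Γ X v l, fibVal v l x = m :=
  ⟨Module.AEval'.of _ ⟨m, hm⟩, by simp [fibVal]⟩

theorem fibVal_X_smul {v : V} {l : List E} (hl : Γ.IsPath v l v) (x : Fib F Γ X v l) :
    fibVal v l ((Polynomial.X : F[X]) • x) = pathAct F Γ l • fibVal v l x := by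
  simp only [fibVal, LinearMap.comp_apply, LinearEquiv.coe_coe, Module.AEval'.of_symm_X_smul]
  exact coe_loopEnd hl _

theorem fibVal_smul {v : V} {l : List E} (hl : Γ.IsPath v l v) (p : F[X]) (x : Fib F Γ X v l) :
    fibVal v l (p • x) = aeval (pathAct F Γ l) p • fibVal v l x := by
  induction p using Polynomial.induction_on generalizing x with
  | C a => rw [aeval_C, algebraMap_smul, ← map_smul, C_eq_algebraMap, algebraMap_smul]
  | add p q hp hq => rw [add_smul, map_add, hp, hq, map_add, add_smul]
  | monomial n a h =>
    rw [pow_succ, ← mul_assoc, mul_smul, h, fibVal_X_smul hl, map_mul _ _ Polynomial.X, aeval_X,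
      mul_smul]

/-- The restriction of a submodule to a base point. -/
noncomputable def fibSub {v : V} {l : List E} (hl : Γ.IsPath v l v)
    (N : Submodule (Scalars F Γ) X) : Submodule F[X] (Fib F Γ X v l) where
  carrier := {x | fibVal v l x ∈ N}
  add_mem' h1 h2 := by
    rw [Set.mem_ofPred_eq, map_add]
    exact N.add_mem h1 h2
  zero_mem' := by
    rw [Set.mem_ofPred_eq, map_zero]
    exact N.zero_mem
  smul_mem' p x h := by
    rw [Set.mem_ofPred_eq, fibVal_smul hl]
    exact N.smul_mem _ h

theorem suppPart_eq_top_of_le {A : Set V} {N : Submodule (Scalars F Γ) X}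
    (h : N ≤ suppPart F Γ X A) : suppPart F Γ N A = ⊤ :=
  eq_top_iff.2 <| le_suppPart fun m _ _ hv => Subtype.ext (vtx_smul_of_mem_suppPart (h m.2) hv)

variable [FiniteDimensional F X]

instance (v : V) (l : List E) : Module.Finite F (Fib F Γ X v l) :=
  Module.Finite.equiv (Module.AEval'.of (loopEnd F Γ X v l))

/-- The submodules of a module that is supported on the predecessors of an end correspond to the
submodules of its restriction to the base point. -/
noncomputable def fibOrderIso (hΓ : Γ.RowFinite) (hX : IsUnital F Γ X)
    (u : Γ.FinMaxSink ⊕ Γ.FinMaxCycle) (hu : suppPart F Γ X (Γ.endPred u) = ⊤) :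
    Submodule (Scalars F Γ) X ≃o Submodule F[X] (Fib F Γ X (basePt u) (basePath u)) :=
  RelIso.ofSurjective (OrderEmbedding.ofMapLEIff (fibSub (isBase u).path) (by
    intro N N'
    constructor
    -- The order is reflected because a submodule supported on the predecessors is determined at the
    -- base point.
    · intro h
      refine le_of_basePt hΓ hX u (hu ▸ le_top) fun m hm hmu => ?_
      obtain ⟨x, rfl⟩ := exists_fibVal_eq (basePath u) hmu
      exact h hm
    · exact fun h x hx => h hx)) (by
    -- The submodule generated by `Y` has exactly `Y` at the base point.
    intro Y
    obtain ⟨N, h, -⟩ := (isBase u).exists_submodule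
      (Y := (Y.restrictScalars F).map (fibVal (basePt u) (basePath u))) (by
        rintro _ ⟨x, -, rfl⟩
        exact fibVal_mem x) (by
        rintro _ ⟨x, hx, rfl⟩
        exact ⟨(Polynomial.X : F[X]) • x, Y.smul_mem _ hx, fibVal_X_smul (isBase u).path x⟩)
    refine ⟨N, ?_⟩
    ext x
    refine (h _ (fibVal_mem x)).trans ⟨?_, fun hx => ⟨x, hx, rfl⟩⟩
    rintro ⟨y, hy, hyx⟩
    rwa [← fibVal_injective hyx])

variable {X' : Type*} [AddCommGroup X'] [Module F X'] [Module (Scalars F Γ) X']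
  [IsScalarTower F (Scalars F Γ) X'] [FiniteDimensional F X']

/-- Injectivity and surjectivity are inclusions between submodules, so `le_of_basePt` reduces them
to the base point. -/
theorem bijective_of_basePt (hΓ : Γ.RowFinite) (hX : IsUnital F Γ X) (hX' : IsUnital F Γ X')
    (u : Γ.FinMaxSink ⊕ Γ.FinMaxCycle) (hu : suppPart F Γ X (Γ.endPred u) = ⊤)
    (hu' : suppPart F Γ X' (Γ.endPred u) = ⊤) (g : X →ₗ[Scalars F Γ] X')
    (h1 : ∀ m ∈ vertexSpace F Γ X (basePt u), g m = 0 → m = 0)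
    (h2 : ∀ n ∈ vertexSpace F Γ X' (basePt u), ∃ m, g m = n) : Function.Bijective g := by
  constructor
  · rw [← LinearMap.ker_eq_bot, eq_bot_iff]
    refine le_of_basePt hΓ hX u (hu ▸ le_top) fun m hm hmu => ?_
    exact h1 m hmu hm
  · rw [← LinearMap.range_eq_top, eq_top_iff]
    exact le_of_basePt hΓ hX' u hu'.ge fun n _ hnu => h2 n hnu

/-- The graph of `φ` is an invariant subspace of `X × X'` at the base point. The submodule it
generates projects bijectively to both factors, since it does so at the base point. -/
theorem nonempty_equiv_of_fib (hΓ : Γ.RowFinite) (hX : IsUnital F Γ X) (hX' : IsUnital F Γ X')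
    (u : Γ.FinMaxSink ⊕ Γ.FinMaxCycle) (hu : suppPart F Γ X (Γ.endPred u) = ⊤)
    (hu' : suppPart F Γ X' (Γ.endPred u) = ⊤)
    (φ : Fib F Γ X (basePt u) (basePath u) ≃ₗ[F[X]] Fib F Γ X' (basePt u) (basePath u)) :
    Nonempty (X ≃ₗ[Scalars F Γ] X') := by
  have hl := (isBase u).path
  let ι := fibVal (F := F) (Γ := Γ) (X := X) (basePt u) (basePath u)
  let ι' := fibVal (F := F) (Γ := Γ) (X := X') (basePt u) (basePath u)
  let G : Fib F Γ X (basePt u) (basePath u) →ₗ[F] X × X' :=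
    ι.prod (ι' ∘ₗ φ.toLinearMap.restrictScalars F)
  have hG : ∀ x, G x = (ι x, ι' (φ x)) := fun _ => rfl
  obtain ⟨N, hN1, hN2⟩ := (isBase u).exists_submodule (Y := LinearMap.range G) (by
      rintro _ ⟨x, rfl⟩
      rw [mem_vertexSpace, hG, Prod.smul_mk, vtx_smul_of_mem (fibVal_mem x),
        vtx_smul_of_mem (fibVal_mem (φ x))]) (by
      rintro _ ⟨x, rfl⟩
      refine ⟨(Polynomial.X : F[X]) • x, ?_⟩
      rw [hG, hG, Prod.smul_mk, map_smul φ, fibVal_X_smul hl, fibVal_X_smul hl])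
  have hNu : suppPart F Γ N (Γ.endPred u) = ⊤ := by
    refine suppPart_eq_top_of_le (le_suppPart fun m hm v hv => hN2 m hm v ?_)
    rwa [endPred_eq] at hv
  have hNunit := (hX.prod hX').submodule N
  have hGN : ∀ x, G x ∈ N := by
    intro x
    refine (hN1 _ ?_).2 ⟨x, rfl⟩
    rw [mem_vertexSpace, hG, Prod.smul_mk, vtx_smul_of_mem (fibVal_mem x),
      vtx_smul_of_mem (fibVal_mem (φ x))]
  have hNG : ∀ m : N, m ∈ vertexSpace F Γ N (basePt u) → ∃ x, G x = m := by
    intro m hm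
    refine (hN1 m ?_).1 m.2
    rw [mem_vertexSpace] at hm ⊢
    exact congrArg Subtype.val hm
  have b1 : Function.Bijective ((LinearMap.fst (Scalars F Γ) X X') ∘ₗ N.subtype) := by
    refine bijective_of_basePt hΓ hNunit hX u hNu hu _ (fun m hm h0 => ?_) (fun n hn => ?_)
    · obtain ⟨x, hx⟩ := hNG m hm
      have h1 : ι x = 0 := (congrArg Prod.fst hx).trans h0
      have h2 : x = 0 := fibVal_injective (h1.trans (map_zero _).symm)
      exact Subtype.ext (hx.symm.trans (by rw [h2, map_zero]; rfl))
    · obtain ⟨x, rfl⟩ := exists_fibVal_eq (basePath u) hn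
      exact ⟨⟨G x, hGN x⟩, rfl⟩
  have b2 : Function.Bijective ((LinearMap.snd (Scalars F Γ) X X') ∘ₗ N.subtype) := by
    refine bijective_of_basePt hΓ hNunit hX' u hNu hu' _ (fun m hm h0 => ?_) (fun n hn => ?_)
    · obtain ⟨x, hx⟩ := hNG m hm
      have h1 : ι' (φ x) = 0 := (congrArg Prod.snd hx).trans h0
      have h2 : φ x = 0 := fibVal_injective (h1.trans (map_zero _).symm)
      have h3 : x = 0 := φ.injective (h2.trans (map_zero _).symm)
      exact Subtype.ext (hx.symm.trans (by rw [h3, map_zero]; rfl))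
    · obtain ⟨y, rfl⟩ := exists_fibVal_eq (basePath u) hn
      exact ⟨⟨G (φ.symm y), hGN _⟩, by simp [hG, ι']⟩
  exact ⟨(LinearEquiv.ofBijective _ b1).symm.trans (LinearEquiv.ofBijective _ b2)⟩

theorem finrank_vertexSpace_eq (e : X ≃ₗ[Scalars F Γ] X') (v : V) :
    Module.finrank F (vertexSpace F Γ X v) = Module.finrank F (vertexSpace F Γ X' v) := by
  have : (vertexSpace F Γ X v).map (e.restrictScalars F).toLinearMap = vertexSpace F Γ X' v := by
    ext m
    constructor
    · rintro ⟨n, hn, rfl⟩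
      rw [mem_vertexSpace]
      exact (map_smul e _ _).symm.trans (congrArg e (mem_vertexSpace.1 hn))
    · intro hm
      refine ⟨e.symm m, ?_, e.apply_symm_apply m⟩
      refine mem_vertexSpace.2 ?_
      exact (map_smul e.symm _ _).symm.trans (congrArg e.symm (mem_vertexSpace.1 hm))
  rw [← this]
  exact ((e.restrictScalars F).submoduleMap _).finrank_eq

theorem finrank_fib (v : V) (l : List E) :
    Module.finrank F (Fib F Γ X v l) = Module.finrank F (vertexSpace F Γ X v) :=
  (Module.AEval'.of (loopEnd F Γ X v l)).finrank_eq.symm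

/-! ### Sinks -/

theorem X_smul_fib_nil (v : V) (x : Fib F Γ X v []) : (Polynomial.X : F[X]) • x = x := by
  apply fibVal_injective
  rw [fibVal_X_smul (isPath_nil.2 rfl), pathAct_nil, one_smul]

/-- The loop at a sink is the trivial path, so `X` acts as the identity. Hence linearity over `F[X]`
is linearity over `F`, and only dimensions remain. -/
theorem smul_fib_nil (v : V) (p : F[X]) (x : Fib F Γ X v []) : p • x = p.eval 1 • x := by
  induction p using Polynomial.induction_on generalizing x with
  | C a => rw [C_eq_algebraMap, algebraMap_smul, ← C_eq_algebraMap, eval_C]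
  | add p q hp hq => rw [add_smul, hp, hq, eval_add, add_smul]
  | monomial n a h =>
    rw [pow_succ, ← mul_assoc, mul_smul, X_smul_fib_nil, h, eval_mul_X, mul_one]

/-- At a sink, submodules are subspaces. -/
noncomputable def fibNilOrderIso (v : V) :
    Submodule F[X] (Fib F Γ X v []) ≃o Submodule F (Fib F Γ X v []) :=
  RelIso.ofSurjective (Submodule.restrictScalarsEmbedding F F[X] (Fib F Γ X v [])) fun Y =>
    ⟨{ Y with
        smul_mem' := fun p x hx => by
          rw [smul_fib_nil]
          exact Y.smul_mem _ hx }, by ext; rfl⟩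

theorem isIndecomposable_iff_of_sink (hΓ : Γ.RowFinite) (hX : IsUnital F Γ X) (w : Γ.FinMaxSink)
    (hu : suppPart F Γ X (Γ.endPred (Sum.inl w)) = ⊤) :
    IsIndecomposable (Scalars F Γ) X ↔ Module.finrank F (vertexSpace F Γ X w.1) = 1 := by
  rw [isIndecomposable_congr ((fibOrderIso hΓ hX _ hu).trans (fibNilOrderIso w.1)),
    isIndecomposable_iff_finrank_eq_one, finrank_fib]

theorem isSimpleModule_iff_of_sink (hΓ : Γ.RowFinite) (hX : IsUnital F Γ X) (w : Γ.FinMaxSink)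
    (hu : suppPart F Γ X (Γ.endPred (Sum.inl w)) = ⊤) :
    Module.finrank F (vertexSpace F Γ X w.1) = 1 ↔ IsSimpleModule (Scalars F Γ) X := by
  rw [isSimpleModule_congr ((fibOrderIso hΓ hX _ hu).trans (fibNilOrderIso w.1)),
    isSimpleModule_iff_finrank_eq_one, finrank_fib]

theorem nonempty_equiv_iff_of_sink (hΓ : Γ.RowFinite) (hX : IsUnital F Γ X)
    (hX' : IsUnital F Γ X') (w : Γ.FinMaxSink)
    (hu : suppPart F Γ X (Γ.endPred (Sum.inl w)) = ⊤)
    (hu' : suppPart F Γ X' (Γ.endPred (Sum.inl w)) = ⊤) :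
    Nonempty (X ≃ₗ[Scalars F Γ] X') ↔
      Module.finrank F (vertexSpace F Γ X w.1) = Module.finrank F (vertexSpace F Γ X' w.1) := by
  refine ⟨fun ⟨e⟩ => finrank_vertexSpace_eq e w.1, fun h => ?_⟩
  rw [← finrank_fib w.1 [], ← finrank_fib w.1 []] at h
  let φ := LinearEquiv.ofFinrankEq _ _ h
  exact nonempty_equiv_of_fib hΓ hX hX' (Sum.inl w) hu hu'
    { φ with
      map_smul' := fun p x => by
        change φ (p • x) = p • φ x
        exact ((congrArg φ (smul_fib_nil w.1 p x)).trans (map_smul φ _ _)).trans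
          (smul_fib_nil w.1 p (φ x)).symm }

end Fib

end DiGraph

namespace DiGraph

/-! ### The type of a module at a cycle -/

section CycleType

variable {F : Type uF} [Field F] {V : Type uV} {E : Type uE} {Γ : DiGraph V E}
  {X : Type*} [AddCommGroup X] [Module F X] [Module (Scalars F Γ) X]
  [IsScalarTower F (Scalars F Γ) X] [FiniteDimensional F X]

theorem IsPath.rotate {e : E} {l : List E} (h : Γ.IsPath (Γ.s e) (e :: l) (Γ.s e)) :
    Γ.IsPath (Γ.t e) (l ++ [e]) (Γ.t e) :=
  isPath_append.2 ⟨Γ.s e, h.2, rfl, rfl⟩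

variable (F X) in
/-- Moving along the first arrow of a closed path. -/
noncomputable def arrowEquiv {e : E} {l : List E} (h : Γ.IsPath (Γ.s e) (e :: l) (Γ.s e)) :
    vertexSpace F Γ X (Γ.s e) ≃ₗ[F] vertexSpace F Γ X (Γ.t e) where
  toFun m := ⟨arr F Γ e • (m : X), arr_smul_mem e _⟩
  invFun m := ⟨dua F Γ e • (m : X), dua_smul_mem e _⟩
  map_add' _ _ := Subtype.ext (smul_add _ _ _)
  map_smul' c m := Subtype.ext (smul_comm _ c (m : X))
  left_inv m := Subtype.ext (dua_arr_smul_of_path h m.2)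
  right_inv m := Subtype.ext (arr_dua_smul m.2)

variable (F X) in
/-- Changing the base point of a closed path. -/
noncomputable def rotateEquiv {e : E} {l : List E} (h : Γ.IsPath (Γ.s e) (e :: l) (Γ.s e)) :
    Fib F Γ X (Γ.s e) (e :: l) ≃ₗ[F[X]] Fib F Γ X (Γ.t e) (l ++ [e]) :=
  LinearEquiv.ofAEval _ ((arrowEquiv F X h).trans (Module.AEval'.of (loopEnd F Γ X _ _))) (by
    intro m
    rw [LinearEquiv.trans_apply, LinearEquiv.trans_apply, Module.AEval'.X_smul_of]
    refine congrArg _ (Subtype.ext ?_)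
    rw [coe_loopEnd h.rotate]
    change arr F Γ e • ((loopEnd F Γ X (Γ.s e) (e :: l) m : _) : X) =
      pathAct F Γ (l ++ [e]) • arr F Γ e • (m : X)
    rw [coe_loopEnd h, pathAct_append, pathAct_cons, pathAct_cons, pathAct_nil, one_mul,
      ← mul_smul, ← mul_smul, mul_assoc])

variable (F X) in
theorem nonempty_fib_equiv_of_rotate {n : ℕ} {e e' : E} {l l' : List E}
    (h : Γ.IsPath (Γ.s e) (e :: l) (Γ.s e)) (hn : (e :: l).rotate n = e' :: l') :
    Nonempty (Fib F Γ X (Γ.s e) (e :: l) ≃ₗ[F[X]] Fib F Γ X (Γ.s e') (e' :: l')) := by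
  induction n generalizing e l with
  | zero =>
    rw [List.rotate_zero] at hn
    obtain ⟨rfl, rfl⟩ := List.cons.inj hn
    exact ⟨LinearEquiv.refl _ _⟩
  | succ n ih =>
    rw [List.rotate_cons_succ] at hn
    have hr := h.rotate
    have φ := rotateEquiv F X h
    -- The rotated path has to be displayed again as a first arrow, with source `Γ.t e`, followed by
    -- a rest, before the induction hypothesis applies.
    generalize hL : l ++ [e] = L at hn hr φ
    cases L with
    | nil => simp at hL
    | cons f L =>
      have hs := hr.1
      rw [← hs] at hr φ
      obtain ⟨ψ⟩ := ih hr hn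
      exact ⟨φ.trans ψ⟩

-- Moving along the cycle is invertible, so the `F[X]`-module does not depend on the starting point.
-- This is why primariness and type may be tested at the chosen base point.
variable (F X) in
theorem IsCycle.nonempty_fib_equiv {C : Cycle E} (hC : Γ.IsCycle C) {e e' : E} {l l' : List E}
    (h : ((e :: l : List E) : Cycle E) = C) (h' : ((e' :: l' : List E) : Cycle E) = C) :
    Nonempty (Fib F Γ X (Γ.s e) (e :: l) ≃ₗ[F[X]] Fib F Γ X (Γ.s e') (e' :: l')) := by
  obtain ⟨n, hn⟩ := Cycle.coe_eq_coe.1 (h.trans h'.symm)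
  subst h
  exact nonempty_fib_equiv_of_rotate F X (isCycle_coe.1 hC).1 hn

/-- An `F`-linear bijection is `F[X]`-linear as soon as it commutes with `X`. -/
theorem exists_equiv_vertexSpace_iff {v : V} {l : List E} (hl : Γ.IsPath v l v) (g : F[X]) :
    (∃ φ : (F[X] ⧸ Ideal.span {g}) ≃ₗ[F] vertexSpace F Γ X v,
      ∀ a, (φ (Ideal.Quotient.mk _ Polynomial.X * a) : X) = pathAct F Γ l • (φ a : X)) ↔
    Nonempty ((F[X] ⧸ Ideal.span {g}) ≃ₗ[F[X]] Fib F Γ X v l) := by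
  constructor
  · rintro ⟨φ, hφ⟩
    refine ⟨(LinearEquiv.ofAEval (loopEnd F Γ X v l) φ.symm fun m => ?_).symm⟩
    apply φ.injective
    refine Subtype.ext ?_
    have h1 := hφ (φ.symm m)
    rw [LinearEquiv.apply_symm_apply, ← coe_loopEnd hl] at h1
    exact (congrArg Subtype.val (φ.apply_symm_apply _)).trans h1.symm
  · rintro ⟨φ⟩
    refine ⟨(φ.restrictScalars F).trans (Module.AEval'.of (loopEnd F Γ X v l)).symm, fun a => ?_⟩
    have h1 : φ (Ideal.Quotient.mk _ Polynomial.X * a) = (Polynomial.X : F[X]) • φ a :=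
      map_smul φ Polynomial.X a
    have h2 := fibVal_X_smul hl (φ a)
    rw [← h1] at h2
    exact h2

theorem IsCycle.isCyclicOfType_iff {C : Cycle E} (hC : Γ.IsCycle C) {e : E} {l : List E}
    (h : ((e :: l : List E) : Cycle E) = C) (g : F[X]) :
    IsCyclicOfType F Γ X C g ↔
      Nonempty ((F[X] ⧸ Ideal.span {g}) ≃ₗ[F[X]] Fib F Γ X (Γ.s e) (e :: l)) := by
  constructor
  · intro hX
    refine (exists_equiv_vertexSpace_iff ?_ g).1 (hX e l h)
    subst h
    exact (isCycle_coe.1 hC).1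
  · rintro ⟨φ⟩ e' l' h'
    obtain ⟨ψ⟩ := hC.nonempty_fib_equiv F X h h'
    refine (exists_equiv_vertexSpace_iff ?_ g).2 ⟨φ.trans ψ⟩
    subst h'
    exact (isCycle_coe.1 hC).1

theorem exists_pow_smul_eq_zero {N : Type*} [AddCommGroup N] [Module F[X] N]
    [Module.Finite F[X] N] {f : F[X]} (h : ∀ x : N, ∃ k : ℕ, f ^ k • x = 0) :
    ∃ k : ℕ, ∀ x : N, f ^ k • x = 0 := by
  obtain ⟨s, hs⟩ := Module.Finite.fg_top (R := F[X]) (M := N)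
  choose k hk using h
  refine ⟨s.sup k, fun x => ?_⟩
  have hx : x ∈ Submodule.span F[X] (s : Set N) := hs ▸ Submodule.mem_top
  induction hx using Submodule.span_induction with
  | mem x hx =>
    rw [← Nat.sub_add_cancel (Finset.le_sup (f := k) hx), pow_add, mul_smul, hk, smul_zero]
  | zero => exact smul_zero _
  | add x y _ _ hx hy => rw [smul_add, hx, hy, add_zero]
  | smul a x _ hx => rw [smul_comm, hx, smul_zero]

theorem IsCycle.isPrimary {C : Cycle E} (hC : Γ.IsCycle C) {e : E} {l : List E}
    (h : ((e :: l : List E) : Cycle E) = C) {f : F[X]}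
    (hf : ∀ x : Fib F Γ X (Γ.s e) (e :: l), ∃ k : ℕ, f ^ k • x = 0) : IsPrimary F Γ X C f := by
  obtain ⟨k, hk⟩ := exists_pow_smul_eq_zero hf
  intro e' l' h'
  refine ⟨k, fun m hm => ?_⟩
  obtain ⟨ψ⟩ := hC.nonempty_fib_equiv F X h h'
  have hl : Γ.IsPath (Γ.s e') (e' :: l') (Γ.s e') := by
    subst h'
    exact (isCycle_coe.1 hC).1
  obtain ⟨x, rfl⟩ := exists_fibVal_eq (e' :: l') hm
  rw [aeval_algHom_apply]
  change aeval (pathAct F Γ (e' :: l')) (f ^ k) • fibVal (Γ.s e') (e' :: l') x = 0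
  rw [← fibVal_smul hl, ← ψ.apply_symm_apply x, ← map_smul, hk, map_zero, map_zero]

theorem exists_pow_smul_fib (K : Γ.FinMaxCycle) (f : IrredPoly F)
    {Q : Submodule (Scalars F Γ) X} (hQ : Q ≤ primPart F Γ X K f)
    (x : Fib F Γ Q (basePt (Sum.inr K)) (basePath (Sum.inr K))) : ∃ k : ℕ, f.1 ^ k • x = 0 := by
  have hl := (isBase (Sum.inr K : Γ.FinMaxSink ⊕ Γ.FinMaxCycle)).path
  obtain ⟨_, ⟨k, rfl⟩, hk⟩ := (hQ (fibVal _ _ x).2).2 1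
  refine ⟨k, fibVal_injective ?_⟩
  rw [fibVal_smul hl, map_zero]
  refine Subtype.ext ?_
  rw [one_smul] at hk
  have h1 : vtx F Γ (basePt (Sum.inr K)) • ((fibVal (basePt (Sum.inr K)) (basePath (Sum.inr K)) x :
      Q) : X) = (fibVal (basePt (Sum.inr K)) (basePath (Sum.inr K)) x : Q) :=
    congrArg Subtype.val (vtx_smul_of_mem (fibVal_mem x))
  rw [h1] at hk
  exact hk

theorem isPrimary_primPart (K : Γ.FinMaxCycle) (f : IrredPoly F) :
    IsPrimary F Γ (primPart F Γ X K f) K.1 f.1 :=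
  K.2.1.1.isPrimary K.rep_spec (exists_pow_smul_fib K f le_rfl)

theorem isCyclicOfType_iff_fib (K : Γ.FinMaxCycle) (g : F[X]) :
    IsCyclicOfType F Γ X K.1 g ↔ Nonempty ((F[X] ⧸ Ideal.span {g}) ≃ₗ[F[X]]
      Fib F Γ X (basePt (Sum.inr K)) (basePath (Sum.inr K))) :=
  K.2.1.1.isCyclicOfType_iff K.rep_spec g

variable {Q : Submodule (Scalars F Γ) X} {K : Γ.FinMaxCycle} {f : IrredPoly F}

theorem IsSummandOf.le {N : Submodule (Scalars F Γ) X} (h : IsSummandOf Q N) : Q ≤ N := by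
  obtain ⟨Q', -, h⟩ := h
  exact h ▸ le_sup_left

theorem suppPart_eq_top_of_le_primPart (hQ : Q ≤ primPart F Γ X K f) :
    suppPart F Γ Q (Γ.endPred (Sum.inr K)) = ⊤ :=
  suppPart_eq_top_of_le (hQ.trans inf_le_left)

/-- At the base point `Q` becomes an indecomposable `f`-primary module, which is cyclic by the
structure theorem; its dimension determines the exponent. -/
theorem existsUnique_isCyclicOfType (hΓ : Γ.RowFinite) (hX : IsUnital F Γ X)
    (hQ : Q ≤ primPart F Γ X K f) (hind : IsIndecomposable (Scalars F Γ) Q) :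
    ∃! n : ℕ, 1 ≤ n ∧ IsCyclicOfType F Γ Q K.1 (f.1 ^ n) := by
  rw [isIndecomposable_congr (R' := F[X])
    (M' := Fib F Γ Q (basePt (Sum.inr K)) (basePath (Sum.inr K)))
    (fibOrderIso hΓ (hX.submodule Q) _ (suppPart_eq_top_of_le_primPart hQ))] at hind
  obtain ⟨n, hn, φ⟩ := exists_equiv_quotient_pow f.2.1 (fun x => by
    obtain ⟨k, hk⟩ := exists_pow_smul_fib K f hQ x
    exact ⟨⟨_, k, rfl⟩, hk⟩) hind
  refine ⟨n, ⟨hn, (isCyclicOfType_iff_fib K _).2 φ⟩, fun m ⟨_, hm⟩ => ?_⟩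
  obtain ⟨φ⟩ := φ
  obtain ⟨ψ⟩ := (isCyclicOfType_iff_fib K _).1 hm
  exact eq_of_quotient_pow_equiv f.2.1 ((ψ.trans φ.symm).restrictScalars F)

theorem eq_one_iff_isSimpleModule (hΓ : Γ.RowFinite) (hX : IsUnital F Γ X)
    (hu : suppPart F Γ X (Γ.endPred (Sum.inr K)) = ⊤) {n : ℕ}
    (hn : IsCyclicOfType F Γ X K.1 (f.1 ^ n)) : n = 1 ↔ IsSimpleModule (Scalars F Γ) X := by
  obtain ⟨φ⟩ := (isCyclicOfType_iff_fib K _).1 hn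
  rw [isSimpleModule_congr (fibOrderIso hΓ hX _ hu), ← φ.isSimpleModule_iff,
    isSimpleModule_quotient_pow_iff f.2.1]

theorem isIndecomposable_of_isCyclicOfType (hΓ : Γ.RowFinite) (hX : IsUnital F Γ X)
    (hu : suppPart F Γ X (Γ.endPred (Sum.inr K)) = ⊤) {n : ℕ} (hn : 1 ≤ n)
    (h : IsCyclicOfType F Γ X K.1 (f.1 ^ n)) : IsIndecomposable (Scalars F Γ) X := by
  obtain ⟨φ⟩ := (isCyclicOfType_iff_fib K _).1 h
  rw [isIndecomposable_congr (fibOrderIso hΓ hX _ hu),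
    ← isIndecomposable_congr (Submodule.orderIsoMapComap φ)]
  exact isIndecomposable_quotient_pow f.2.1 hn

theorem primPart_eq_top_of_isCyclicOfType
    (hu : suppPart F Γ X (Γ.endPred (Sum.inr K)) = ⊤) {n : ℕ}
    (h : IsCyclicOfType F Γ X K.1 (f.1 ^ n)) : primPart F Γ X K f = ⊤ := by
  rw [primPart, hu, top_inf_eq, eq_top_iff]
  intro m _ a
  refine ⟨f.1 ^ n, ⟨n, rfl⟩, ?_⟩
  obtain ⟨φ⟩ := (isCyclicOfType_iff_fib K _).1 h
  obtain ⟨x, hx⟩ := exists_fibVal_eq (basePath (Sum.inr K : Γ.FinMaxSink ⊕ Γ.FinMaxCycle))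
    (vtx_smul_mem (F := F) (Γ := Γ) (basePt (Sum.inr K : Γ.FinMaxSink ⊕ Γ.FinMaxCycle)) (a • m))
  rw [← hx, ← fibVal_smul (isBase (Sum.inr K)).path, ← φ.apply_symm_apply x, ← map_smul]
  obtain ⟨p, hp⟩ := Ideal.Quotient.mk_surjective (φ.symm x)
  have h0 : f.1 ^ n • φ.symm x = 0 := by
    rw [← hp]
    exact Ideal.Quotient.eq_zero_iff_mem.2
      (Ideal.mul_mem_right p _ (Ideal.mem_span_singleton_self (f.1 ^ n)))
  rw [h0, map_zero, map_zero]

variable {X' : Type*} [AddCommGroup X'] [Module F X'] [Module (Scalars F Γ) X']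
  [IsScalarTower F (Scalars F Γ) X'] [FiniteDimensional F X']

theorem nonempty_equiv_iff_of_isCyclicOfType (hΓ : Γ.RowFinite) (hX : IsUnital F Γ X)
    (hX' : IsUnital F Γ X') (hu : suppPart F Γ X (Γ.endPred (Sum.inr K)) = ⊤)
    (hu' : suppPart F Γ X' (Γ.endPred (Sum.inr K)) = ⊤) {n n' : ℕ}
    (hn : IsCyclicOfType F Γ X K.1 (f.1 ^ n)) (hn' : IsCyclicOfType F Γ X' K.1 (f.1 ^ n')) :
    Nonempty (X ≃ₗ[Scalars F Γ] X') ↔ n = n' := by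
  obtain ⟨φ⟩ := (isCyclicOfType_iff_fib K _).1 hn
  obtain ⟨ψ⟩ := (isCyclicOfType_iff_fib K _).1 hn'
  constructor
  · rintro ⟨e⟩
    have h := finrank_vertexSpace_eq e (basePt (Sum.inr K))
    rw [← finrank_fib _ (basePath (Sum.inr K)), ← finrank_fib _ (basePath (Sum.inr K)),
      ← (φ.restrictScalars F).finrank_eq, ← (ψ.restrictScalars F).finrank_eq,
      finrank_quotient_pow, finrank_quotient_pow] at h
    exact Nat.eq_of_mul_eq_mul_right f.2.1.natDegree_pos h
  · rintro rfl
    exact nonempty_equiv_of_fib hΓ hX hX' _ hu hu' (φ.symm.trans ψ)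

end CycleType

end DiGraph

namespace DiGraph

/-! ### Representations given by operators -/

section Representation

variable {F : Type uF} [Field F] {V : Type uV} {E : Type uE} {Γ : DiGraph V E}
  {M : Type*} [AddCommGroup M] [Module F M]

/-- The representation given by operators that satisfy the defining relations. -/
noncomputable def repHom (ρ : Gen V E → Module.End F M)
    (h : ∀ ⦃a b⦄, LeavittRel F Γ a b → FreeAlgebra.lift F (fun x => MulOpposite.op (ρ x)) a =
      FreeAlgebra.lift F (fun x => MulOpposite.op (ρ x)) b) :
    Scalars F Γ →ₐ[F] Module.End F M :=
  -- The operators stand for right multiplications, so products go to composites in the opposite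
  -- order.
  let φ : LeavittPathAlgebra F Γ →ₙₐ[F] (Module.End F M)ᵐᵒᵖ :=
    ((RingQuot.liftAlgHom F ⟨FreeAlgebra.lift F (fun x => MulOpposite.op (ρ x)), h⟩ :
      RingQuot (LeavittRel F Γ) →ₐ[F] (Module.End F M)ᵐᵒᵖ) :
      RingQuot (LeavittRel F Γ) →ₙₐ[F] (Module.End F M)ᵐᵒᵖ).comp
    (NonUnitalSubalgebraClass.subtype (NonUnitalAlgebra.adjoin F (Set.range (genQuot F Γ))))
  AlgHom.opComm (Unitization.lift φ)

theorem repHom_act_lgen (ρ : Gen V E → Module.End F M)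
    (h : ∀ ⦃a b⦄, LeavittRel F Γ a b → FreeAlgebra.lift F (fun x => MulOpposite.op (ρ x)) a =
      FreeAlgebra.lift F (fun x => MulOpposite.op (ρ x)) b) (x : Gen V E) :
    repHom ρ h (act F Γ (lgen F Γ x)) = ρ x := by
  have h1 : RingQuot.liftAlgHom F ⟨FreeAlgebra.lift F (fun x => MulOpposite.op (ρ x)), h⟩
      (genQuot F Γ x) = MulOpposite.op (ρ x) := by
    rw [genQuot, RingQuot.liftAlgHom_mkAlgHom_apply]
    exact FreeAlgebra.lift_ι_apply _ _
  apply MulOpposite.op_injective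
  rw [← h1]
  exact DFunLike.congr_fun (Unitization.lift.symm_apply_apply _) (lgen F Γ x)

end Representation

/-- A set with a partial left action of the arrows, on which every vertex that emits arrows is
partitioned by them. -/
structure BranchingSystem {V : Type uV} {E : Type uE} (Γ : DiGraph V E) (I : Type*) where
  src : I → V
  hd : I → Option E
  tl : I → I
  cons : E → I → I
  src_cons : ∀ {e y}, src y = Γ.t e → src (cons e y) = Γ.s e
  hd_cons : ∀ {e y}, src y = Γ.t e → hd (cons e y) = some e
  tl_cons : ∀ {e y}, src y = Γ.t e → tl (cons e y) = y
  src_of_hd : ∀ {e x}, hd x = some e → src x = Γ.s e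
  src_tl : ∀ {e x}, hd x = some e → src (tl x) = Γ.t e
  cons_tl : ∀ {e x}, hd x = some e → cons e (tl x) = x
  sink : ∀ {x}, hd x = none → Γ.IsSink (src x)

/-! ### Modules of functions on a branching system -/

namespace BranchingSystem

open scoped Classical in
/-- The operators of a branching system, twisted by automorphisms of the coefficients. -/
noncomputable def op {F : Type uF} [Field F] {V : Type uV} {E : Type uE} {Γ : DiGraph V E}
    {I : Type*} {W : Type*} [AddCommGroup W] [Module F W]
    (B : Γ.BranchingSystem I) (θ : V → (W ≃ₗ[F] W)) : Gen V E → Module.End F (I → W)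
  | .vertex v =>
    { toFun := fun m x => if B.src x = v then m x else 0
      map_add' := fun m n => by ext x; by_cases h : B.src x = v <;> simp [h]
      map_smul' := fun c m => by ext x; by_cases h : B.src x = v <;> simp [h] }
  | .arrow e =>
    { toFun := fun m y => if B.src y = Γ.t e then θ (Γ.s e) (m (B.cons e y)) else 0
      map_add' := fun m n => by ext x; by_cases h : B.src x = Γ.t e <;> simp [h]
      map_smul' := fun c m => by ext x; by_cases h : B.src x = Γ.t e <;> simp [h] }
  | .dual e =>
    { toFun := fun m x => if B.hd x = some e then (θ (Γ.s e)).symm (m (B.tl x)) else 0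
      map_add' := fun m n => by ext x; by_cases h : B.hd x = some e <;> simp [h]
      map_smul' := fun c m => by ext x; by_cases h : B.hd x = some e <;> simp [h] }

variable {F : Type uF} [Field F] {V : Type uV} {E : Type uE} {Γ : DiGraph V E}
  {I : Type*} {W : Type*} [AddCommGroup W] [Module F W]
  (B : Γ.BranchingSystem I) (θ : V → (W ≃ₗ[F] W))

open scoped Classical in
theorem op_vertex_apply (v : V) (m : I → W) (x : I) :
    B.op θ (.vertex v) m x = if B.src x = v then m x else 0 := rfl

open scoped Classical in
theorem op_arrow_apply (e : E) (m : I → W) (y : I) :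
    B.op θ (.arrow e) m y = if B.src y = Γ.t e then θ (Γ.s e) (m (B.cons e y)) else 0 := rfl

open scoped Classical in
theorem op_dual_apply (e : E) (m : I → W) (x : I) :
    B.op θ (.dual e) m x = if B.hd x = some e then (θ (Γ.s e)).symm (m (B.tl x)) else 0 := rfl

/-- (CK1) holds because prolonging by `e` and removing the first arrow gives back the element; (CK2)
because an element whose source emits arrows has exactly one first arrow. The twists cancel, an
arrow and its dual carrying inverse automorphisms. -/
theorem op_rel ⦃a b : FreeAlgebra F (Gen V E)⦄ (h : LeavittRel F Γ a b) :
    FreeAlgebra.lift F (fun x => MulOpposite.op (B.op θ x)) a =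
      FreeAlgebra.lift F (fun x => MulOpposite.op (B.op θ x)) b := by
  cases h with
  | vertex_mul_self v =>
    simp only [gen, map_mul, FreeAlgebra.lift_ι_apply, ← MulOpposite.op_mul]
    congr 1
    ext m x
    simp only [Module.End.mul_apply, op_vertex_apply]
    split_ifs <;> rfl
  | vertex_mul_of_ne v w h =>
    simp only [gen, map_mul, FreeAlgebra.lift_ι_apply, ← MulOpposite.op_mul, map_zero]
    rw [MulOpposite.op_eq_zero_iff]
    ext m x
    simp only [Module.End.mul_apply, op_vertex_apply]
    split_ifs with h1 h2
    · exact absurd (h2.symm.trans h1) h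
    all_goals rfl
  | source_mul e =>
    simp only [gen, map_mul, FreeAlgebra.lift_ι_apply, ← MulOpposite.op_mul]
    congr 1
    ext m x
    simp only [Module.End.mul_apply, op_vertex_apply, op_arrow_apply]
    split_ifs with h1 h2
    · rfl
    · exact absurd (B.src_cons h1) h2
    · rfl
  | mul_target e =>
    simp only [gen, map_mul, FreeAlgebra.lift_ι_apply, ← MulOpposite.op_mul]
    congr 1
    ext m x
    simp only [Module.End.mul_apply, op_vertex_apply, op_arrow_apply]
    split_ifs <;> rfl
  | target_mul_dual e =>
    simp only [gen, map_mul, FreeAlgebra.lift_ι_apply, ← MulOpposite.op_mul]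
    congr 1
    ext m x
    simp only [Module.End.mul_apply, op_vertex_apply, op_dual_apply]
    split_ifs with h1 h2
    · rfl
    · exact absurd (B.src_tl h1) h2
    · rfl
  | dual_mul_source e =>
    simp only [gen, map_mul, FreeAlgebra.lift_ι_apply, ← MulOpposite.op_mul]
    congr 1
    ext m x
    simp only [Module.End.mul_apply, op_vertex_apply, op_dual_apply]
    split_ifs with h1 h2 h2
    · rfl
    · rfl
    · exact absurd (B.src_of_hd h2) h1
    · rfl
  | dual_mul_self e =>
    simp only [gen, map_mul, FreeAlgebra.lift_ι_apply, ← MulOpposite.op_mul]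
    congr 1
    ext m x
    simp only [Module.End.mul_apply, op_vertex_apply, op_dual_apply, op_arrow_apply]
    split_ifs with h1 h2
    · rw [B.tl_cons h1, LinearEquiv.apply_symm_apply]
    · exact absurd (B.hd_cons h1) h2
    · rfl
  | dual_mul_of_ne e f h =>
    simp only [gen, map_mul, FreeAlgebra.lift_ι_apply, ← MulOpposite.op_mul, map_zero]
    rw [MulOpposite.op_eq_zero_iff]
    ext m x
    simp only [Module.End.mul_apply, op_arrow_apply, op_dual_apply]
    split_ifs with h1 h2
    · rw [B.hd_cons h1] at h2
      exact absurd (Option.some.inj h2).symm h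
    · exact map_zero _
    · rfl
  | vertex_eq_sum v hfin hne =>
    classical
    simp only [gen, map_mul, map_sum, FreeAlgebra.lift_ι_apply, ← MulOpposite.op_mul]
    rw [← Finset.op_sum]
    congr 1
    ext m x
    rw [LinearMap.sum_apply, Finset.sum_apply]
    simp only [Module.End.mul_apply, op_vertex_apply, op_arrow_apply, op_dual_apply]
    cases hx : B.hd x with
    | none =>
      rw [if_neg]
      · simp
      · rintro rfl
        obtain ⟨e, he⟩ := hne
        exact B.sink hx e he
    | some e =>
      have hterm : ∀ f, f ≠ e → (if some e = some f then (θ (Γ.s f)).symm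
          (if B.src (B.tl x) = Γ.t f then θ (Γ.s f) (m (B.cons f (B.tl x))) else 0) else 0) = 0 :=
        fun f hf => if_neg fun h => hf (Option.some.inj h).symm
      by_cases hv : B.src x = v
      · rw [if_pos hv, Finset.sum_eq_single e (fun f _ hf => hterm f hf), if_pos rfl,
          if_pos (B.src_tl hx), LinearEquiv.symm_apply_apply, B.cons_tl hx]
        intro h
        exact absurd (by simpa using (B.src_of_hd hx).symm.trans hv) h
      · rw [if_neg hv, Finset.sum_eq_zero]
        intro f hf
        refine hterm f ?_
        rintro rfl
        exact hv ((B.src_of_hd hx).trans (by simpa using hf))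

/-- The module of a branching system. -/
@[nolint unusedArguments]
def Mod (_ : Γ.BranchingSystem I) (_ : V → (W ≃ₗ[F] W)) : Type _ := I → W

instance : AddCommGroup (B.Mod θ) := inferInstanceAs (AddCommGroup (I → W))

instance : Module F (B.Mod θ) := inferInstanceAs (Module F (I → W))

noncomputable instance : Module (Scalars F Γ) (B.Mod θ) :=
  Module.compHom (I → W) (repHom (B.op θ) (B.op_rel θ)).toRingHom

instance : IsScalarTower F (Scalars F Γ) (B.Mod θ) where
  smul_assoc c s m := by
    change repHom (B.op θ) (B.op_rel θ) (c • s) m = c • repHom (B.op θ) (B.op_rel θ) s m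
    rw [map_smul]
    rfl

instance [Finite I] [FiniteDimensional F W] : FiniteDimensional F (B.Mod θ) :=
  inferInstanceAs (FiniteDimensional F (I → W))

/-- The coefficient of an element of the module. -/
def coeff {B : Γ.BranchingSystem I} {θ : V → (W ≃ₗ[F] W)} (x : I) : B.Mod θ →ₗ[F] W :=
  LinearMap.proj (φ := fun _ => W) x

variable {B θ}

theorem mod_ext {m n : B.Mod θ} (h : ∀ x, coeff x m = coeff x n) : m = n := funext h

open scoped Classical in
theorem coeff_vtx_smul (v : V) (m : B.Mod θ) (x : I) :
    coeff x (vtx F Γ v • m) = if B.src x = v then coeff x m else 0 :=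
  congrFun (LinearMap.congr_fun (repHom_act_lgen (B.op θ) (B.op_rel θ) (.vertex v)) m) x

open scoped Classical in
theorem coeff_arr_smul (e : E) (m : B.Mod θ) (y : I) :
    coeff y (arr F Γ e • m) =
      if B.src y = Γ.t e then θ (Γ.s e) (coeff (B.cons e y) m) else 0 :=
  congrFun (LinearMap.congr_fun (repHom_act_lgen (B.op θ) (B.op_rel θ) (.arrow e)) m) y

theorem isUnital [Finite I] : IsUnital F Γ (B.Mod θ) := by
  classical
  have := Fintype.ofFinite I
  refine isUnital_of_exists_sum fun m => ⟨Finset.univ.image B.src, mod_ext fun x => ?_⟩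
  rw [map_sum]
  simp only [coeff_vtx_smul]
  rw [Finset.sum_ite_eq, if_pos (Finset.mem_image_of_mem _ (Finset.mem_univ x))]

theorem mem_vertexSpace_iff {v : V} {m : B.Mod θ} :
    m ∈ vertexSpace F Γ (B.Mod θ) v ↔ ∀ x, B.src x ≠ v → coeff x m = 0 := by
  classical
  rw [mem_vertexSpace]
  constructor
  · intro h x hx
    rw [← h, coeff_vtx_smul, if_neg hx]
  · intro h
    refine mod_ext fun x => ?_
    rw [coeff_vtx_smul]
    split_ifs with hx
    · rfl
    · exact (h x hx).symm

/-- The space at a vertex that is the source of a single element. -/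
noncomputable def vertexSpaceEquiv (B : Γ.BranchingSystem I) (θ : V → (W ≃ₗ[F] W)) {v : V} {x₀ : I}
    (h₀ : ∀ x, B.src x = v ↔ x = x₀) : vertexSpace F Γ (B.Mod θ) v ≃ₗ[F] W := by
  classical
  exact LinearEquiv.ofBijective ((coeff x₀) ∘ₗ (vertexSpace F Γ (B.Mod θ) v).subtype) (by
    constructor
    · rw [← LinearMap.ker_eq_bot, LinearMap.ker_eq_bot']
      intro m hm
      refine Subtype.ext (mod_ext fun x => ?_)
      rw [ZeroMemClass.coe_zero, map_zero]
      by_cases hx : x = x₀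
      · rw [hx]
        exact hm
      · exact mem_vertexSpace_iff.1 m.2 x fun h => hx ((h₀ x).1 h)
    · intro a
      refine ⟨⟨(Pi.single x₀ a : I → W), mem_vertexSpace_iff.2 fun x hx => ?_⟩, ?_⟩
      · exact Pi.single_eq_of_ne (M := fun _ => W) (fun h => hx ((h₀ x).2 h)) a
      · exact Pi.single_eq_same (M := fun _ => W) x₀ a)

theorem vertexSpaceEquiv_apply {v : V} {x₀ : I} (h₀ : ∀ x, B.src x = v ↔ x = x₀)
    (m : vertexSpace F Γ (B.Mod θ) v) : vertexSpaceEquiv B θ h₀ m = coeff x₀ (m : B.Mod θ) := rfl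

/-- The element `x` is `y` prolonged by `l`; no twist occurs along `l`. -/
theorem exists_coeff_pathAct_smul {v w : V} {l : List E} (h : Γ.IsPath v l w)
    (hθ : ∀ e ∈ l, θ (Γ.s e) = LinearEquiv.refl F W) {y : I} (hy : B.src y = w) :
    ∃ x, B.src x = v ∧ ∀ m : B.Mod θ, coeff y (pathAct F Γ l • m) = coeff x m := by
  induction l generalizing v with
  | nil =>
    cases h
    exact ⟨y, hy, fun m => by simp⟩
  | cons e l ih =>
    obtain ⟨rfl, h⟩ := h
    obtain ⟨x, hx, hm⟩ := ih h fun f hf => hθ f (by simp [hf])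
    refine ⟨B.cons e x, B.src_cons hx, fun m => ?_⟩
    rw [pathAct_cons, mul_smul, hm, coeff_arr_smul, if_pos hx, hθ e (by simp)]
    rfl

/-- Only the first arrow can carry a twist, and `x₀` prolonged once around is again `x₀`, as nothing
else lies over `v`. -/
theorem coeff_loop_smul {v : V} {e : E} {l : List E} (h : Γ.IsPath v (e :: l) v)
    (hθ : ∀ f ∈ l, θ (Γ.s f) = LinearEquiv.refl F W) {x₀ : I}
    (h₀ : ∀ x, B.src x = v ↔ x = x₀) (m : B.Mod θ) :
    coeff x₀ (pathAct F Γ (e :: l) • m) = θ v (coeff x₀ m) := by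
  obtain ⟨rfl, h⟩ := h
  obtain ⟨x, hx, hm⟩ := exists_coeff_pathAct_smul (B := B) (θ := θ) h hθ ((h₀ x₀).2 rfl)
  rw [pathAct_cons, mul_smul, hm, coeff_arr_smul, if_pos hx, (h₀ _).1 (B.src_cons hx)]

end BranchingSystem

end DiGraph

namespace DiGraph

/-! ### The paths to a base point -/

section PathSystem

variable {V : Type uV} {E : Type uE} {Γ : DiGraph V E} {v₀ : V} {l : List E}

/-- Such an arrow lies on a closed path through the base point, so maximality puts it on `l`. -/
theorem IsBase.mem_of_path (hb : Γ.IsBase v₀ l) {v : V} {q : List E} (h : Γ.IsPath v q v₀)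
    (hv : Γ.Reaches v₀ v) {e : E} (he : e ∈ q) : e ∈ l := by
  obtain ⟨h1, h2⟩ := h.reaches_of_mem he
  exact hb.mem_of_reaches e ((reaches_arrow e).trans h2) (h2.trans (hv.trans h1))

theorem IsBase.eq_of_source_eq (hb : Γ.IsBase v₀ l) {e f : E} (he : e ∈ l) (hf : f ∈ l)
    (h : Γ.s e = Γ.s f) : e = f :=
  List.inj_on_of_nodup_map hb.nodup he hf h

/-- From the vertices of the end there is a unique path to the base point that only meets it at
the end. -/
theorem IsBase.path_unique (hb : Γ.IsBase v₀ l) {v : V} {q q' : List E} (h : Γ.IsPath v q v₀)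
    (h' : Γ.IsPath v q' v₀) (hq : ∀ e ∈ q, Γ.s e ≠ v₀) (hq' : ∀ e ∈ q', Γ.s e ≠ v₀)
    (hv : Γ.Reaches v₀ v) : q = q' :=
  h.unique h' hq hq' fun _ he _ hf hef =>
    hb.eq_of_source_eq (hb.mem_of_path h hv he) (hb.mem_of_path h' hv hf) hef

/-- A repeated source would put the arrow `e` on a closed path, hence on `l`. From its source the
path to the base point is then unique, but the whole path and its part from the repetition on have
different lengths. -/
theorem IsBase.nodup_path (hb : Γ.IsBase v₀ l) {v : V} {q : List E} (h : Γ.IsPath v q v₀)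
    (hq : ∀ e ∈ q, Γ.s e ≠ v₀) : (q.map Γ.s).Nodup := by
  induction q generalizing v with
  | nil => simp
  | cons e q ih =>
    obtain ⟨rfl, h⟩ := h
    rw [List.map_cons, List.nodup_cons]
    refine ⟨fun hmem => ?_, ih h fun f hf => hq f (by simp [hf])⟩
    obtain ⟨f, hf, hfe⟩ := List.mem_map.1 hmem
    have hreach := (h.reaches_of_mem hf).1
    rw [hfe] at hreach
    have hel : e ∈ l := hb.mem_of_reaches e ((reaches_arrow e).trans h.reaches) hreach
    have hv : Γ.Reaches v₀ (Γ.s e) := (hb.path.reaches_of_mem hel).1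
    obtain ⟨q₁, q₂, rfl⟩ := List.append_of_mem hf
    obtain ⟨x, -, h2⟩ := isPath_append.1 h
    have := hb.path_unique (v := Γ.s e) (q := e :: (q₁ ++ f :: q₂)) (q' := f :: q₂) ⟨rfl, h⟩
      ⟨hfe, h2.2⟩ hq (fun g hg => hq g (by
        rw [List.mem_cons, List.mem_append]
        exact Or.inr (Or.inr hg))) hv
    have := congrArg List.length this
    simp at this
    omega

variable (Γ v₀) in
/-- The paths to `v₀` that only meet it at the end. -/
abbrev PathTo : Type _ := {x : V × List E // Γ.IsPath x.1 x.2 v₀ ∧ ∀ e ∈ x.2, Γ.s e ≠ v₀}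

/-- The arrows come from a finite set, by row-finiteness and finiteness of the predecessors, and
distinct sources bound the length. -/
theorem finite_pathTo (hΓ : Γ.RowFinite) (hb : Γ.IsBase v₀ l) : Finite (Γ.PathTo v₀) := by
  have hA : {e : E | Γ.s e ∈ Γ.pred v₀}.Finite :=
    (hb.finite.biUnion fun v _ => hΓ v).subset fun e he => Set.mem_biUnion he rfl
  have := hA.to_subtype
  have := Fintype.ofFinite {e : E | Γ.s e ∈ Γ.pred v₀}
  have hL : ((fun q : List {e : E | Γ.s e ∈ Γ.pred v₀} => q.map Subtype.val) ''
      {q | q.length ≤ Fintype.card {e : E | Γ.s e ∈ Γ.pred v₀}}).Finite :=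
    (List.finite_length_le _ _).image _
  refine ((hb.finite.prod hL).subset ?_).to_subtype
  rintro ⟨v, q⟩ ⟨h, hq⟩
  refine ⟨h.reaches, ?_⟩
  have hmem : ∀ e ∈ q, e ∈ {e : E | Γ.s e ∈ Γ.pred v₀} := fun e he =>
    (reaches_arrow e).trans (h.reaches_of_mem he).2
  lift q to List {e : E | Γ.s e ∈ Γ.pred v₀} using hmem
  exact ⟨q, ((hb.nodup_path h hq).of_map _).of_map _ |>.length_le_card, rfl⟩

/-- The trivial path. -/
def trivialPath (v₀ : V) : Γ.PathTo v₀ := ⟨(v₀, []), rfl, by simp⟩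

theorem IsBase.tail_avoids {e : E} (hb : Γ.IsBase v₀ (e :: l)) : ∀ f ∈ l, Γ.s f ≠ v₀ := by
  intro f hf h
  have := hb.nodup
  rw [List.map_cons, List.nodup_cons, hb.path.1, ← h] at this
  exact this.1 (List.mem_map_of_mem hf)

/-- The first arrow of a path to the base point; the trivial path starts with the loop. -/
def pathHd (l : List E) (x : Γ.PathTo v₀) : Option E :=
  match x with
  | ⟨(_, []), _⟩ => l.head?
  | ⟨(_, e :: _), _⟩ => some e

/-- The rest of a path to the base point. -/
def pathTl (hb : Γ.IsBase v₀ l) (x : Γ.PathTo v₀) : Γ.PathTo v₀ :=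
  match x with
  | ⟨(_, []), _⟩ =>
    match l, hb with
    | [], _ => trivialPath v₀
    | e :: l, hb => ⟨(Γ.t e, l), hb.path.2, hb.tail_avoids⟩
  | ⟨(_, e :: q), h⟩ => ⟨(Γ.t e, q), h.1.2, fun f hf => h.2 f (List.mem_cons_of_mem e hf)⟩

open scoped Classical in
/-- Prolonging a path to the base point. -/
noncomputable def pathCons (e : E) (y : Γ.PathTo v₀) : Γ.PathTo v₀ :=
  if h : y.1.1 = Γ.t e ∧ Γ.s e ≠ v₀ then
    ⟨(Γ.s e, e :: y.1.2), ⟨rfl, h.1 ▸ y.2.1⟩, by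
      simpa using ⟨h.2, y.2.2⟩⟩
  else trivialPath v₀

theorem pathCons_of_ne {e : E} {y : Γ.PathTo v₀} (h : y.1.1 = Γ.t e) (he : Γ.s e ≠ v₀) :
    pathCons e y = ⟨(Γ.s e, e :: y.1.2), ⟨rfl, h ▸ y.2.1⟩, by simpa using ⟨he, y.2.2⟩⟩ :=
  dif_pos ⟨h, he⟩

theorem pathCons_of_eq {e : E} (y : Γ.PathTo v₀) (he : Γ.s e = v₀) :
    pathCons e y = trivialPath v₀ :=
  dif_neg fun h => h.2 he

theorem eq_trivialPath_iff {x : Γ.PathTo v₀} : x.1.1 = v₀ ↔ x = trivialPath v₀ := by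
  constructor
  · obtain ⟨⟨v, q⟩, h1, h2⟩ := x
    intro h
    obtain rfl : v = v₀ := h
    cases q with
    | nil => rfl
    | cons e q => exact absurd h1.1 (h2 e (by simp))
  · rintro rfl
    rfl

/-- An arrow at the base point from whose target one can return lies on `l` by maximality. It is the
first arrow there, the sources being distinct, and the way back is unique. -/
theorem IsBase.exists_cons (hb : Γ.IsBase v₀ l) {e : E} {y : Γ.PathTo v₀} (h : y.1.1 = Γ.t e)
    (he : Γ.s e = v₀) : l = e :: y.1.2 := by
  obtain ⟨⟨v, q⟩, h1, h2⟩ := y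
  obtain rfl : v = Γ.t e := h
  have hel : e ∈ l := hb.mem_of_reaches e (he ▸ reaches_refl _) (he ▸ h1.reaches)
  cases l with
  | nil => simp at hel
  | cons f l =>
    obtain rfl := hb.eq_of_source_eq hel (by simp) (he.trans hb.path.1.symm)
    rw [hb.path_unique hb.path.2 h1 hb.tail_avoids h2 (he ▸ reaches_arrow e)]

/-- The branching system of the paths to the base point of an end. -/
noncomputable def pathSystem (hb : Γ.IsBase v₀ l) : Γ.BranchingSystem (Γ.PathTo v₀) where
  src x := x.1.1
  hd := pathHd l
  tl := pathTl hb
  cons := pathCons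
  src_cons := by
    intro e y h
    -- Prolonging by an arrow at the base point completes the loop, which is identified with the
    -- trivial path.
    by_cases he : Γ.s e = v₀
    · rw [pathCons_of_eq y he, he]
      rfl
    · rw [pathCons_of_ne h he]
  hd_cons := by
    intro e y h
    by_cases he : Γ.s e = v₀
    · rw [pathCons_of_eq y he, hb.exists_cons h he]
      rfl
    · rw [pathCons_of_ne h he]
      rfl
  tl_cons := by
    intro e y h
    by_cases he : Γ.s e = v₀
    · rw [pathCons_of_eq y he]
      have hl := hb.exists_cons h he
      subst hl
      exact Subtype.ext (Prod.ext h.symm rfl)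
    · rw [pathCons_of_ne h he]
      exact Subtype.ext (Prod.ext h.symm rfl)
  src_of_hd := by
    rintro e ⟨⟨v, _ | ⟨f, q⟩⟩, h1, h2⟩ he
    · obtain rfl : v = v₀ := h1
      cases l with
      | nil => simp [pathHd] at he
      | cons f l =>
        obtain rfl : f = e := Option.some.inj he
        exact hb.path.1.symm
    · obtain rfl : f = e := Option.some.inj he
      exact h1.1.symm
  src_tl := by
    rintro e ⟨⟨v, _ | ⟨f, q⟩⟩, h1, h2⟩ he
    · cases l with
      | nil => simp [pathHd] at he
      | cons f l =>
        obtain rfl : f = e := Option.some.inj he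
        rfl
    · obtain rfl : f = e := Option.some.inj he
      rfl
  cons_tl := by
    rintro e ⟨⟨v, _ | ⟨f, q⟩⟩, h1, h2⟩ he
    · obtain rfl : v = v₀ := h1
      cases l with
      | nil => simp [pathHd] at he
      | cons f l =>
        obtain rfl : f = e := Option.some.inj he
        exact pathCons_of_eq _ hb.path.1
    · obtain rfl : f = e := Option.some.inj he
      exact (pathCons_of_ne rfl (h2 f (by simp))).trans (Subtype.ext (Prod.ext h1.1 rfl))
  sink := by
    rintro ⟨⟨v, _ | ⟨f, q⟩⟩, h1, h2⟩ he
    · obtain rfl : v = v₀ := h1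
      exact hb.sink (List.head?_eq_none_iff.1 he)
    · simp [pathHd] at he

/-- Transport of a branching system along a bijection. -/
def BranchingSystem.transport {I J : Type*} (B : Γ.BranchingSystem I) (φ : I ≃ J) :
    Γ.BranchingSystem J where
  src x := B.src (φ.symm x)
  hd x := B.hd (φ.symm x)
  tl x := φ (B.tl (φ.symm x))
  cons e y := φ (B.cons e (φ.symm y))
  src_cons h := by rw [φ.symm_apply_apply, B.src_cons h]
  hd_cons h := by rw [φ.symm_apply_apply, B.hd_cons h]
  tl_cons h := by rw [φ.symm_apply_apply, B.tl_cons h, φ.apply_symm_apply]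
  src_of_hd h := B.src_of_hd h
  src_tl h := by rw [φ.symm_apply_apply, B.src_tl h]
  cons_tl h := by rw [φ.symm_apply_apply, B.cons_tl h, φ.apply_symm_apply]
  sink h := B.sink h

/-- The index set is moved to `Fin n` so that the module of functions stays in the universe of `W`.
-/
theorem exists_branchingSystem (hΓ : Γ.RowFinite) (hb : Γ.IsBase v₀ l) :
    ∃ (n : ℕ) (B : Γ.BranchingSystem (Fin n)) (x₀ : Fin n),
      (∀ x, B.src x = v₀ ↔ x = x₀) ∧ ∀ x, Γ.Reaches (B.src x) v₀ := by
  have := finite_pathTo hΓ hb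
  let φ := Finite.equivFin (Γ.PathTo v₀)
  refine ⟨_, (pathSystem hb).transport φ, φ (trivialPath v₀), fun x => ?_, fun x => ?_⟩
  · rw [← φ.symm_apply_eq]
    exact eq_trivialPath_iff
  · exact (φ.symm x).2.1.reaches

end PathSystem

/-! ### Realization of all types -/

section Existence

variable {F : Type uF} [Field F] {V : Type uV} {E : Type uE} {Γ : DiGraph V E}

/-- Every automorphism of a finite dimensional space is realized by a module that is supported on
the predecessors of an end. -/
theorem exists_module (hΓ : Γ.RowFinite) (u : Γ.FinMaxSink ⊕ Γ.FinMaxCycle)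
    (W : Type (max uF w)) [AddCommGroup W] [Module F W] [FiniteDimensional F W] (τ : W ≃ₗ[F] W) :
    ∃ M : FDModule.{uV, uE, uF, max uF w} F Γ, suppPart F Γ M (Γ.endPred u) = ⊤ ∧
      ∃ φ : vertexSpace F Γ M (basePt u) ≃ₗ[F] W, basePath u ≠ [] →
        ∀ m, φ (loopEnd F Γ M (basePt u) (basePath u) m) = τ (φ m) := by
  classical
  have hb := isBase u
  obtain ⟨n, B, x₀, h₀, hB⟩ := exists_branchingSystem hΓ hb
  -- The twist sits at the base point only, so one turn around the loop applies `τ` exactly once.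
  let θ : V → (W ≃ₗ[F] W) := fun v => if v = basePt u then τ else LinearEquiv.refl F W
  refine ⟨{ carrier := B.Mod θ, unital := BranchingSystem.isUnital }, ?_,
    BranchingSystem.vertexSpaceEquiv B θ h₀, ?_⟩
  · refine eq_top_iff.2 (le_suppPart fun m _ v hv =>
      BranchingSystem.mod_ext (B := B) (θ := θ) fun x => ?_)
    refine (BranchingSystem.coeff_vtx_smul v m x).trans ((if_neg ?_).trans (map_zero _).symm)
    rintro rfl
    rw [endPred_eq] at hv
    exact hv (hB x)
  · intro hl m
    rw [BranchingSystem.vertexSpaceEquiv_apply, coe_loopEnd hb.path]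
    generalize basePath u = l at hb hl
    cases l with
    | nil => exact absurd rfl hl
    | cons e l =>
      rw [BranchingSystem.coeff_loop_smul hb.path (fun f hf => if_neg (hb.tail_avoids f hf)) h₀]
      rw [show θ (basePt u) = τ from if_pos rfl, BranchingSystem.vertexSpaceEquiv_apply]

theorem exists_sink_module (hΓ : Γ.RowFinite) (w : Γ.FinMaxSink) (n : ℕ) :
    ∃ M : FDModule.{uV, uE, uF, max uF w} F Γ, suppPart F Γ M (Γ.endPred (Sum.inl w)) = ⊤ ∧
      Module.finrank F (vertexSpace F Γ M w.1) = n := by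
  obtain ⟨M, h, φ, -⟩ := exists_module hΓ (Sum.inl w) (ULift.{max uF w} (Fin n → F))
    (LinearEquiv.refl F _)
  refine ⟨M, h, φ.finrank_eq.trans ?_⟩
  rw [ULift.moduleEquiv.finrank_eq, Module.finrank_fin_fun]

theorem exists_cycle_module (hΓ : Γ.RowFinite) (K : Γ.FinMaxCycle) (f : IrredPoly F) (n : ℕ) :
    ∃ M : FDModule.{uV, uE, uF, max uF w} F Γ, suppPart F Γ M (Γ.endPred (Sum.inr K)) = ⊤ ∧
      IsCyclicOfType F Γ M K.1 (f.1 ^ n) := by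
  have hne : f.1 ^ n ≠ 0 := pow_ne_zero n f.2.1.ne_zero
  let A := F[X] ⧸ Ideal.span {f.1 ^ n}
  have hfd : FiniteDimensional F A := (AdjoinRoot.powerBasis hne).finite
  -- As `f(0) = 1`, the polynomial `f` is not associated to `X`; so `X` is invertible modulo `f ^
  -- n`, and multiplication by it is an automorphism that can be realized.
  have hcop : IsCoprime (f.1 ^ n) Polynomial.X := by
    refine IsCoprime.pow_left ?_
    rcases EuclideanDomain.dvd_or_coprime f.1 Polynomial.X f.2.1 with h | h
    · have h0 := X_dvd_iff.1 (f.2.1.associated_of_dvd irreducible_X h).symm.dvd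
      rw [coeff_zero_eq_eval_zero, f.2.2] at h0
      exact absurd h0 one_ne_zero
    · exact h
  let μ : A →ₗ[F] A := LinearMap.mulLeft F (Ideal.Quotient.mk _ Polynomial.X)
  have hμ : Function.Injective μ := by
    obtain ⟨a, b, hab⟩ := hcop
    have h1 : Ideal.Quotient.mk (Ideal.span {f.1 ^ n}) b * Ideal.Quotient.mk _ Polynomial.X = 1 := by
      rw [← map_mul, ← map_one (Ideal.Quotient.mk _), ← hab, map_add,
        Ideal.Quotient.eq_zero_iff_mem.2 (Ideal.mul_mem_left _ a (Ideal.mem_span_singleton_self _)),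
        zero_add]
    intro x y hxy
    have h2 := congrArg (Ideal.Quotient.mk (Ideal.span {f.1 ^ n}) b * ·) hxy
    simpa only [μ, LinearMap.mulLeft_apply, ← mul_assoc, h1, one_mul] using h2
  let σ : A ≃ₗ[F] A := LinearEquiv.ofInjectiveEndo μ hμ
  obtain ⟨M, h, φ, hφ⟩ := exists_module hΓ (Sum.inr K) (ULift.{max uF w} A)
    ((ULift.moduleEquiv.trans σ).trans ULift.moduleEquiv.symm)
  refine ⟨M, h, (isCyclicOfType_iff_fib K _).2 ⟨(LinearEquiv.ofAEval _
    (φ.trans (ULift.moduleEquiv (R := F) (M := A))) fun m => ?_).symm⟩⟩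
  have h1 := congrArg ULift.down (hφ (by simp [basePath]) m)
  exact h1

end Existence

end DiGraph

/-! ### The classification -/

theorem mainTheorem1 {F : Type uF} [Field F] {V : Type uV} {E : Type uE}
    (Γ : DiGraph V E) (hΓ : Γ.RowFinite) :
    ∃ (D : ∀ M : FDModule.{uV, uE, uF, max uF w} F Γ, Γ.FinMaxSink ⊕ Γ.FinMaxCycle → Submodule (Scalars F Γ) M)
      (P : ∀ M : FDModule.{uV, uE, uF, max uF w} F Γ, Γ.FinMaxCycle → IrredPoly F → Submodule (Scalars F Γ) M),
      -- the functorial decomposition along maximal sinks and cycles with finite predecessor sets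
      (∀ M : FDModule.{uV, uE, uF, max uF w} F Γ, IsDirectSumOf ⊤ (D M)) ∧
      (∀ (M : FDModule.{uV, uE, uF, max uF w} F Γ) (u : Γ.FinMaxSink ⊕ Γ.FinMaxCycle),
        D M u ≠ ⊥ → vertexSupport F Γ (D M u) = Γ.endPred u) ∧
      (∀ (M M' : FDModule.{uV, uE, uF, max uF w} F Γ) (g : M →ₗ[Scalars F Γ] M')
        (u : Γ.FinMaxSink ⊕ Γ.FinMaxCycle), (D M u).map g ≤ D M' u) ∧
      -- the summands belonging to a sink
      (∀ (w : Γ.FinMaxSink) (M M' : FDModule.{uV, uE, uF, max uF w} F Γ),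
        Nonempty (D M (Sum.inl w) ≃ₗ[Scalars F Γ] D M' (Sum.inl w)) ↔
          Module.finrank F (vertexSpace F Γ (D M (Sum.inl w)) w.1) =
            Module.finrank F (vertexSpace F Γ (D M' (Sum.inl w)) w.1)) ∧
      (∀ (w : Γ.FinMaxSink) (n : ℕ), ∃ M : FDModule.{uV, uE, uF, max uF w} F Γ,
        D M (Sum.inl w) = ⊤ ∧ Module.finrank F (vertexSpace F Γ M w.1) = n) ∧
      (∀ (w : Γ.FinMaxSink) (M : FDModule.{uV, uE, uF, max uF w} F Γ),
        (IsIndecomposable (Scalars F Γ) (D M (Sum.inl w)) ↔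
          Module.finrank F (vertexSpace F Γ (D M (Sum.inl w)) w.1) = 1) ∧
        (Module.finrank F (vertexSpace F Γ (D M (Sum.inl w)) w.1) = 1 ↔
          IsSimpleModule (Scalars F Γ) (D M (Sum.inl w)))) ∧
      -- the primary decomposition of the summands belonging to a cycle
      (∀ (M : FDModule.{uV, uE, uF, max uF w} F Γ) (C : Γ.FinMaxCycle),
        IsDirectSumOf (D M (Sum.inr C)) (P M C)) ∧
      (∀ (M : FDModule.{uV, uE, uF, max uF w} F Γ) (C : Γ.FinMaxCycle) (f : IrredPoly F),
        IsPrimary F Γ (P M C f) C.1 f.1) ∧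
      (∀ (M M' : FDModule.{uV, uE, uF, max uF w} F Γ) (g : M →ₗ[Scalars F Γ] M')
        (C : Γ.FinMaxCycle) (f : IrredPoly F), (P M C f).map g ≤ P M' C f) ∧
      -- the indecomposable summands of the primary parts
      (∀ (M : FDModule.{uV, uE, uF, max uF w} F Γ) (C : Γ.FinMaxCycle) (f : IrredPoly F),
        ∃ (k : ℕ) (Q : Fin k → Submodule (Scalars F Γ) M),
          IsDirectSumOf (P M C f) Q ∧ ∀ i, IsIndecomposable (Scalars F Γ) (Q i)) ∧
      (∀ (M : FDModule.{uV, uE, uF, max uF w} F Γ) (C : Γ.FinMaxCycle) (f : IrredPoly F)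
        (Q : Submodule (Scalars F Γ) M),
        IsSummandOf Q (P M C f) → IsIndecomposable (Scalars F Γ) Q →
        ∃! n : ℕ, 1 ≤ n ∧ IsCyclicOfType F Γ Q C.1 (f.1 ^ n)) ∧
      (∀ (M M' : FDModule.{uV, uE, uF, max uF w} F Γ) (C : Γ.FinMaxCycle) (f : IrredPoly F)
        (Q : Submodule (Scalars F Γ) M) (Q' : Submodule (Scalars F Γ) M') (n n' : ℕ),
        IsSummandOf Q (P M C f) → IsIndecomposable (Scalars F Γ) Q →
        IsSummandOf Q' (P M' C f) → IsIndecomposable (Scalars F Γ) Q' →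
        IsCyclicOfType F Γ Q C.1 (f.1 ^ n) → IsCyclicOfType F Γ Q' C.1 (f.1 ^ n') →
        (Nonempty (Q ≃ₗ[Scalars F Γ] Q') ↔ n = n')) ∧
      (∀ (M : FDModule.{uV, uE, uF, max uF w} F Γ) (C : Γ.FinMaxCycle) (f : IrredPoly F)
        (Q : Submodule (Scalars F Γ) M) (n : ℕ),
        IsSummandOf Q (P M C f) → IsIndecomposable (Scalars F Γ) Q →
        IsCyclicOfType F Γ Q C.1 (f.1 ^ n) →
        (n = 1 ↔ IsSimpleModule (Scalars F Γ) Q)) ∧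
      (∀ (C : Γ.FinMaxCycle) (f : IrredPoly F) (n : ℕ), 1 ≤ n → ∃ M : FDModule.{uV, uE, uF, max uF w} F Γ,
        P M C f = ⊤ ∧ IsIndecomposable (Scalars F Γ) M ∧
          IsCyclicOfType F Γ M C.1 (f.1 ^ n)) := by
  refine ⟨fun M u => suppPart F Γ M (Γ.endPred u), fun M K f => primPart F Γ M K f,
    fun M => ⟨iSupIndep_suppPart hΓ M.unital, iSup_suppPart hΓ M.unital⟩,
    fun M u hne => vertexSupport_suppPart hΓ M.unital u hne,
    fun M M' g u => suppPart_map g _, fun w M M' => ?_, fun w n => exists_sink_module hΓ w n,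
    fun w M => ?_, fun M K => ⟨iSupIndep_primPart hΓ M.unital K, iSup_primPart hΓ M.unital K⟩,
    fun M K f => isPrimary_primPart K f, fun M M' g K f => primPart_map g K f,
    fun M K f => ?_, fun M K f Q hQ hind => existsUnique_isCyclicOfType hΓ M.unital hQ.le hind,
    fun M M' K f Q Q' n n' hQ _ hQ' _ hn hn' => ?_, fun M K f Q n hQ _ hn => ?_,
    fun K f n hn => ?_⟩
  · exact nonempty_equiv_iff_of_sink hΓ (M.unital.submodule _) (M'.unital.submodule _) w
      (suppPart_eq_top_of_le le_rfl) (suppPart_eq_top_of_le le_rfl)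
  · exact ⟨isIndecomposable_iff_of_sink hΓ (M.unital.submodule _) w
      (suppPart_eq_top_of_le le_rfl), isSimpleModule_iff_of_sink hΓ (M.unital.submodule _) w
      (suppPart_eq_top_of_le le_rfl)⟩
  -- Submodules are subspaces, so finite dimension gives the descending chain condition.
  · have : IsArtinian (Scalars F Γ) M := isArtinian_of_tower F inferInstance
    exact exists_isDirectSumOf_indecomposable _
  · exact nonempty_equiv_iff_of_isCyclicOfType hΓ (M.unital.submodule Q) (M'.unital.submodule Q')
      (suppPart_eq_top_of_le_primPart hQ.le) (suppPart_eq_top_of_le_primPart hQ'.le) hn hn'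
  · exact eq_one_iff_isSimpleModule hΓ (M.unital.submodule Q)
      (suppPart_eq_top_of_le_primPart hQ.le) hn
  · obtain ⟨M, hM, htype⟩ := exists_cycle_module hΓ K f n
    exact ⟨M, primPart_eq_top_of_isCyclicOfType hM htype,
      isIndecomposable_of_isCyclicOfType hΓ M.unital hM hn htype, htype⟩
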